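/- Let $p$ be a prime, $d\ge 2$ an integer, $F$ a field of characteristic $p$, and let $X$ and $Y$ be connected finite $d$-dimensional CW-complexes. Write $b_n(Z;F)=\dim_F H_n(Z;F)$ and $$\beta^{\inf,p}_n(Y;F)=\inf_{Y'\to Y}\frac{b_n(Y';F)}{|Y'\to Y|},$$ where the infimum runs over all connected regular coverings $Y'\to Y$ whose number of sheets $|Y'\to Y|$ is a (finite) power of $p$. A group is residually (finite $p$-group) if every nontrivial element has nontrivial image in some quotient that is a finite $p$-group; let $\mathcal{RF}_p$ be the class of these groups. An $\mathcal{RF}_p$-tower from $X$ to $Y$ is a sequence of maps $$X=Y_n\xrightarrow{i_n}\overline{Y_n}\xrightarrow{q_n}Y_{n-1}\xrightarrow{i_{n-1}}\overline{Y_{n-1}}\xrightarrow{q_{n-1}}\cdots\xrightarrow{i_1}\overline{Y_1}\xrightarrow{q_1}Y_0=Y,\qquad n\ge 1,$$ in which each $q_k$ is a regular covering, i.e. a principal $G_k$-bundle for a discrete group $G_k\in\mathcal{RF}_p$ (with $\overline{Y_k}$ carrying the lifted CW-structure; it need be neither connected nor finite), and each $i_k$ is the inclusion of a finite subcomplex.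 Suppose that there is an $\mathcal{RF}_p$-tower from $X$ to $Y$ and that $\beta^{\inf,p}_d(Y;F)=0$. Then: 1. $\beta^{\inf,p}_d(X;F)=0$. 2. If $d=2$, then either $\chi(X)\le 0$, or $b_1(X;F)=b_2(X;F)=0$ (and hence $\chi(X)=1$). -/

import Mathlib

universe u v

/-- The `n`-th singular homology of the space `X` with coefficients in the field `F`. -/
noncomputable abbrev singularHomologyOver (F : Type v) [Field F] (n : ℕ)
    (X : Type u) [TopologicalSpace X] : ModuleCat.{max u v} F :=
  ((AlgebraicTopology.singularHomologyFunctor (ModuleCat.{max u v} F) n).obj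
    (ModuleCat.of F (ULift.{u} F))).obj (TopCat.of X)

/-- The `n`-th Betti number `b_n(X; F) = dim_F H_n(X; F)`. -/
noncomputable def bettiNumber (F : Type v) [Field F] (n : ℕ)
    (X : Type u) [TopologicalSpace X] : ℕ :=
  Module.finrank F (singularHomologyOver.{u, v} F n X)

/-- A CW-complex: a Hausdorff space with a CW-structure on the whole space. -/
structure CWSpace : Type (u + 1) where
  carrier : Type u
  [topologicalSpace : TopologicalSpace carrier]
  [t2Space : T2Space carrier]
  [cwComplex : Topology.CWComplex (Set.univ : Set carrier)]

namespace CWSpace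

instance : CoeSort CWSpace.{u} (Type u) := ⟨CWSpace.carrier⟩

attribute [instance] topologicalSpace t2Space cwComplex

/-- The (indexing type of the) `n`-cells. -/
def Cell (X : CWSpace.{u}) (n : ℕ) : Type u :=
  Topology.RelCWComplex.cell (Set.univ : Set X) n

/-- The open cell with index `e`. -/
def openCell (X : CWSpace.{u}) {n : ℕ} (e : X.Cell n) : Set X :=
  Topology.RelCWComplex.openCell (C := (Set.univ : Set X)) n e

/-- `X` has only finitely many cells. -/
def IsFinite (X : CWSpace.{u}) : Prop :=
  Topology.RelCWComplex.Finite (Set.univ : Set X)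

/-- `X` is `d`-dimensional: there is a `d`-cell and there are no cells of higher dimension. -/
def HasDimension (X : CWSpace.{u}) (d : ℕ) : Prop :=
  Nonempty (X.Cell d) ∧ ∀ n, d < n → IsEmpty (X.Cell n)

/-- The Euler characteristic `∑ (-1)^n · #{n-cells}` of a finite CW-complex. -/
noncomputable def eulerCharacteristic (X : CWSpace.{u}) : ℤ :=
  ∑ᶠ n : ℕ, (-1 : ℤ) ^ n * (Nat.card (X.Cell n) : ℤ)

/-- `f` maps every open `n`-cell of `X` bijectively onto an open `n`-cell of `Y`. -/
def MapsCellsBijectively {X Y : CWSpace.{u}} (f : X → Y) : Prop :=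
  ∀ (n : ℕ) (e : X.Cell n), ∃ e' : Y.Cell n, Set.BijOn f (X.openCell e) (Y.openCell e')

/-- `i` is the inclusion of a subcomplex, i.e. an isomorphism of CW-complexes from `X` onto a
subcomplex of `Y` (a closed subspace that is a union of open cells of `Y`). -/
structure IsSubcomplexInclusion {X Y : CWSpace.{u}} (i : X → Y) : Prop where
  isClosedEmbedding : Topology.IsClosedEmbedding i
  mapsCells : MapsCellsBijectively i

/-- `q : Z → Y` is a regular covering of CW-complexes with group `G`: it is a principal `G`-bundle
for the discrete group `G`, and `Z` carries the CW-structure lifted from `Y`, i.e. the open cells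
of `Z` are the sheets of `q` over the open cells of `Y`. If `Z` is connected, then `G` is the
group of deck transformations of `q`. The total space `Z` need be neither connected nor finite. -/
structure IsRegularCovering (G : Type u) [Group G] {Z Y : CWSpace.{u}} [MulAction G Z]
    (q : Z → Y) : Prop where
  isQuotientCoveringMap : IsQuotientCoveringMap q G
  mapsCells : MapsCellsBijectively q

/-- `f : X → Y` is an elementary `𝓕`-tower: it factors as the inclusion of a finite subcomplex `X`
into a regular covering of `Y` whose covering group belongs to the family of groups `𝓕`. -/
def IsElementaryTower (𝓕 : (G : Type u) → [Group G] → Prop) (X Y : CWSpace.{u})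
    (f : X → Y) : Prop :=
  X.IsFinite ∧ ∃ (Z : CWSpace.{u}) (G : Type u) (_ : Group G) (_ : MulAction G Z)
    (i : X → Z) (q : Z → Y),
    𝓕 G ∧ IsSubcomplexInclusion i ∧ IsRegularCovering G q ∧ f = q ∘ i

/-- `IsTower 𝓕 X Y f`: the map `f : X → Y` is the underlying map of an `𝓕`-tower (of some length
`n ≥ 1`) with source `X` and target `Y`. -/
inductive IsTower (𝓕 : (G : Type u) → [Group G] → Prop) (Y : CWSpace.{u}) :
    (X : CWSpace.{u}) → (X → Y) → Prop where
  | elementary (X : CWSpace.{u}) (f : X → Y) : IsElementaryTower 𝓕 X Y f → IsTower 𝓕 Y X f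
  | step (X Y' : CWSpace.{u}) (f : X → Y') (g : Y' → Y) :
      IsTower 𝓕 Y Y' g → IsElementaryTower 𝓕 X Y' f → IsTower 𝓕 Y X (g ∘ f)

end CWSpace

/-- The class of residually (finite `p`-) groups: every nontrivial element survives in some
quotient that is a finite `p`-group. -/
def ResiduallyFiniteP (p : ℕ) (G : Type u) [Group G] : Prop :=
  ∀ g : G, g ≠ 1 → ∃ (N : Subgroup G) (_ : N.Normal), Finite (G ⧸ N) ∧ IsPGroup p (G ⧸ N) ∧ g ∉ N

/-- `β^{inf,p}_n(Y; F)`: the infimum of `b_n(Y'; F) / |Y' → Y|` over all regular coverings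
`Y' → Y` with connected total space whose number of sheets is a power of `p`. As `Y'` is connected,
`G` is the group of deck transformations, and its order is the number of sheets; so these are the
coverings belonging to the normal subgroups of `p`-power index of the fundamental group. -/
noncomputable def betaInfP (p : ℕ) (F : Type v) [Field F] (n : ℕ)
    (Y : Type u) [TopologicalSpace Y] : ℝ :=
  sInf {r : ℝ | ∃ (Y' : Type u) (_ : TopologicalSpace Y') (_ : ConnectedSpace Y')
    (G : Type u) (_ : Group G) (_ : MulAction G Y') (q : Y' → Y) (m : ℕ),
    IsQuotientCoveringMap q G ∧ Nat.card G = p ^ m ∧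
      r = (bettiNumber.{u, v} F n Y' : ℝ) / (Nat.card G : ℝ)}

-- The argument runs on the property `HasSmallCoverings`: there are regular coverings `E → Y` whose
-- group `H` is a finite `p`-group, `E` possibly disconnected, with `b_d(E) / |H|` arbitrarily
-- small. For a connected `Y` it follows at once from the vanishing of the infimum. Conversely, let
-- `C` be a path component of such an `E` over a connected finite complex of dimension at most `d`.
-- It is a regular covering with group its stabilizer `S`, and its `[H : S]` translates are disjoint
-- and clopen, so `b_d(C) / |S| ≤ b_d(E) / |H|` (`exists_component`,
-- `HasSmallCoverings.betaInfP_eq_zero`).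
--
-- The property climbs one stage `X ⊆ Z → Y` of a tower (`HasSmallCoverings.of_elementary`). Since
-- `X` is compact, only finitely many elements of the residually (finite `p`-) group `G` relate
-- points of `X`. Hence some normal `N` with `|G/N| = p^k` keeps `X → Z/N` injective. Given a small
-- covering `E → Y` with group `H`, the pullback of `E` to `X` is a regular covering with group `H`,
-- and it embeds as a subcomplex of `E ×_Y Z/N`. The latter covers `E` with group `G/N`. Two
-- inequalities finish the step. In degree at least the dimension, the Betti number of a subcomplex
-- is at most that of the whole complex. In characteristic `p`, Betti numbers grow at most by the
-- factor `|G/N|` in a regular covering with `p`-group `G/N`. So `b_d` of the pullback is at most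
-- `p^k b_d(E)`, and `p^k` does not depend on `E`.
--
-- The second inequality (`bettiNumber_le_of_card_eq_prime_pow`) reduces to order `p` through a
-- central subgroup. If `t` generates the group, then `T = t - 1` satisfies `T^p = 0` on singular
-- chains of `E`, and its kernel is the image of the transfer, which equals the image of `T^(p-1)`
-- because `1 + t + ... + t^(p-1) = (t - 1)^(p-1)` over `F`. Filtering by the images of the powers
-- of `T` bounds the Betti number upstairs by `p` times the one downstairs. The first inequality,
-- like the Euler characteristic formula, comes from Mayer–Vietoris applied cell by cell.
-- Mayer–Vietoris itself is derived from barycentric subdivision.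
--
-- For `d = 2`, take a connected covering `X' → X` of `g` sheets with `b_2(X') < g / 2`. Then `g
-- χ(X) = 1 - b_1(X') + b_2(X') < 1 + g / 2`. If `χ(X) ≥ 1`, this forces `g = 1`; so `X' = X`,
-- `b_2(X) = 0`, and `1 - b_1(X) = χ(X) ≥ 1` gives the rest.

universe w

/-! ### Chain complexes of vector spaces and their long exact sequences -/

section
open CategoryTheory

/-- A chain complex of vector spaces, in unbundled linear-algebra terms. -/
structure VectCx (F : Type v) [Field F] where
  X : ℕ → Type w
  [addCommGroup : ∀ n, AddCommGroup (X n)]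
  [module : ∀ n, Module F (X n)]
  d : ∀ n, X (n + 1) →ₗ[F] X n
  d_d : ∀ n x, d n (d (n + 1) x) = 0

namespace VectCx

variable {F : Type v} [Field F]

attribute [instance] addCommGroup module

/-- The associated chain complex in the category of modules. -/
noncomputable def toComplex (C : VectCx.{v, w} F) : ChainComplex (ModuleCat.{w} F) ℕ :=
  ChainComplex.of (fun n => ModuleCat.of F (C.X n)) (fun n => ModuleCat.ofHom (C.d n))
    (fun n => by ext x; exact C.d_d n x)

/-- Homology of a complex of vector spaces. -/
noncomputable abbrev H (C : VectCx.{v, w} F) (n : ℕ) : ModuleCat.{w} F := C.toComplex.homology n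

lemma toComplex_d (C : VectCx.{v, w} F) (n : ℕ) :
    C.toComplex.d (n + 1) n = ModuleCat.ofHom (C.d n) := by
  simp [toComplex]

/-- A chain map. -/
structure Hom (C D : VectCx.{v, w} F) where
  f : ∀ n, C.X n →ₗ[F] D.X n
  comm : ∀ n x, D.d n (f (n + 1) x) = f n (C.d n x)

/-- The associated morphism in the category of chain complexes. -/
noncomputable def Hom.toHom {C D : VectCx.{v, w} F} (φ : Hom C D) : C.toComplex ⟶ D.toComplex :=
  ChainComplex.ofHom (fun n => ModuleCat.ofHom (φ.f n)) fun n => by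
    rw [toComplex_d, toComplex_d]; ext x; exact φ.comm n x

/-- The linear map induced on homology. -/
noncomputable def Hom.map {C D : VectCx.{v, w} F} (φ : Hom C D) (n : ℕ) : C.H n →ₗ[F] D.H n :=
  (HomologicalComplex.homologyMap φ.toHom n).hom

/-- An isomorphism of complexes induces isomorphisms on homology. -/
lemma nonempty_H_equiv {C D : VectCx.{v, w} F} (φ : Hom C D)
    (h : ∀ n, Function.Bijective (φ.f n)) (n : ℕ) : Nonempty (C.H n ≃ₗ[F] D.H n) := by
  have h1 : ∀ i, IsIso (φ.toHom.f i) := fun i =>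
    (ConcreteCategory.isIso_iff_bijective (ModuleCat.ofHom (φ.f i))).2 (h i)
  have : IsIso φ.toHom := HomologicalComplex.Hom.isIso_of_components φ.toHom
  exact ⟨(asIso (HomologicalComplex.homologyMap φ.toHom n)).toLinearEquiv⟩

/-- The long exact homology sequence of a short exact sequence of complexes. -/
lemma exists_long_exact {A B C : VectCx.{v, w} F} (f : Hom A B) (g : Hom B C)
    (hf : ∀ n, Function.Injective (f.f n)) (hfg : ∀ n, Function.Exact (f.f n) (g.f n))
    (hg : ∀ n, Function.Surjective (g.f n)) :
    (∀ n, Function.Exact (f.map n) (g.map n)) ∧ Function.Surjective (g.map 0) ∧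
    ∃ δ : ∀ n, C.H (n + 1) →ₗ[F] A.H n,
      (∀ n, Function.Exact (g.map (n + 1)) (δ n)) ∧ ∀ n, Function.Exact (δ n) (f.map n) := by
  have h0 : f.toHom ≫ g.toHom = 0 := by
    ext n x
    exact (hfg n (f.f n x)).2 ⟨x, rfl⟩
  let S : ShortComplex (ChainComplex (ModuleCat.{w} F) ℕ) := ShortComplex.mk f.toHom g.toHom h0
  have hS : S.ShortExact := by
    apply HomologicalComplex.shortExact_of_degreewise_shortExact
    intro n
    have h1 : Mono (ModuleCat.ofHom (f.f n)) := (ModuleCat.mono_iff_injective _).2 (hf n)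
    have h2 : Epi (ModuleCat.ofHom (g.f n)) := (ModuleCat.epi_iff_surjective _).2 (hg n)
    exact { exact := (ShortComplex.ShortExact.moduleCat_exact_iff_function_exact _).2 (hfg n)
            mono_f := h1
            epi_g := h2 }
  refine ⟨fun n => ?_, ?_, fun n => (hS.δ (n + 1) n (by simp)).hom, fun n => ?_, fun n => ?_⟩
  · exact (ShortComplex.ShortExact.moduleCat_exact_iff_function_exact _).1 (hS.homology_exact₂ n)
  · have : Epi g.toHom := hS.epi_g
    have h2 : Epi (HomologicalComplex.homologyMap g.toHom 0) := by
      -- No differential leaves degree `0`, so every `0`-chain is a cycle and surjectivity on chains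
      -- descends to homology.
      apply HomologicalComplex.epi_homologyMap_of_epi_of_not_rel
      simp
    exact (ModuleCat.epi_iff_surjective _).1 h2
  · exact (ShortComplex.ShortExact.moduleCat_exact_iff_function_exact _).1
      (hS.homology_exact₃ (n + 1) n (by simp))
  · exact (ShortComplex.ShortExact.moduleCat_exact_iff_function_exact _).1
      (hS.homology_exact₁ (n + 1) n (by simp))

lemma Hom.map_id_of {C : VectCx.{v, w} F} (φ : Hom C C) (h : ∀ n x, φ.f n x = x) (n : ℕ)
    (x : C.H n) : φ.map n x = x := by
  have : φ.toHom = 𝟙 _ := by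
    ext n x
    exact h n x
  simp [Hom.map, this]

/-- Composition of chain maps. -/
def Hom.comp {C D E : VectCx.{v, w} F} (ψ : Hom D E) (φ : Hom C D) : Hom C E where
  f n := ψ.f n ∘ₗ φ.f n
  comm n x := by simp [ψ.comm, φ.comm]

lemma Hom.map_comp {C D E : VectCx.{v, w} F} (ψ : Hom D E) (φ : Hom C D) (n : ℕ) (x : C.H n) :
    (ψ.comp φ).map n x = ψ.map n (φ.map n x) := by
  have : (ψ.comp φ).toHom = φ.toHom ≫ ψ.toHom := by
    ext n x
    rfl
  simp [Hom.map, this, HomologicalComplex.homologyMap_comp]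

/-- A complex that is exact in every degree has no homology. -/
lemma subsingleton_H (C : VectCx.{v, w} F) (n : ℕ)
    (h : ∀ x : C.X n, (∀ m (e : n = m + 1), C.d m (e ▸ x) = 0) → ∃ y, C.d n y = x) :
    Subsingleton (C.H n) := by
  have : C.toComplex.ExactAt n := by
    -- Quantifying over `m` with `n = m + 1` expresses "`x` is a cycle" uniformly in `n`; in degree
    -- `0` the condition is vacuous.
    rcases n with _ | n
    · rw [HomologicalComplex.exactAt_iff' _ 1 0 0 (by simp) (by simp)]
      rw [ShortComplex.moduleCat_exact_iff]
      intro x _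
      obtain ⟨y, hy⟩ := h x (fun m e => by omega)
      refine ⟨y, ?_⟩
      have := C.toComplex_d 0
      change (C.toComplex.d (0 + 1) 0) y = x
      rw [this]; exact hy
    · rw [HomologicalComplex.exactAt_iff' _ (n + 2) (n + 1) n (by simp) (by simp)]
      rw [ShortComplex.moduleCat_exact_iff]
      intro x hx
      obtain ⟨y, hy⟩ := h x (fun m e => by
        obtain rfl : n = m := by omega
        change (C.toComplex.d (n + 1) n) x = 0 at hx
        rw [C.toComplex_d] at hx
        exact hx)
      refine ⟨y, ?_⟩
      change (C.toComplex.d (n + 1 + 1) (n + 1)) y = x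
      rw [C.toComplex_d]; exact hy
  exact ModuleCat.subsingleton_of_isZero this.isZero_homology

/-- The subcomplex with prescribed chain spaces. -/
def sub (C : VectCx.{v, w} F) (S : ∀ n, Submodule F (C.X n))
    (hS : ∀ n, ∀ x ∈ S (n + 1), C.d n x ∈ S n) : VectCx.{v, w} F where
  X n := S n
  d n := (C.d n).restrict (hS n)
  d_d n x := by ext; simp [C.d_d]

/-- The quotient by a subcomplex. -/
def quot (C : VectCx.{v, w} F) (S : ∀ n, Submodule F (C.X n))
    (hS : ∀ n, ∀ x ∈ S (n + 1), C.d n x ∈ S n) : VectCx.{v, w} F where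
  X n := C.X n ⧸ S n
  d n := (S (n + 1)).mapQ (S n) (C.d n) (hS n)
  d_d n x := by
    obtain ⟨x, rfl⟩ := Submodule.Quotient.mk_surjective _ x
    simp [C.d_d]

/-- Inclusion of a subcomplex. -/
def subIncl (C : VectCx.{v, w} F) (S : ∀ n, Submodule F (C.X n))
    (hS : ∀ n, ∀ x ∈ S (n + 1), C.d n x ∈ S n) : Hom (C.sub S hS) C where
  f n := (S n).subtype
  comm _ _ := rfl

/-- Projection to a quotient complex. -/
def quotProj (C : VectCx.{v, w} F) (S : ∀ n, Submodule F (C.X n))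
    (hS : ∀ n, ∀ x ∈ S (n + 1), C.d n x ∈ S n) : Hom C (C.quot S hS) where
  f n := (S n).mkQ
  comm _ _ := rfl

/-- If every relative cycle can be pushed into the subcomplex, the inclusion is a
quasi-isomorphism. -/
lemma bijective_subIncl_map (C : VectCx.{v, w} F) (S : ∀ n, Submodule F (C.X n))
    (hS : ∀ n, ∀ x ∈ S (n + 1), C.d n x ∈ S n)
    (h : ∀ n (x : C.X n), (∀ m (e : n = m + 1), C.d m (e ▸ x) ∈ S m) → ∃ y, x - C.d n y ∈ S n)
    (n : ℕ) : Function.Bijective ((C.subIncl S hS).map n) := by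
  obtain ⟨h1, -, δ, h3, h4⟩ := exists_long_exact (C.subIncl S hS) (C.quotProj S hS)
    (fun n => (S n).injective_subtype)
    (fun n => by
      intro x
      exact (Submodule.Quotient.mk_eq_zero _).trans ⟨fun h => ⟨⟨x, h⟩, rfl⟩, by
        rintro ⟨y, rfl⟩; exact y.2⟩)
    (fun n => (S n).mkQ_surjective)
  -- The hypothesis says exactly that the quotient complex is acyclic.
  have hQ : ∀ n, Subsingleton ((C.quot S hS).H n) := fun n => by
    apply subsingleton_H
    intro x hx
    obtain ⟨x, rfl⟩ := Submodule.Quotient.mk_surjective _ x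
    obtain ⟨y, hy⟩ := h n x (fun m e => by
      subst e
      have := hx m rfl
      exact (Submodule.Quotient.mk_eq_zero _).1 this)
    refine ⟨Submodule.Quotient.mk y, ?_⟩
    change Submodule.Quotient.mk (C.d n y) = _
    rw [eq_comm, Submodule.Quotient.eq]
    exact hy
  constructor
  · rw [injective_iff_map_eq_zero]
    intro x hx
    obtain ⟨y, rfl⟩ := (h4 n x).1 hx
    rw [(hQ (n + 1)).elim y 0, map_zero]
  · intro x
    exact (h1 n x).1 ((hQ n).elim _ _)

/-- The direct sum of two complexes. -/
def prod (C D : VectCx.{v, w} F) : VectCx.{v, w} F where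
  X n := C.X n × D.X n
  d n := (C.d n).prodMap (D.d n)
  d_d n x := by simp [C.d_d, D.d_d]

/-- The sequence `C → C ⊕ D → D` gives exactness in the middle on homology, and by functoriality its
two splittings turn this into a direct sum decomposition. -/
lemma nonempty_H_prod (C D : VectCx.{v, w} F) (n : ℕ) :
    Nonempty ((C.prod D).H n ≃ₗ[F] (C.H n × D.H n)) := by
  let i : Hom C (C.prod D) := 
    ⟨fun n => LinearMap.inl F _ _, fun n x => Prod.ext rfl (map_zero (D.d n))⟩
  let p : Hom (C.prod D) C := ⟨fun n => LinearMap.fst F _ _, fun n x => rfl⟩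
  let j : Hom D (C.prod D) := 
    ⟨fun n => LinearMap.inr F _ _, fun n x => Prod.ext (map_zero (C.d n)) rfl⟩
  let q : Hom (C.prod D) D := ⟨fun n => LinearMap.snd F _ _, fun n x => rfl⟩
  obtain ⟨h1, -, δ, h3, h4⟩ := exists_long_exact i q
    (fun n => LinearMap.inl_injective) (fun n x => ⟨fun h => ⟨x.1, Prod.ext rfl h.symm⟩, by
      rintro ⟨y, rfl⟩; rfl⟩)
    (fun n => LinearMap.snd_surjective)
  have hpi : ∀ x, p.map n (i.map n x) = x := fun x => by
    rw [← Hom.map_comp]; exact Hom.map_id_of _ (fun _ _ => rfl) n x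
  have hqj : ∀ x, q.map n (j.map n x) = x := fun x => by
    rw [← Hom.map_comp]; exact Hom.map_id_of _ (fun _ _ => rfl) n x
  refine ⟨LinearEquiv.ofBijective ((p.map n).prod (q.map n)) ⟨?_, ?_⟩⟩
  · rw [injective_iff_map_eq_zero]
    intro x hx
    obtain ⟨hx1, hx2⟩ := Prod.ext_iff.1 hx
    obtain ⟨y, rfl⟩ := (h1 n x).1 hx2
    have : y = 0 := by rw [← hpi y]; exact hx1
    rw [this, map_zero]
  · rintro ⟨a, b⟩
    refine ⟨i.map n (a - p.map n (j.map n b)) + j.map n b, ?_⟩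
    have : ∀ a, q.map n (i.map n a) = 0 := fun a => (h1 n _).2 ⟨a, rfl⟩
    simp [hpi, hqj, this]

/-- The Mayer–Vietoris sequence of two subcomplexes. -/
lemma exists_mayerVietoris (C : VectCx.{v, w} F) (S T : ∀ n, Submodule F (C.X n))
    (hS : ∀ n, ∀ x ∈ S (n + 1), C.d n x ∈ S n) (hT : ∀ n, ∀ x ∈ T (n + 1), C.d n x ∈ T n)
    (hST : ∀ n, ∀ x ∈ S (n + 1) ⊓ T (n + 1), C.d n x ∈ S n ⊓ T n)
    (hST' : ∀ n, ∀ x ∈ S (n + 1) ⊔ T (n + 1), C.d n x ∈ S n ⊔ T n) :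
    ∃ (a : ∀ n, (C.sub (fun n => S n ⊓ T n) hST).H n →ₗ[F] (C.sub S hS).H n × (C.sub T hT).H n)
      (b : ∀ n, ((C.sub S hS).H n × (C.sub T hT).H n) →ₗ[F] (C.sub (fun n => S n ⊔ T n) hST').H n)
      (δ : ∀ n, (C.sub (fun n => S n ⊔ T n) hST').H (n + 1) →ₗ[F]
        (C.sub (fun n => S n ⊓ T n) hST).H n),
      (∀ n, Function.Exact (a n) (b n)) ∧ Function.Surjective (b 0) ∧
      (∀ n, Function.Exact (b (n + 1)) (δ n)) ∧ ∀ n, Function.Exact (δ n) (a n) := by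
  -- The short exact sequence is `0 → S ∩ T → S ⊕ T → S + T → 0` with `z ↦ (z, z)` and `(x, y) ↦ x -
  -- y`.
  let f : Hom (C.sub (fun n => S n ⊓ T n) hST) ((C.sub S hS).prod (C.sub T hT)) :=
    ⟨fun n => (Submodule.inclusion inf_le_left).prod (Submodule.inclusion inf_le_right),
      fun n x => rfl⟩
  let g : Hom ((C.sub S hS).prod (C.sub T hT)) (C.sub (fun n => S n ⊔ T n) hST') :=
    ⟨fun n => (Submodule.inclusion le_sup_left).coprod (-Submodule.inclusion le_sup_right),
      fun n x => by
        apply Subtype.ext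
        change C.d n (x.1.1 + -x.2.1) = C.d n x.1.1 + -C.d n x.2.1
        simp⟩
  obtain ⟨h1, h2, δ, h3, h4⟩ := exists_long_exact f g
    (fun n x y h => by
      apply Subtype.ext
      exact congrArg (fun z => z.1.1) h)
    (fun n => by
      rintro ⟨⟨x, hx⟩, ⟨y, hy⟩⟩
      constructor
      · intro h
        have : x + -y = 0 := congrArg Subtype.val h
        obtain rfl : x = y := by simpa using eq_neg_of_add_eq_zero_left this
        exact ⟨⟨x, hx, hy⟩, rfl⟩
      · rintro ⟨⟨z, hz⟩, h⟩
        obtain rfl : z = x := congrArg (fun z => z.1.1) h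
        obtain rfl : z = y := congrArg (fun z => z.2.1) h
        apply Subtype.ext
        change z + -z = 0
        simp)
    (fun n => by
      rintro ⟨x, hx⟩
      obtain ⟨y, hy, z, hz, rfl⟩ := Submodule.mem_sup.1 hx
      refine ⟨(⟨y, hy⟩, -⟨z, hz⟩), ?_⟩
      apply Subtype.ext
      change y + - -z = y + z
      simp)
  have e := fun n => (nonempty_H_prod (C.sub S hS) (C.sub T hT) n).some
  refine ⟨fun n => (e n).toLinearMap ∘ₗ f.map n, fun n => g.map n ∘ₗ (e n).symm.toLinearMap, δ,
    fun n x => ?_, ?_, fun n x => ?_, fun n x => ?_⟩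
  · obtain ⟨x, rfl⟩ := (e n).surjective x
    simpa using h1 n x
  · exact h2.comp (e 0).symm.surjective
  · rw [h3 n x]
    simp
  · rw [← h4 n x]
    simp

end VectCx
end

/-! ### Dimension counts along exact sequences -/

section

section LongExact

variable {F : Type v} [Field F]

/-- A graded vector space that is finite-dimensional in every degree, vanishes in degrees `≥ N` and
has Euler characteristic `c`. -/
structure HasEulerChar (F : Type v) [Field F] (V : ℕ → Type w) [∀ n, AddCommGroup (V n)]
    [∀ n, Module F (V n)] (N : ℕ) (c : ℤ) : Prop where
  finite : ∀ n, Module.Finite F (V n)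
  subsingleton : ∀ n, N ≤ n → Subsingleton (V n)
  sum_eq : ∑ n ∈ Finset.range N, (-1 : ℤ) ^ n * (Module.finrank F (V n) : ℤ) = c

lemma finite_of_function_exact {A B C : Type*} [AddCommGroup A] [AddCommGroup B]
    [AddCommGroup C] [Module F A] [Module F B] [Module F C] {f : A →ₗ[F] B} {g : B →ₗ[F] C}
    (h : Function.Exact f g) [Module.Finite F A] [Module.Finite F C] : Module.Finite F B := by
  have h1 : Module.Finite F (LinearMap.ker g) := by
    rw [h.linearMap_ker_eq]; infer_instance
  have h2 : Module.Finite F (B ⧸ LinearMap.ker g) :=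
    Module.Finite.equiv g.quotKerEquivRange.symm
  exact Module.Finite.of_submodule_quotient (LinearMap.ker g)

lemma finrank_eq_of_function_exact {A B C : Type*} [AddCommGroup A] [AddCommGroup B]
    [AddCommGroup C] [Module F A] [Module F B] [Module F C] {f : A →ₗ[F] B} {g : B →ₗ[F] C}
    (h : Function.Exact f g) [Module.Finite F B] :
    Module.finrank F B =
      Module.finrank F (LinearMap.range f) + Module.finrank F (LinearMap.range g) := by
  rw [← g.finrank_range_add_finrank_ker, h.linearMap_ker_eq, add_comm]

lemma finrank_le_of_function_exact {A B C : Type*} [AddCommGroup A] [AddCommGroup B]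
    [AddCommGroup C] [Module F A] [Module F B] [Module F C] {f : A →ₗ[F] B} {g : B →ₗ[F] C}
    (h : Function.Exact f g) [Module.Finite F A] [Module.Finite F C] :
    Module.finrank F B ≤ Module.finrank F A + Module.finrank F C := by
  have := finite_of_function_exact h
  rw [finrank_eq_of_function_exact h]
  exact add_le_add (LinearMap.finrank_range_le f) (Submodule.finrank_le _)

variable {A M X : ℕ → Type w} [∀ n, AddCommGroup (A n)] [∀ n, Module F (A n)]
  [∀ n, AddCommGroup (M n)] [∀ n, Module F (M n)] [∀ n, AddCommGroup (X n)] [∀ n, Module F (X n)]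

/-- Additivity of the Euler characteristic along a long exact sequence. -/
lemma HasEulerChar.of_long_exact {N : ℕ} {α μ : ℤ} (hA : HasEulerChar F A N α)
    (hM : HasEulerChar F M (N + 1) μ) (a : ∀ n, A n →ₗ[F] M n) (b : ∀ n, M n →ₗ[F] X n)
    (δ : ∀ n, X (n + 1) →ₗ[F] A n) (hab : ∀ n, Function.Exact (a n) (b n))
    (hb : Function.Surjective (b 0)) (hbδ : ∀ n, Function.Exact (b (n + 1)) (δ n))
    (hδa : ∀ n, Function.Exact (δ n) (a n)) : HasEulerChar F X (N + 1) (μ - α) := by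
  have hAf := hA.finite
  have hMf := hM.finite
  have hX : ∀ n, Module.Finite F (X n) := by
    rintro (_ | n)
    · exact Module.Finite.of_surjective (b 0) hb
    · exact finite_of_function_exact (hbδ n)
  refine ⟨hX, fun n hn => ?_, ?_⟩
  · obtain ⟨n, rfl⟩ : ∃ m, n = m + 1 := ⟨n - 1, by omega⟩
    have h1 := hA.subsingleton n (by omega)
    have h2 := hM.subsingleton (n + 1) (by omega)
    refine ⟨fun x y => ?_⟩
    have : ∀ x : X (n + 1), x = 0 := fun x => by
      obtain ⟨z, rfl⟩ := (hbδ n x).1 (Subsingleton.elim _ _)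
      rw [Subsingleton.elim z 0, map_zero]
    rw [this x, this y]
  · have e1 : ∀ n, (Module.finrank F (A n) : ℤ) = Module.finrank F (LinearMap.range (δ n)) +
        Module.finrank F (LinearMap.range (a n)) := fun n => by
      rw [finrank_eq_of_function_exact (hδa n)]; push_cast; rfl
    have e2 : ∀ n, (Module.finrank F (M n) : ℤ) = Module.finrank F (LinearMap.range (a n)) +
        Module.finrank F (LinearMap.range (b n)) := fun n => by
      rw [finrank_eq_of_function_exact (hab n)]; push_cast; rfl
    have e3 : ∀ n, (Module.finrank F (X (n + 1)) : ℤ) =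
        Module.finrank F (LinearMap.range (b (n + 1))) +
        Module.finrank F (LinearMap.range (δ n)) := fun n => by
      rw [finrank_eq_of_function_exact (hbδ n)]; push_cast; rfl
    have e4 : (Module.finrank F (X 0) : ℤ) = Module.finrank F (LinearMap.range (b 0)) := by
      rw [LinearMap.range_eq_top.2 hb, finrank_top]
    -- `A` vanishes from degree `N` on, so the boundary term of the truncated alternating sum
    -- disappears.
    have e5 : Module.finrank F (LinearMap.range (a N)) = 0 := by
      have h1 := hA.subsingleton N le_rfl
      have := LinearMap.finrank_range_le (a N)
      rw [Module.finrank_zero_of_subsingleton (M := A N)] at this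
      omega
    rw [← hM.sum_eq, ← hA.sum_eq, Finset.sum_range_succ' _ N, e4]
    -- Cutting the sequence at degree `K` leaves the rank of `a K` as an error term; carrying it
    -- along is what makes the telescoping an induction on `K`.
    have : ∀ K, ∑ k ∈ Finset.range K, (-1 : ℤ) ^ (k + 1) * (Module.finrank F (X (k + 1)) : ℤ) +
        (-1) ^ 0 * Module.finrank F (LinearMap.range (b 0)) =
        ∑ n ∈ Finset.range (K + 1), (-1) ^ n * (Module.finrank F (M n) : ℤ) -
        ∑ n ∈ Finset.range K, (-1) ^ n * (Module.finrank F (A n) : ℤ) -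
        (-1) ^ K * Module.finrank F (LinearMap.range (a K)) := by
      intro K
      induction K with
      | zero => simp [e2]
      | succ K ih =>
        rw [Finset.sum_range_succ, Finset.sum_range_succ _ (K + 1),
          Finset.sum_range_succ (fun n => (-1 : ℤ) ^ n * (Module.finrank F (A n) : ℤ)) K, e3, e2 (K + 1), e1 K]
        linear_combination ih
    rw [this N, e5]
    simp

lemma finrank_le_of_exact_of_subsingleton {A M X : Type*} [AddCommGroup A] [Module F A]
    [AddCommGroup M] [Module F M] [AddCommGroup X] [Module F X] (a : A →ₗ[F] M) (b : M →ₗ[F] X)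
    (h : Function.Exact a b) [Subsingleton A] [Module.Finite F X] :
    Module.finrank F M ≤ Module.finrank F X := by
  apply LinearMap.finrank_le_finrank_of_injective (f := b)
  rw [injective_iff_map_eq_zero]
  intro x hx
  obtain ⟨y, rfl⟩ := (h x).1 hx
  rw [Subsingleton.elim y 0, map_zero]

lemma HasEulerChar.congr {V W : ℕ → Type w} [∀ n, AddCommGroup (V n)] [∀ n, Module F (V n)]
    [∀ n, AddCommGroup (W n)] [∀ n, Module F (W n)] {N : ℕ} {c : ℤ} (h : HasEulerChar F V N c)
    (e : ∀ n, Nonempty (V n ≃ₗ[F] W n)) : HasEulerChar F W N c where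
  finite n := by have := h.finite n; exact Module.Finite.equiv (e n).some
  subsingleton n hn := by
    have := h.subsingleton n hn; exact (e n).some.symm.toEquiv.subsingleton
  sum_eq := by
    rw [← h.sum_eq]
    exact Finset.sum_congr rfl fun n _ => by rw [(e n).some.finrank_eq]

lemma HasEulerChar.mono {V : ℕ → Type w} [∀ n, AddCommGroup (V n)] [∀ n, Module F (V n)]
    {N N' : ℕ} {c : ℤ} (h : HasEulerChar F V N c) (hN : N ≤ N') : HasEulerChar F V N' c where
  finite := h.finite
  subsingleton n hn := h.subsingleton n (hN.trans hn)
  sum_eq := by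
    rw [← h.sum_eq]
    symm
    apply Finset.sum_subset (Finset.range_mono hN)
    intro n _ hn
    have := h.subsingleton n (by simpa using hn)
    rw [Module.finrank_zero_of_subsingleton]
    simp

lemma HasEulerChar.prod {V W : ℕ → Type w} [∀ n, AddCommGroup (V n)] [∀ n, Module F (V n)]
    [∀ n, AddCommGroup (W n)] [∀ n, Module F (W n)] {N : ℕ} {c c' : ℤ} (h : HasEulerChar F V N c)
    (h' : HasEulerChar F W N c') : HasEulerChar F (fun n => V n × W n) N (c + c') where
  finite n := by have := h.finite n; have := h'.finite n; infer_instance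
  subsingleton n hn := by
    have := h.subsingleton n hn; have := h'.subsingleton n hn; infer_instance
  sum_eq := by
    rw [← h.sum_eq, ← h'.sum_eq, ← Finset.sum_add_distrib]
    refine Finset.sum_congr rfl fun n _ => ?_
    have := h.finite n; have := h'.finite n
    rw [Module.finrank_prod]
    push_cast
    ring

end LongExact
end

/-! ### Combinatorial subdivision of tuples of vertices -/

section

section TupleChains

variable (F : Type v) [Field F] {P : Type*} {Q : Type*}

/-- Formal linear combinations of `m`-tuples of points of `P`. -/
abbrev TupleChain (P : Type*) (m : ℕ) := (Fin m → P) →₀ F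

/-- The alternating sum of the faces. -/
noncomputable def tupleD (P : Type*) (m : ℕ) : TupleChain F P (m + 1) →ₗ[F] TupleChain F P m :=
  Finsupp.linearCombination F
    fun v => ∑ i : Fin (m + 1), (-1 : F) ^ (i : ℕ) • Finsupp.single (v ∘ i.succAbove) 1

/-- The map induced by a map of vertices. -/
noncomputable def tupleMap (f : P → Q) (m : ℕ) : TupleChain F P m →ₗ[F] TupleChain F Q m :=
  Finsupp.lmapDomain F F (f ∘ ·)

/-- Adding an apex in front of a tuple. -/
noncomputable def tupleCone (b : P) (m : ℕ) : TupleChain F P m →ₗ[F] TupleChain F P (m + 1) :=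
  Finsupp.lmapDomain F F fun v => (Fin.cons b v : Fin (m + 1) → P)

variable {F}

@[simp] lemma tupleD_single {m : ℕ} (v : Fin (m + 1) → P) (c : F) :
    tupleD F P m (Finsupp.single v c) =
      ∑ i : Fin (m + 1), ((-1 : F) ^ (i : ℕ) * c) • Finsupp.single (v ∘ i.succAbove) 1 := by
  rw [tupleD, Finsupp.linearCombination_single, Finset.smul_sum]
  simp_rw [smul_smul, mul_comm c]

@[simp] lemma tupleMap_single (f : P → Q) {m : ℕ} (v : Fin m → P) (c : F) :
    tupleMap F f m (Finsupp.single v c) = Finsupp.single (f ∘ v) c := by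
  simp [tupleMap]

@[simp] lemma tupleCone_single (b : P) {m : ℕ} (v : Fin m → P) (c : F) :
    tupleCone F b m (Finsupp.single v c) = Finsupp.single (Fin.cons b v : Fin (m + 1) → P) c := by
  simp [tupleCone]

lemma tupleD_tupleMap (f : P → Q) (m : ℕ) (x : TupleChain F P (m + 1)) :
    tupleD F Q m (tupleMap F f (m + 1) x) = tupleMap F f m (tupleD F P m x) := by
  induction x using Finsupp.induction_linear with
  | zero => simp
  | add x y hx hy => simp [hx, hy]
  | single v c =>
    simp only [tupleMap_single, tupleD_single, map_sum, map_smul, Function.comp_assoc]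

lemma tupleMap_tupleCone (f : P → Q) (b : P) (m : ℕ) (x : TupleChain F P m) :
    tupleMap F f (m + 1) (tupleCone F b m x) = tupleCone F (f b) m (tupleMap F f m x) := by
  induction x using Finsupp.induction_linear with
  | zero => simp
  | add x y hx hy => simp [hx, hy]
  | single v c =>
    simp only [tupleCone_single, tupleMap_single]
    congr 1
    exact Fin.comp_cons f b v

/-- The index counts vertices, so `tupleD F P 0` is the augmentation and the empty tuple sits in
simplicial degree `-1`. At this end the cone formula has no correction term. -/
lemma tupleD_tupleCone_zero (b : P) (x : TupleChain F P 0) :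
    tupleD F P 0 (tupleCone F b 0 x) = x := by
  induction x using Finsupp.induction_linear with
  | zero => simp
  | add x y hx hy => simp [hx, hy]
  | single v c =>
    simp only [tupleCone_single, tupleD_single]
    simp only [Fin.sum_univ_succ, Finset.univ_eq_empty, Finset.sum_empty]
    simp [Subsingleton.elim (_ : Fin 0 → P) v]

/-- The face opposite the apex is the original tuple; the other faces are cones over its faces, with
signs reversed by the index shift. Coning is thus a contracting homotopy. -/
lemma tupleD_tupleCone_succ (b : P) (m : ℕ) (x : TupleChain F P (m + 1)) :
    tupleD F P (m + 1) (tupleCone F b (m + 1) x) = x - tupleCone F b m (tupleD F P m x) := by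
  induction x using Finsupp.induction_linear with
  | zero => simp
  | add x y hx hy => simp only [map_add, hx, hy]; abel
  | single v c =>
    simp only [tupleCone_single, tupleD_single]
    rw [Fin.sum_univ_succ, sub_eq_add_neg, map_sum, ← Finset.sum_neg_distrib]
    congr 1
    · have : (Fin.cons b v : Fin (m + 2) → P) ∘ (Fin.succAbove 0) = v := by
        ext i; simp
      rw [this]; simp
    · refine Finset.sum_congr rfl fun i _ => ?_
      have : (Fin.cons b v : Fin (m + 2) → P) ∘ (Fin.succAbove i.succ) =
          Fin.cons b (v ∘ i.succAbove) := by
        ext j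
        refine Fin.cases ?_ (fun j => ?_) j
        · simp
        · simp
      rw [this, map_smul, tupleCone_single, ← neg_smul]
      congr 1
      rw [Fin.val_succ, pow_succ]
      ring

/-- Every nonempty tuple is the cone from its first vertex over its tail, so the cone formula
reduces the claim to one degree lower, without pairing off terms of a double sum. -/
lemma tupleD_tupleD (m : ℕ) (x : TupleChain F P (m + 2)) :
    tupleD F P m (tupleD F P (m + 1) x) = 0 := by
  induction m with
  | zero =>
    induction x using Finsupp.induction_linear with
    | zero => simp
    | add x y hx hy => simp [hx, hy]
    | single v c =>
      have : Finsupp.single v c =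
          tupleCone F (v 0) 1 (Finsupp.single (Fin.tail v) c : TupleChain F P 1) := by
        rw [tupleCone_single, Fin.cons_self_tail]
      rw [this, tupleD_tupleCone_succ, map_sub, tupleD_tupleCone_zero, sub_self]
  | succ m ih =>
    induction x using Finsupp.induction_linear with
    | zero => simp
    | add x y hx hy => simp [hx, hy]
    | single v c =>
      have : Finsupp.single v c =
          tupleCone F (v 0) (m + 2) (Finsupp.single (Fin.tail v) c : TupleChain F P (m + 2)) := by
        rw [tupleCone_single, Fin.cons_self_tail]
      rw [this, tupleD_tupleCone_succ, map_sub, tupleD_tupleCone_succ, ih, map_zero, sub_zero,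
        sub_self]

variable (F) in
/-- Barycentric subdivision of tuples, for a given choice of barycentres. -/
noncomputable def tupleSd (β : ∀ m, (Fin (m + 1) → P) → P) :
    ∀ m, TupleChain F P m →ₗ[F] TupleChain F P m
  | 0 => LinearMap.id
  | m + 1 => Finsupp.linearCombination F
      fun v => tupleCone F (β m v) m (tupleSd β m (tupleD F P m (Finsupp.single v 1)))

variable (F) in
/-- The chain homotopy between the identity and barycentric subdivision. -/
noncomputable def tupleHtpy (β : ∀ m, (Fin (m + 1) → P) → P) :
    ∀ m, TupleChain F P m →ₗ[F] TupleChain F P (m + 1)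
  | 0 => 0
  | m + 1 => Finsupp.linearCombination F
      fun v => tupleCone F (β m v) (m + 1) (Finsupp.single v 1 -
        tupleSd F β (m + 1) (Finsupp.single v 1) -
        tupleHtpy β m (tupleD F P m (Finsupp.single v 1)))

lemma tupleSd_succ_single (β : ∀ m, (Fin (m + 1) → P) → P) (m : ℕ) (v : Fin (m + 1) → P) :
    tupleSd F β (m + 1) (Finsupp.single v 1) =
      tupleCone F (β m v) m (tupleSd F β m (tupleD F P m (Finsupp.single v 1))) := by
  rw [tupleSd, Finsupp.linearCombination_single, one_smul]

lemma tupleHtpy_succ_single (β : ∀ m, (Fin (m + 1) → P) → P) (m : ℕ) (v : Fin (m + 1) → P) :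
    tupleHtpy F β (m + 1) (Finsupp.single v 1) =
      tupleCone F (β m v) (m + 1) (Finsupp.single v 1 -
        tupleSd F β (m + 1) (Finsupp.single v 1) -
        tupleHtpy F β m (tupleD F P m (Finsupp.single v 1))) := by
  rw [tupleHtpy, Finsupp.linearCombination_single, one_smul]

lemma tuple_induction {m : ℕ} {Y : Type*} [AddCommGroup Y] [Module F Y]
    {f g : TupleChain F P m →ₗ[F] Y}
    (h : ∀ v, f (Finsupp.single v 1) = g (Finsupp.single v 1)) (x : TupleChain F P m) :
    f x = g x := by
  have : f = g := Finsupp.lhom_ext' fun v => LinearMap.ext_ring (h v)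
  rw [this]

/-- By the cone formula the boundary of the cone over the subdivided boundary is that subdivided
boundary, up to the cone over its own boundary, which vanishes by induction. -/
lemma tupleD_tupleSd (β : ∀ m, (Fin (m + 1) → P) → P) (m : ℕ) (x : TupleChain F P (m + 1)) :
    tupleD F P m (tupleSd F β (m + 1) x) = tupleSd F β m (tupleD F P m x) := by
  induction m with
  | zero =>
    refine tuple_induction (f := tupleD F P 0 ∘ₗ tupleSd F β 1)
      (g := tupleSd F β 0 ∘ₗ tupleD F P 0) (fun v => ?_) x
    simp only [LinearMap.comp_apply, tupleSd_succ_single, tupleD_tupleCone_zero]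
  | succ m ih =>
    refine tuple_induction (f := tupleD F P (m + 1) ∘ₗ tupleSd F β (m + 2))
      (g := tupleSd F β (m + 1) ∘ₗ tupleD F P (m + 1)) (fun v => ?_) x
    simp only [LinearMap.comp_apply]
    rw [tupleSd_succ_single, tupleD_tupleCone_succ, ih, tupleD_tupleD, map_zero, map_zero,
      sub_zero]

/-- The homotopy cones off the chain `v - Sd v - h ∂v`; as soon as this chain is a cycle, the cone
formula is the homotopy identity. The cycle condition `h` comes from the identity one degree lower.
-/
lemma tupleD_tupleHtpy_of (β : ∀ m, (Fin (m + 1) → P) → P) (m : ℕ)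
    (h : ∀ v : Fin (m + 1) → P, tupleD F P m (Finsupp.single v 1 -
      tupleSd F β (m + 1) (Finsupp.single v 1) -
        tupleHtpy F β m (tupleD F P m (Finsupp.single v 1))) = 0) (x : TupleChain F P (m + 1)) :
    tupleD F P (m + 1) (tupleHtpy F β (m + 1) x) =
      x - tupleSd F β (m + 1) x - tupleHtpy F β m (tupleD F P m x) := by
  refine tuple_induction (f := tupleD F P (m + 1) ∘ₗ tupleHtpy F β (m + 1))
      (g := LinearMap.id - tupleSd F β (m + 1) - tupleHtpy F β m ∘ₗ tupleD F P m) (fun v => ?_) x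
  rw [LinearMap.comp_apply, tupleHtpy_succ_single, tupleD_tupleCone_succ, h, map_zero, sub_zero]
  rfl

lemma tupleD_tupleHtpy (β : ∀ m, (Fin (m + 1) → P) → P) (m : ℕ) (x : TupleChain F P (m + 1)) :
    tupleD F P (m + 1) (tupleHtpy F β (m + 1) x) =
      x - tupleSd F β (m + 1) x - tupleHtpy F β m (tupleD F P m x) := by
  induction m with
  | zero =>
    refine tupleD_tupleHtpy_of β 0 (fun v => ?_) x
    rw [map_sub, map_sub, tupleD_tupleSd]
    simp [tupleSd, tupleHtpy]
  | succ m ih =>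
    refine tupleD_tupleHtpy_of β (m + 1) (fun v => ?_) x
    rw [map_sub, map_sub, tupleD_tupleSd, ih, tupleD_tupleD, map_zero]
    abel

/-- Naturality under vertex maps preserving barycentres. For affine maps of simplices this is what
lets subdivision pass to singular chains. -/
lemma tupleMap_tupleSd (f : P → Q) (β : ∀ m, (Fin (m + 1) → P) → P)
    (β' : ∀ m, (Fin (m + 1) → Q) → Q) (hβ : ∀ m v, f (β m v) = β' m (f ∘ v)) (m : ℕ)
    (x : TupleChain F P m) :
    tupleMap F f m (tupleSd F β m x) = tupleSd F β' m (tupleMap F f m x) := by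
  induction m with
  | zero => rfl
  | succ m ih =>
    refine tuple_induction (f := tupleMap F f (m + 1) ∘ₗ tupleSd F β (m + 1))
      (g := tupleSd F β' (m + 1) ∘ₗ tupleMap F f (m + 1)) (fun v => ?_) x
    simp only [LinearMap.comp_apply]
    rw [tupleSd_succ_single, tupleMap_tupleCone, ih, ← tupleD_tupleMap, tupleMap_single,
      tupleSd_succ_single, hβ]

lemma tupleMap_tupleHtpy (f : P → Q) (β : ∀ m, (Fin (m + 1) → P) → P)
    (β' : ∀ m, (Fin (m + 1) → Q) → Q) (hβ : ∀ m v, f (β m v) = β' m (f ∘ v)) (m : ℕ)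
    (x : TupleChain F P m) :
    tupleMap F f (m + 1) (tupleHtpy F β m x) = tupleHtpy F β' m (tupleMap F f m x) := by
  induction m with
  | zero => simp [tupleHtpy]
  | succ m ih =>
    refine tuple_induction (f := tupleMap F f (m + 2) ∘ₗ tupleHtpy F β (m + 1))
      (g := tupleHtpy F β' (m + 1) ∘ₗ tupleMap F f (m + 1)) (fun v => ?_) x
    simp only [LinearMap.comp_apply]
    rw [tupleHtpy_succ_single, tupleMap_tupleCone, (tupleMap F f (m + 1)).map_sub,
      (tupleMap F f (m + 1)).map_sub, ih, ← tupleD_tupleMap, tupleMap_tupleSd f β β' hβ,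
      tupleMap_single, tupleHtpy_succ_single, hβ]

/-- The tuples occurring in the subdivision of `v`: the apex is the barycentre of `v`, the rest
occurs in the subdivision of a face of `v`. -/
lemma mem_support_tupleSd_succ (β : ∀ m, (Fin (m + 1) → P) → P) (m : ℕ) (v w : Fin (m + 1) → P)
    (hw : w ∈ (tupleSd F β (m + 1) (Finsupp.single v 1)).support) :
    ∃ (i : Fin (m + 1)) (w' : Fin m → P), w = Fin.cons (β m v) w' ∧
      w' ∈ (tupleSd F β m (Finsupp.single (v ∘ i.succAbove) 1)).support := by
  classical
  rw [tupleSd_succ_single] at hw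
  have h1 := Finsupp.mapDomain_support hw
  rw [Finset.mem_image] at h1
  obtain ⟨w', hw', rfl⟩ := h1
  rw [tupleD_single, map_sum] at hw'
  have h2 := Finsupp.support_finsetSum hw'
  rw [Finset.mem_biUnion] at h2
  obtain ⟨i, -, hi⟩ := h2
  refine ⟨i, w', rfl, ?_⟩
  rw [map_smul] at hi
  exact Finsupp.support_smul hi

end TupleChains
end

/-! ### Singular chains and operators induced from the universal simplex -/

section

section SingularChains

/-- The standard topological simplex of dimension `n`. -/
abbrev StdSimp (n : ℕ) := stdSimplex ℝ (Fin (n + 1))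

/-- The affine map of standard simplices with prescribed images of the vertices. -/
noncomputable def affineSimplex {n m : ℕ} (w : Fin (n + 1) → StdSimp m) :
    C(StdSimp n, StdSimp m) where
  toFun t := ⟨fun j => ∑ i, t i * w i j,
    fun j => Finset.sum_nonneg fun i _ => mul_nonneg (t.2.1 i) ((w i).2.1 j), by
      rw [Finset.sum_comm]
      simp_rw [← Finset.mul_sum]
      have : ∀ i, ∑ j, w i j = 1 := fun i => (w i).2.2
      simp_rw [this, mul_one]
      exact t.2.2⟩
  continuous_toFun := by
    refine Continuous.subtype_mk (continuous_pi fun j => continuous_finsetSum _ fun i _ => ?_) _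
    exact ((continuous_apply i).comp continuous_subtype_val).mul continuous_const

lemma affineSimplex_apply {n m : ℕ} (w : Fin (n + 1) → StdSimp m) (t : StdSimp n)
    (j : Fin (m + 1)) : affineSimplex w t j = ∑ i, t i * w i j := rfl

/-- The tuple of vertices of a standard simplex. -/
noncomputable def stdVertices (n : ℕ) : Fin (n + 1) → StdSimp n := stdSimplex.vertex

lemma affineSimplex_vertex {n m : ℕ} (w : Fin (n + 1) → StdSimp m) (i : Fin (n + 1)) :
    affineSimplex w (stdVertices n i) = w i := by
  ext j
  rw [affineSimplex_apply, Finset.sum_eq_single i]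
  · simp [stdVertices]
  · intro k _ hk
    simp [stdVertices, hk]
  · simp

lemma affineSimplex_comp_vertices {n m : ℕ} (w : Fin (n + 1) → StdSimp m) :
    affineSimplex w ∘ stdVertices n = w := funext (affineSimplex_vertex w)

lemma affineSimplex_vertices (n : ℕ) (t : StdSimp n) : affineSimplex (stdVertices n) t = t := by
  ext j
  rw [affineSimplex_apply, Finset.sum_eq_single j]
  · simp [stdVertices]
  · intro k _ hk
    simp [stdVertices, hk.symm]
  · simp

lemma affineSimplex_comp {n m l : ℕ} (w : Fin (m + 1) → StdSimp l) (v : Fin (n + 1) → StdSimp m)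
    (t : StdSimp n) : affineSimplex w (affineSimplex v t) = affineSimplex (affineSimplex w ∘ v) t := by
  ext j
  simp only [affineSimplex_apply, Function.comp_apply, Finset.sum_mul, Finset.mul_sum]
  rw [Finset.sum_comm]
  simp_rw [mul_assoc]

/-- The barycentre of a tuple of points in a standard simplex. -/
noncomputable def tupleBary (l : ℕ) (m : ℕ) (v : Fin (m + 1) → StdSimp l) : StdSimp l :=
  affineSimplex v stdSimplex.barycenter

lemma affineSimplex_tupleBary {l k : ℕ} (w : Fin (l + 1) → StdSimp k) (m : ℕ)
    (v : Fin (m + 1) → StdSimp l) :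
    affineSimplex w (tupleBary l m v) = tupleBary k m (affineSimplex w ∘ v) :=
  affineSimplex_comp _ _ _

variable (F : Type v) [Field F] (X : Type u) [TopologicalSpace X]

/-- Singular `n`-chains. -/
abbrev SingChain (n : ℕ) := C(StdSimp n, X) →₀ F

variable {X}

/-- The singular chain obtained from a chain of tuples in a simplex by affine interpolation
followed by a singular simplex. -/
noncomputable def singRealize {m : ℕ} (σ : C(StdSimp m, X)) (n : ℕ) :
    TupleChain F (StdSimp m) (n + 1) →ₗ[F] SingChain F X n :=
  Finsupp.lmapDomain F F fun w => σ.comp (affineSimplex w)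

variable {F}

@[simp] lemma singRealize_single {m : ℕ} (σ : C(StdSimp m, X)) (n : ℕ)
    (w : Fin (n + 1) → StdSimp m) (c : F) :
    singRealize F σ n (Finsupp.single w c) = Finsupp.single (σ.comp (affineSimplex w)) c := by
  simp [singRealize]

lemma singRealize_vertices {m : ℕ} (σ : C(StdSimp m, X)) (c : F) :
    singRealize F σ m (Finsupp.single (stdVertices m) c) = Finsupp.single σ c := by
  rw [singRealize_single]
  congr 1
  ext t
  simp [affineSimplex_vertices]

lemma singRealize_comp {m l : ℕ} (σ : C(StdSimp m, X)) (w : Fin (l + 1) → StdSimp m) (n : ℕ)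
    (x : TupleChain F (StdSimp l) (n + 1)) :
    singRealize F (σ.comp (affineSimplex w)) n x =
      singRealize F σ n (tupleMap F (affineSimplex w) (n + 1) x) := by
  refine tuple_induction (f := singRealize F (σ.comp (affineSimplex w)) n)
    (g := singRealize F σ n ∘ₗ tupleMap F (affineSimplex w) (n + 1)) (fun v => ?_) x
  simp only [LinearMap.comp_apply, singRealize_single, tupleMap_single]
  congr 1
  ext t
  simp [affineSimplex_comp]

variable (F X) in
/-- The natural operator on singular chains determined by an operator on tuples. -/
noncomputable def singOp {n k : ℕ}
    (θ : TupleChain F (StdSimp n) (n + 1) →ₗ[F] TupleChain F (StdSimp n) (k + 1)) :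
    SingChain F X n →ₗ[F] SingChain F X k :=
  Finsupp.linearCombination F
    fun σ => singRealize F σ k (θ (Finsupp.single (stdVertices n) 1))

lemma singOp_single {n k : ℕ}
    (θ : TupleChain F (StdSimp n) (n + 1) →ₗ[F] TupleChain F (StdSimp n) (k + 1))
    (σ : C(StdSimp n, X)) : singOp F X θ (Finsupp.single σ 1) =
      singRealize F σ k (θ (Finsupp.single (stdVertices n) 1)) := by
  simp [singOp]

/-- An operator defined through the universal simplex acts on every affine chain as the tuple
operator does, provided the latter commutes with affine maps. Identities between tuple operators
thereby carry over to singular chains. -/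
lemma singOp_singRealize {n k m : ℕ}
    (θ : TupleChain F (StdSimp n) (n + 1) →ₗ[F] TupleChain F (StdSimp n) (k + 1))
    (θ' : TupleChain F (StdSimp m) (n + 1) →ₗ[F] TupleChain F (StdSimp m) (k + 1))
    (h : ∀ (w : Fin (n + 1) → StdSimp m) x, tupleMap F (affineSimplex w) (k + 1) (θ x) =
      θ' (tupleMap F (affineSimplex w) (n + 1) x))
    (σ : C(StdSimp m, X)) (x : TupleChain F (StdSimp m) (n + 1)) :
    singOp F X θ (singRealize F σ n x) = singRealize F σ k (θ' x) := by
  refine tuple_induction (f := singOp F X θ ∘ₗ singRealize F σ n)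
    (g := singRealize F σ k ∘ₗ θ') (fun w => ?_) x
  simp only [LinearMap.comp_apply]
  rw [singRealize_single, singOp_single, singRealize_comp, h, tupleMap_single,
    affineSimplex_comp_vertices]

variable (F X)

/-- The singular boundary operator. -/
noncomputable def singD (n : ℕ) : SingChain F X (n + 1) →ₗ[F] SingChain F X n :=
  singOp F X (tupleD F _ (n + 1))

/-- Barycentric subdivision of singular chains. -/
noncomputable def singSd (n : ℕ) : SingChain F X n →ₗ[F] SingChain F X n :=
  singOp F X (tupleSd F (tupleBary _) (n + 1))

/-- The chain homotopy between the identity and barycentric subdivision. -/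
noncomputable def singHtpy (n : ℕ) : SingChain F X n →ₗ[F] SingChain F X (n + 1) :=
  singOp F X (tupleHtpy F (tupleBary _) (n + 1))

variable {F X}

lemma singD_singRealize {m : ℕ} (σ : C(StdSimp m, X)) (n : ℕ)
    (x : TupleChain F (StdSimp m) (n + 2)) :
    singD F X n (singRealize F σ (n + 1) x) = singRealize F σ n (tupleD F _ (n + 1) x) :=
  singOp_singRealize _ _ (fun _ _ => (tupleD_tupleMap _ _ _).symm) σ x

lemma singSd_singRealize {m : ℕ} (σ : C(StdSimp m, X)) (n : ℕ)
    (x : TupleChain F (StdSimp m) (n + 1)) :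
    singSd F X n (singRealize F σ n x) =
      singRealize F σ n (tupleSd F (tupleBary _) (n + 1) x) :=
  singOp_singRealize _ _
    (fun w _ => tupleMap_tupleSd _ _ _ (fun k v => affineSimplex_tupleBary w k v) _ _) σ x

lemma singHtpy_singRealize {m : ℕ} (σ : C(StdSimp m, X)) (n : ℕ)
    (x : TupleChain F (StdSimp m) (n + 1)) :
    singHtpy F X n (singRealize F σ n x) =
      singRealize F σ (n + 1) (tupleHtpy F (tupleBary _) (n + 1) x) :=
  singOp_singRealize _ _
    (fun w _ => tupleMap_tupleHtpy _ _ _ (fun k v => affineSimplex_tupleBary w k v) _ _) σ x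

/-- Every singular simplex is the realization of the tuple of vertices of its domain, the form to
which the realization formulas apply. -/
lemma singChain_induction {n : ℕ} {Y : Type*} [AddCommGroup Y] [Module F Y]
    {f g : SingChain F X n →ₗ[F] Y}
    (h : ∀ (σ : C(StdSimp n, X)), f (singRealize F σ n (Finsupp.single (stdVertices n) 1)) =
      g (singRealize F σ n (Finsupp.single (stdVertices n) 1))) (x : SingChain F X n) :
    f x = g x := by
  have : f = g := Finsupp.lhom_ext' fun σ => LinearMap.ext_ring (by
    have := h σ
    rw [singRealize_vertices] at this
    exact this)
  rw [this]

lemma singD_singD (n : ℕ) (x : SingChain F X (n + 2)) :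
    singD F X n (singD F X (n + 1) x) = 0 := by
  refine singChain_induction (f := singD F X n ∘ₗ singD F X (n + 1)) (g := 0) (fun σ => ?_) x
  rw [LinearMap.comp_apply, singD_singRealize, singD_singRealize, tupleD_tupleD, map_zero]
  rfl

lemma singD_singSd (n : ℕ) (x : SingChain F X (n + 1)) :
    singD F X n (singSd F X (n + 1) x) = singSd F X n (singD F X n x) := by
  refine singChain_induction (f := singD F X n ∘ₗ singSd F X (n + 1))
    (g := singSd F X n ∘ₗ singD F X n) (fun σ => ?_) x
  simp only [LinearMap.comp_apply]
  rw [singSd_singRealize, singD_singRealize, tupleD_tupleSd, singD_singRealize,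
    singSd_singRealize]

lemma singD_singHtpy_zero (x : SingChain F X 0) :
    singD F X 0 (singHtpy F X 0 x) = x - singSd F X 0 x := by
  refine singChain_induction (f := singD F X 0 ∘ₗ singHtpy F X 0)
    (g := LinearMap.id - singSd F X 0) (fun σ => ?_) x
  simp only [LinearMap.comp_apply, LinearMap.sub_apply, LinearMap.id_apply]
  rw [singHtpy_singRealize, singD_singRealize, tupleD_tupleHtpy, map_sub, map_sub,
    singSd_singRealize]
  simp [tupleHtpy]

lemma singD_singHtpy_succ (n : ℕ) (x : SingChain F X (n + 1)) :
    singD F X (n + 1) (singHtpy F X (n + 1) x) =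
      x - singSd F X (n + 1) x - singHtpy F X n (singD F X n x) := by
  refine singChain_induction (f := singD F X (n + 1) ∘ₗ singHtpy F X (n + 1))
    (g := LinearMap.id - singSd F X (n + 1) - singHtpy F X n ∘ₗ singD F X n) (fun σ => ?_) x
  simp only [LinearMap.comp_apply, LinearMap.sub_apply, LinearMap.id_apply]
  rw [singHtpy_singRealize, singD_singRealize, tupleD_tupleHtpy, map_sub, map_sub,
    singSd_singRealize, singD_singRealize, singHtpy_singRealize]

variable (F) in
/-- Chains all of whose simplices lie in `U`. -/
noncomputable def chainsIn (U : Set X) (n : ℕ) : Submodule F (SingChain F X n) :=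
  Finsupp.supported F F {σ | ∀ t, σ t ∈ U}

/-- All simplices produced from `σ` are `σ` composed with affine maps, so their images lie in the
image of `σ`. -/
lemma singOp_mem_chainsIn {n k : ℕ}
    (θ : TupleChain F (StdSimp n) (n + 1) →ₗ[F] TupleChain F (StdSimp n) (k + 1)) (U : Set X)
    {x : SingChain F X n} (hx : x ∈ chainsIn F U n) : singOp F X θ x ∈ chainsIn F U k := by
  rw [singOp, Finsupp.linearCombination_apply]
  refine Submodule.sum_mem _ fun σ hσ => Submodule.smul_mem _ _ ?_
  have h1 : ∀ t, σ t ∈ U := (Finsupp.mem_supported _ _).1 hx hσ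
  generalize θ (Finsupp.single (stdVertices n) 1) = y
  induction y using Finsupp.induction_linear with
  | zero => simp
  | add x y hx hy => rw [map_add]; exact Submodule.add_mem _ hx hy
  | single v c =>
    rw [singRealize_single]
    exact Finsupp.single_mem_supported F c (fun t => h1 _)

lemma singOp_mem_sup {n k : ℕ}
    (θ : TupleChain F (StdSimp n) (n + 1) →ₗ[F] TupleChain F (StdSimp n) (k + 1)) (U V : Set X)
    {x : SingChain F X n} (hx : x ∈ chainsIn F U n ⊔ chainsIn F V n) :
    singOp F X θ x ∈ chainsIn F U k ⊔ chainsIn F V k := by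
  obtain ⟨y, hy, z, hz, rfl⟩ := Submodule.mem_sup.1 hx
  rw [map_add]
  exact Submodule.add_mem_sup (singOp_mem_chainsIn θ U hy) (singOp_mem_chainsIn θ V hz)

end SingularChains
end

/-! ### Small simplices -/

section

section SmallSimplices

open Filter Topology

variable {F : Type v} [Field F]

lemma dist_affineSimplex_le {n l : ℕ} (w : Fin (n + 1) → StdSimp l) (t : StdSimp n)
    (x : StdSimp l) {r : ℝ} (hr : ∀ i, dist (w i) x ≤ r) : dist (affineSimplex w t) x ≤ r := by
  have h0 : 0 ≤ r := dist_nonneg.trans (hr 0)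
  rw [Subtype.dist_eq, dist_pi_le_iff h0]
  intro j
  have h1 : ∀ i, |w i j - x j| ≤ r := fun i =>
    (dist_le_pi_dist (w i).1 x.1 j).trans (hr i)
  have h2 : ∑ i, t i = 1 := t.2.2
  have h3 : (∑ i, t i * w i j) - x j = ∑ i, t i * (w i j - x j) := by
    simp_rw [mul_sub, Finset.sum_sub_distrib, ← Finset.sum_mul, h2, one_mul]
  rw [Real.dist_eq]
  change |(∑ i, t i * w i j) - x j| ≤ r
  rw [h3]
  calc |∑ i, t i * (w i j - x j)| ≤ ∑ i, |t i * (w i j - x j)| := Finset.abs_sum_le_sum_abs _ _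
    _ ≤ ∑ i, t i * r := Finset.sum_le_sum fun i _ => by
        have ht : 0 ≤ t i := t.2.1 i
        rw [abs_mul, abs_of_nonneg ht]
        exact mul_le_mul_of_nonneg_left (h1 i) (t.2.1 i)
    _ = r := by rw [← Finset.sum_mul, h2, one_mul]

/-- In the average of the `m + 1` differences `v i - v k` the term `i = k` vanishes; the `m`
remaining ones produce the contraction factor `m / (m + 1)`. -/
lemma dist_tupleBary_le {l m : ℕ} (v : Fin (m + 1) → StdSimp l) {D : ℝ}
    (hD : ∀ i j, dist (v i) (v j) ≤ D) (k : Fin (m + 1)) :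
    dist (tupleBary l m v) (v k) ≤ m / (m + 1) * D := by
  have hD0 : 0 ≤ D := dist_nonneg.trans (hD 0 0)
  have hm : (0 : ℝ) < m + 1 := by positivity
  rw [Subtype.dist_eq, dist_pi_le_iff (by positivity)]
  intro j
  have h1 : ∀ i, |v i j - v k j| ≤ D := fun i =>
    (dist_le_pi_dist (v i).1 (v k).1 j).trans (hD i k)
  rw [Real.dist_eq]
  change |(∑ i, (stdSimplex.barycenter : StdSimp m).1 i * v i j) - v k j| ≤ _
  simp_rw [stdSimplex.barycenter_apply]
  rw [← Finset.mul_sum, Fintype.card_fin]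
  have h3 : ((m + 1 : ℕ) : ℝ)⁻¹ * (∑ i, v i j) - v k j =
      (m + 1 : ℝ)⁻¹ * ∑ i ∈ Finset.univ.erase k, (v i j - v k j) := by
    have : ∑ i ∈ Finset.univ.erase k, (v i j - v k j) = ∑ i, (v i j - v k j) := by
      apply Finset.sum_erase; simp
    rw [this, Finset.sum_sub_distrib, mul_sub]
    push_cast
    congr 1
    simp
    field_simp
  rw [h3, abs_mul, abs_of_pos (inv_pos.2 hm)]
  calc (m + 1 : ℝ)⁻¹ * |∑ i ∈ Finset.univ.erase k, (v i j - v k j)|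
      ≤ (m + 1 : ℝ)⁻¹ * ∑ i ∈ Finset.univ.erase k, |v i j - v k j| := by
        gcongr; exact Finset.abs_sum_le_sum_abs _ _
    _ ≤ (m + 1 : ℝ)⁻¹ * ∑ i ∈ Finset.univ.erase k, D := by
        gcongr; exact h1 _
    _ = m / (m + 1) * D := by
        rw [Finset.sum_const, Finset.card_erase_of_mem (Finset.mem_univ _)]
        simp
        field_simp

lemma dist_le_of_mem_support_tupleSd {l : ℕ} : ∀ (m : ℕ) (v w : Fin m → StdSimp l),
    w ∈ (tupleSd F (tupleBary l) m (Finsupp.single v 1)).support → ∀ (x : StdSimp l) (r : ℝ),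
    (∀ i, dist (v i) x ≤ r) → ∀ i, dist (w i) x ≤ r
  | 0, _, _, _, _, _, _, i => i.elim0
  | m + 1, v, w, hw, x, r, hr, i => by
    obtain ⟨k, w', rfl, hw'⟩ := mem_support_tupleSd_succ _ m v w hw
    refine Fin.cases ?_ (fun i => ?_) i
    · exact dist_affineSimplex_le v _ x hr
    · exact dist_le_of_mem_support_tupleSd m _ w' hw' x r (fun i => hr _) i

/-- Vertices of the subdivision stay in the balls containing the original vertices, so pairs
involving the new barycentre are controlled by `dist_tupleBary_le`. The other pairs occur in the
subdivision of a face, whose factor is smaller. -/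
lemma mesh_of_mem_support_tupleSd {l : ℕ} : ∀ (m : ℕ) (v w : Fin m → StdSimp l),
    w ∈ (tupleSd F (tupleBary l) m (Finsupp.single v 1)).support → ∀ D : ℝ,
    (∀ i j, dist (v i) (v j) ≤ D) → ∀ i j, dist (w i) (w j) ≤ (m - 1) / m * D
  | 0, _, _, _, _, _, i, _ => i.elim0
  | m + 1, v, w, hw, D, hD, i, j => by
    have hD0 : 0 ≤ D := dist_nonneg.trans (hD 0 0)
    obtain ⟨k, w', rfl, hw'⟩ := mem_support_tupleSd_succ _ m v w hw
    have e : (((m + 1 : ℕ) : ℝ) - 1) / ((m + 1 : ℕ) : ℝ) = m / (m + 1) := by push_cast; ring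
    rw [e]
    have h1 : ∀ i, dist (w' i) (tupleBary l m v) ≤ m / (m + 1) * D :=
      dist_le_of_mem_support_tupleSd m _ w' hw' _ _ fun i => by
        rw [dist_comm]; exact dist_tupleBary_le v hD _
    have h2 : ∀ i j, dist (w' i) (w' j) ≤ m / (m + 1) * D := fun i j => by
      refine (mesh_of_mem_support_tupleSd m _ w' hw' D (fun i j => hD _ _) i j).trans ?_
      have hm : 0 < m := Nat.pos_of_ne_zero (by rintro rfl; exact i.elim0)
      have hm' : (0 : ℝ) < m := by exact_mod_cast hm
      gcongr ?_ * D
      rw [div_le_div_iff₀ hm' (by positivity)]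
      nlinarith
    refine Fin.cases (Fin.cases ?_ (fun j => ?_) j) (fun i => Fin.cases ?_ (fun j => ?_) j) i
    · simp only [Fin.cons_zero, dist_self]; positivity
    · simp only [Fin.cons_zero, Fin.cons_succ]; rw [dist_comm]; exact h1 j
    · simp only [Fin.cons_zero, Fin.cons_succ]; exact h1 i
    · simp only [Fin.cons_succ]; exact h2 i j

lemma mesh_iterate_tupleSd {l m : ℕ} (v : Fin (m + 1) → StdSimp l) {D : ℝ}
    (hD : ∀ i j, dist (v i) (v j) ≤ D) (k : ℕ) (w : Fin (m + 1) → StdSimp l)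
    (hw : w ∈ ((tupleSd F (tupleBary l) (m + 1))^[k] (Finsupp.single v 1)).support) (i j) :
    dist (w i) (w j) ≤ (m / (m + 1)) ^ k * D := by
  classical
  induction k generalizing w i j with
  | zero =>
    have := Finsupp.support_single_subset hw
    rw [Finset.mem_singleton] at this
    subst this
    simpa using hD i j
  | succ k ih =>
    rw [Function.iterate_succ_apply'] at hw
    generalize (tupleSd F (tupleBary l) (m + 1))^[k] (Finsupp.single v 1) = y at ih hw
    rw [← Finsupp.sum_single y, map_finsuppSum] at hw
    obtain ⟨z, hz, hwz⟩ := Finset.mem_biUnion.1 (Finsupp.support_sum hw)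
    rw [← mul_one (y z), ← smul_eq_mul, ← Finsupp.smul_single, map_smul] at hwz
    refine (mesh_of_mem_support_tupleSd (m + 1) z w (Finsupp.support_smul hwz) _
      (fun i j => ih z hz i j) i j).trans_eq ?_
    push_cast
    ring

variable {X : Type u} [TopologicalSpace X]

lemma singSd_iterate_singRealize {m : ℕ} (σ : C(StdSimp m, X)) (n : ℕ)
    (x : TupleChain F (StdSimp m) (n + 1)) (k : ℕ) :
    (singSd F X n)^[k] (singRealize F σ n x) =
      singRealize F σ n ((tupleSd F (tupleBary _) (n + 1))^[k] x) := by
  induction k with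
  | zero => rfl
  | succ k ih => rw [Function.iterate_succ_apply', Function.iterate_succ_apply', ih,
      singSd_singRealize]

/-- After sufficiently many subdivisions every chain is small. -/
lemma eventually_singSd_iterate_mem {U V : Set X} (hU : IsOpen U) (hV : IsOpen V)
    (hUV : U ∪ V = Set.univ) (n : ℕ) (x : SingChain F X n) :
    ∀ᶠ k in atTop, (singSd F X n)^[k] x ∈ chainsIn F U n ⊔ chainsIn F V n := by
  have hlin : ∀ k, (singSd F X n)^[k] = ⇑((singSd F X n) ^ k) := fun k => by
    rw [Module.End.coe_pow]
  induction x using Finsupp.induction_linear with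
  | zero => simp
  | add x y hx hy =>
    filter_upwards [hx, hy] with k h1 h2
    rw [hlin, map_add, ← hlin]
    exact Submodule.add_mem _ h1 h2
  | single σ c =>
    -- `δ` is a Lebesgue number of the cover pulled back to the simplex; subdivision is iterated
    -- until the mesh drops below it.
    obtain ⟨δ, hδ, hball⟩ := lebesgue_number_lemma_of_metric (ι := Bool)
      (c := fun b => σ ⁻¹' (if b then U else V)) (isCompact_univ (X := StdSimp n))
      (fun b => by
        cases b
        · exact hV.preimage σ.continuous
        · exact hU.preimage σ.continuous)
      (fun t _ => by
        have : σ t ∈ U ∪ V := hUV ▸ Set.mem_univ _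
        rw [Set.mem_iUnion]
        rcases this with h | h
        · exact ⟨true, h⟩
        · exact ⟨false, h⟩)
    have hlim : Tendsto (fun k : ℕ => ((n : ℝ) / (n + 1)) ^ k * 1) atTop (𝓝 (0 * 1)) := by
      refine (tendsto_pow_atTop_nhds_zero_of_lt_one (by positivity) ?_).mul_const 1
      rw [div_lt_one (by positivity)]
      linarith
    rw [zero_mul] at hlim
    filter_upwards [hlim.eventually_lt_const hδ] with k hk
    rw [← singRealize_vertices, ← mul_one c, ← smul_eq_mul, ← Finsupp.smul_single, map_smul,
      hlin, map_smul, ← hlin, singSd_iterate_singRealize]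
    refine Submodule.smul_mem _ _ ?_
    rw [← Finsupp.sum_single ((tupleSd F (tupleBary n) (n + 1))^[k] _), map_finsuppSum]
    refine Submodule.sum_mem _ fun w hw => ?_
    -- Barycentric coordinates lie in `[0, 1]`, so in the sup metric any two vertices are at
    -- distance at most `1`.
    have hmesh := mesh_iterate_tupleSd (F := F) (stdVertices n) (D := 1) (fun i j => by
      refine (dist_pi_le_iff zero_le_one).2 fun t => ?_
      have h1 := (stdVertices n i).2.1 t
      have h2 := (stdVertices n j).2.1 t
      have h3 := stdSimplex.le_one (stdVertices n i) t
      have h4 := stdSimplex.le_one (stdVertices n j) t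
      change _ ≤ (1 : ℝ) at h3
      change _ ≤ (1 : ℝ) at h4
      rw [Real.dist_eq, abs_le]
      exact ⟨by linarith! , by linarith!⟩) k w hw
    have hin : ∀ t, affineSimplex w t ∈ Metric.ball (w 0) δ := fun t =>
      (dist_affineSimplex_le w t (w 0) (fun i => hmesh i 0)).trans_lt hk
    obtain ⟨b, hb⟩ := hball (w 0) (Set.mem_univ _)
    dsimp only
    rw [singRealize_single]
    cases b
    · exact Submodule.mem_sup_right (Finsupp.single_mem_supported F _ fun t => hb (hin t))
    · exact Submodule.mem_sup_left (Finsupp.single_mem_supported F _ fun t => hb (hin t))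

variable (F X) in
/-- The singular chain complex of `X`. -/
noncomputable def singCx : VectCx.{v, max u v} F where
  X n := SingChain F X n
  d n := singD F X n
  d_d n x := singD_singD n x

lemma singD_mem_chainsIn (U : Set X) (n : ℕ) (x) (hx : x ∈ chainsIn F U (n + 1)) :
    (singCx F X).d n x ∈ chainsIn F U n := singOp_mem_chainsIn _ U hx

lemma singD_mem_sup (U V : Set X) (n : ℕ) (x)
    (hx : x ∈ chainsIn F U (n + 1) ⊔ chainsIn F V (n + 1)) :
    (singCx F X).d n x ∈ chainsIn F U n ⊔ chainsIn F V n := singOp_mem_sup _ U V hx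

/-- Summing the homotopy identity over the iterates writes `x - Sd^k x` as a boundary plus terms `h
(∂ (Sd^j x))`. These are small because `∂x` is, and both `Sd` and `h` preserve small chains. -/
lemma exists_sub_singD_mem {U V : Set X} (n : ℕ) (k : ℕ) (x : SingChain F X n)
    (hx : ∀ m (e : n = m + 1), singD F X m (e ▸ x) ∈ chainsIn F U m ⊔ chainsIn F V m) :
    ∃ y, x - (singSd F X n)^[k] x - singD F X n y ∈ chainsIn F U n ⊔ chainsIn F V n := by
  induction k with
  | zero => exact ⟨0, by simp⟩
  | succ k ih =>
    obtain ⟨y, hy⟩ := ih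
    rw [Function.iterate_succ_apply']
    have hk : ∀ m (e : n = m + 1), singD F X m (e ▸ (singSd F X n)^[k] x) ∈
        chainsIn F U m ⊔ chainsIn F V m := by
      intro m e
      subst e
      have h0 := hx m rfl
      clear hy hx y
      induction k with
      | zero => exact h0
      | succ k ih2 =>
        rw [Function.iterate_succ_apply']
        change singD F X m (singSd F X (m + 1) _) ∈ _
        rw [singD_singSd]
        exact singOp_mem_sup _ U V ih2
    generalize (singSd F X n)^[k] x = z at *
    refine ⟨y + singHtpy F X n z, ?_⟩
    have : z - singSd F X n z - singD F X n (singHtpy F X n z) ∈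
        chainsIn F U n ⊔ chainsIn F V n := by
      rcases n with _ | n
      · rw [singD_singHtpy_zero, sub_self]
        exact Submodule.zero_mem _
      · rw [singD_singHtpy_succ]
        have := singOp_mem_sup (tupleHtpy F (tupleBary _) (n + 1)) U V (hk n rfl)
        convert this using 1
        change _ = singHtpy F X n (singD F X n z)
        abel
    convert Submodule.add_mem _ hy this using 1
    rw [map_add]
    abel

lemma exists_sub_singD_mem_of_isOpen {U V : Set X} (hU : IsOpen U) (hV : IsOpen V)
    (hUV : U ∪ V = Set.univ) (n : ℕ) (x : SingChain F X n)
    (hx : ∀ m (e : n = m + 1), singD F X m (e ▸ x) ∈ chainsIn F U m ⊔ chainsIn F V m) :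
    ∃ y, x - singD F X n y ∈ chainsIn F U n ⊔ chainsIn F V n := by
  obtain ⟨k, hk⟩ := (eventually_singSd_iterate_mem (F := F) hU hV hUV n x).exists
  obtain ⟨y, hy⟩ := exists_sub_singD_mem n k x hx
  refine ⟨y, ?_⟩
  have h := Submodule.add_mem _ hy hk
  rwa [sub_right_comm, sub_add_cancel] at h

lemma bijective_small_chains {U V : Set X} (hU : IsOpen U) (hV : IsOpen V)
    (hUV : U ∪ V = Set.univ) (n : ℕ) :
    Function.Bijective (((singCx F X).subIncl (fun n => chainsIn F U n ⊔ chainsIn F V n)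
      (singD_mem_sup U V)).map n) :=
  VectCx.bijective_subIncl_map _ _ _
    (fun n x hx => exists_sub_singD_mem_of_isOpen hU hV hUV n x hx) n

end SmallSimplices
end

/-! ### Comparison with Mathlib's singular homology -/

section

open CategoryTheory Simplicial AlgebraicTopology Limits

section Comparison

variable (F : Type v) [Field F] (X : Type u) [TopologicalSpace X]

lemma map_succAbove_eq_affineSimplex (n : ℕ) (i : Fin (n + 2)) (t : StdSimp n) :
    stdSimplex.map i.succAbove t = affineSimplex (stdVertices (n + 1) ∘ i.succAbove) t := by
  ext j
  rw [affineSimplex_apply, stdSimplex.map_coe, FunOnFinite.linearMap_apply_apply]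
  rw [Finset.sum_filter]
  refine Finset.sum_congr rfl fun k _ => ?_
  simp [stdVertices, Pi.single_apply, eq_comm]

/-- The simplices of the singular simplicial set as continuous maps. -/
noncomputable def toSSetEquiv (n : ℕ) :
    (TopCat.toSSet.obj (TopCat.of X)) _⦋n⦌ ≃ C(StdSimp n, X) :=
  TopCat.toSSetObjEquiv (TopCat.of X) (Opposite.op ⦋n⦌)

lemma toSSetEquiv_δ (n : ℕ) (i : Fin (n + 2))
    (x : (TopCat.toSSet.obj (TopCat.of X)) _⦋n + 1⦌) :
    toSSetEquiv X n ((TopCat.toSSet.obj (TopCat.of X)).δ i x) =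
      (toSSetEquiv X (n + 1) x).comp (affineSimplex (stdVertices (n + 1) ∘ i.succAbove)) := by
  ext t
  rw [ContinuousMap.comp_apply, ← map_succAbove_eq_affineSimplex]
  rfl

/-- The coefficient module of singular homology. -/
noncomputable abbrev coeffModule : ModuleCat.{max u v} F := ModuleCat.of F (ULift.{u} F)

variable {F X} in
lemma singD_single (n : ℕ) (σ : C(StdSimp (n + 1), X)) (c : F) :
    singD F X n (Finsupp.single σ c) = ∑ i : Fin (n + 2), ((-1 : F) ^ (i : ℕ) * c) •
      Finsupp.single (σ.comp (affineSimplex (stdVertices (n + 1) ∘ i.succAbove))) 1 := by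
  rw [← singRealize_vertices, singD_singRealize, tupleD_single, map_sum]
  simp_rw [map_smul, singRealize_single]

/-- The chain complex used to define `singularHomologyOver`. -/
noncomputable abbrev mathlibSingCx : ChainComplex (ModuleCat.{max u v} F) ℕ :=
  (TopCat.toSSet.obj (TopCat.of X)).chainComplex (coeffModule.{u, v} F)

/-- The comparison map on `n`-chains. -/
noncomputable def comparisonHom (n : ℕ) :
    (mathlibSingCx.{u, v} F X).X n ⟶ ModuleCat.of F (SingChain F X n) :=
  Sigma.desc fun x => ModuleCat.ofHom
    (Finsupp.lsingle (toSSetEquiv X n x) ∘ₗ ULift.moduleEquiv.toLinearMap)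

variable {F} in
/-- The map out of a free module determined by maps out of the coefficient module. -/
noncomputable def finsuppDesc {S : Type u} {M : ModuleCat.{max u v} F}
    (φ : S → (coeffModule.{u, v} F ⟶ M)) : ModuleCat.of F (S →₀ F) ⟶ M :=
  ModuleCat.ofHom (Finsupp.lsum F fun σ => (φ σ).hom ∘ₗ ULift.moduleEquiv.symm.toLinearMap)

variable {F} in
lemma finsuppDesc_single {S : Type u} {M : ModuleCat.{max u v} F}
    (φ : S → (coeffModule.{u, v} F ⟶ M)) (s : S) (c : F) :
    finsuppDesc φ (Finsupp.single s c) = φ s ⟨c⟩ := by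
  change Finsupp.lsum F _ (Finsupp.single s c) = _
  rw [Finsupp.lsum_single]
  rfl

/-- The inverse comparison map on `n`-chains. -/
noncomputable def comparisonInv (n : ℕ) :
    ModuleCat.of F (SingChain F X n) ⟶ (mathlibSingCx.{u, v} F X).X n :=
  finsuppDesc fun σ => SSet.ιChainComplex (R := coeffModule.{u, v} F)
    (TopCat.toSSet.obj (TopCat.of X)) ((toSSetEquiv X n).symm σ)

lemma ι_comparisonHom (n : ℕ) (x) (c : F) :
    comparisonHom.{u, v} F X n
      ((TopCat.toSSet.obj (TopCat.of X)).ιChainComplex (R := coeffModule.{u, v} F) x ⟨c⟩) =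
      Finsupp.single (toSSetEquiv X n x) c := by
  have : (TopCat.toSSet.obj (TopCat.of X)).ιChainComplex (R := coeffModule.{u, v} F) x ≫
    comparisonHom.{u, v} F X n = ModuleCat.ofHom
      (Finsupp.lsingle (toSSetEquiv X n x) ∘ₗ ULift.moduleEquiv.toLinearMap) :=
    Sigma.ι_desc _ _
  exact congrArg (fun f => f.hom (ULift.up c)) this

lemma comparisonInv_single (n : ℕ) (σ : C(StdSimp n, X)) (c : F) :
    comparisonInv.{u, v} F X n (Finsupp.single σ c) =
      (TopCat.toSSet.obj (TopCat.of X)).ιChainComplex (R := coeffModule.{u, v} F)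
        ((toSSetEquiv X n).symm σ) ⟨c⟩ :=
  finsuppDesc_single _ _ _

/-- The comparison of `n`-chains as an isomorphism. -/
noncomputable def comparisonIso (n : ℕ) :
    (mathlibSingCx.{u, v} F X).X n ≅ ModuleCat.of F (SingChain F X n) where
  hom := comparisonHom F X n
  inv := comparisonInv F X n
  hom_inv_id := by
    refine SSet.chainComplex_hom_ext fun x => ?_
    ext ⟨c⟩
    simp only [ModuleCat.hom_comp, LinearMap.comp_apply]
    rw [ι_comparisonHom, comparisonInv_single, Equiv.symm_apply_apply]
    rfl
  inv_hom_id := by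
    refine ModuleCat.hom_ext (Finsupp.lhom_ext' fun σ => LinearMap.ext_ring ?_)
    change comparisonHom F X n (comparisonInv F X n (Finsupp.single σ 1)) = Finsupp.single σ 1
    rw [comparisonInv_single, ι_comparisonHom, Equiv.apply_symm_apply]

/-- The concrete singular chain complex is isomorphic to Mathlib's. -/
noncomputable def comparisonCxIso : mathlibSingCx.{u, v} F X ≅ (singCx F X).toComplex :=
  HomologicalComplex.Hom.isoOfComponents (fun n => comparisonIso F X n) (by
    rintro i j (rfl : j + 1 = i)
    refine SSet.chainComplex_hom_ext fun x => ?_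
    rw [VectCx.toComplex_d, SSet.ιChainComplex_d_assoc]
    ext ⟨c⟩
    -- The signs in the simplicial differential are integers acting on morphisms, while `singD` has
    -- signs in `F`; each face is computed here before the two are matched.
    have h1 : ∀ i : Fin (j + 2), (ModuleCat.Hom.hom (((-1 : ℤ) ^ (i : ℕ) •
        (TopCat.toSSet.obj (TopCat.of X)).ιChainComplex (R := coeffModule.{u, v} F)
          ((TopCat.toSSet.obj (TopCat.of X)).δ i x)) ≫ (comparisonIso F X j).hom)) ⟨c⟩ =
        (-1 : ℤ) ^ (i : ℕ) • Finsupp.single ((toSSetEquiv X (j + 1) x).comp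
          (affineSimplex (stdVertices (j + 1) ∘ i.succAbove))) c := fun i => by
      rw [Preadditive.zsmul_comp, ModuleCat.hom_zsmul, LinearMap.smul_apply, ← toSSetEquiv_δ]
      exact congrArg _ (ι_comparisonHom F X j _ c)
    rw [Preadditive.sum_comp, ModuleCat.hom_sum, LinearMap.sum_apply]
    refine Eq.trans ?_ (Finset.sum_congr rfl fun i _ => (h1 i).symm)
    refine (congrArg (singD F X j) (ι_comparisonHom F X (j + 1) x c)).trans ?_
    rw [singD_single]
    refine Finset.sum_congr rfl fun i _ => ?_
    rw [Finsupp.smul_single, Finsupp.smul_single, smul_eq_mul, mul_one, zsmul_eq_mul]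
    push_cast
    rfl)

lemma nonempty_singularHomology_equiv (n : ℕ) :
    Nonempty (singularHomologyOver.{u, v} F n X ≃ₗ[F] (singCx F X).H n) :=
  ⟨((HomologicalComplex.homologyFunctor _ _ n).mapIso (comparisonCxIso F X)).toLinearEquiv⟩

end Comparison
end

/-! ### Mayer–Vietoris, homotopy invariance and basic computations -/

section

open CategoryTheory AlgebraicTopology Limits

section SpaceHomology

variable {F : Type v} [Field F] {X : Type u} [TopologicalSpace X] {Y : Type u} [TopologicalSpace Y]

variable (F) in
/-- The chain map induced by a continuous map. -/
noncomputable def singMap (g : C(X, Y)) (n : ℕ) : SingChain F X n →ₗ[F] SingChain F Y n :=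
  Finsupp.lmapDomain F F fun σ => g.comp σ

@[simp] lemma singMap_single (g : C(X, Y)) (n : ℕ) (σ : C(StdSimp n, X)) (c : F) :
    singMap F g n (Finsupp.single σ c) = Finsupp.single (g.comp σ) c := by
  simp [singMap]

lemma singMap_singRealize {m : ℕ} (g : C(X, Y)) (σ : C(StdSimp m, X)) (n : ℕ)
    (x : TupleChain F (StdSimp m) (n + 1)) :
    singMap F g n (singRealize F σ n x) = singRealize F (g.comp σ) n x := by
  refine tuple_induction (f := singMap F g n ∘ₗ singRealize F σ n)
    (g := singRealize F (g.comp σ) n) (fun v => ?_) x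
  simp [ContinuousMap.comp_assoc]

lemma singD_singMap (g : C(X, Y)) (n : ℕ) (x : SingChain F X (n + 1)) :
    singD F Y n (singMap F g (n + 1) x) = singMap F g n (singD F X n x) := by
  refine singChain_induction (f := singD F Y n ∘ₗ singMap F g (n + 1))
    (g := singMap F g n ∘ₗ singD F X n) (fun σ => ?_) x
  simp only [LinearMap.comp_apply]
  rw [singMap_singRealize, singD_singRealize, singD_singRealize, singMap_singRealize]

lemma singMap_injective {g : C(X, Y)} (hg : Function.Injective g) (n : ℕ) :
    Function.Injective (singMap F g n) := by
  refine Finsupp.mapDomain_injective fun σ τ h => ?_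
  ext t
  exact hg (DFunLike.congr_fun h t)

/-- The homology of a subspace is computed by the chains lying in it. -/
lemma nonempty_H_chainsIn (U : Set X) (n : ℕ) :
    Nonempty (singularHomologyOver.{u, v} F n U ≃ₗ[F]
      ((singCx F X).sub (chainsIn F U) (singD_mem_chainsIn U)).H n) := by
  let ι : C(U, X) := ⟨Subtype.val, continuous_subtype_val⟩
  have hmem : ∀ n (x : SingChain F U n), singMap F ι n x ∈ chainsIn F U n := fun n x => by
    induction x using Finsupp.induction_linear with
    | zero => simp
    | add x y hx hy => rw [map_add]; exact Submodule.add_mem _ hx hy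
    | single σ c =>
      rw [singMap_single]
      exact Finsupp.single_mem_supported F c fun t => (σ t).2
  let φ : VectCx.Hom (singCx F U) ((singCx F X).sub (chainsIn F U) (singD_mem_chainsIn U)) :=
    ⟨fun n => (singMap F ι n).codRestrict _ (hmem n), fun n x =>
      Subtype.ext (singD_singMap ι n x)⟩
  have hφ : ∀ n, Function.Bijective (φ.f n) := fun n => by
    refine ⟨fun x y h => singMap_injective Subtype.val_injective n (congrArg Subtype.val h), ?_⟩
    rintro ⟨x, hx⟩
    have hle : chainsIn F U n ≤ LinearMap.range (singMap F ι n) := by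
      rw [chainsIn, Finsupp.supported_eq_span_single, Submodule.span_le]
      rintro _ ⟨σ, hσ, rfl⟩
      refine ⟨Finsupp.single ⟨fun t => ⟨σ t, hσ t⟩, by fun_prop⟩ 1, ?_⟩
      rw [singMap_single]
      rfl
    obtain ⟨y, hy⟩ := hle hx
    exact ⟨y, Subtype.ext hy⟩
  exact ⟨(nonempty_singularHomology_equiv F U n).some.trans
    (VectCx.nonempty_H_equiv φ hφ n).some⟩

lemma chainsIn_inf (U V : Set X) (n : ℕ) :
    chainsIn F U n ⊓ chainsIn F V n = chainsIn F (U ∩ V) n := by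
  rw [chainsIn, chainsIn, chainsIn, ← Finsupp.supported_inter]
  congr 1
  ext σ
  exact forall_and.symm

lemma nonempty_H_sub_chainsIn (U : Set X) (S : ∀ n, Submodule F (SingChain F X n))
    (h : S = chainsIn F U) (hS : ∀ n, ∀ x ∈ S (n + 1), (singCx F X).d n x ∈ S n) (n : ℕ) :
    Nonempty (singularHomologyOver.{u, v} F n U ≃ₗ[F] ((singCx F X).sub S hS).H n) := by
  subst h
  exact nonempty_H_chainsIn U n

/-- The Mayer–Vietoris sequence of an open cover by two sets. -/
lemma exists_mayerVietoris_of_isOpen {U V : Set X} (hU : IsOpen U) (hV : IsOpen V)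
    (hUV : U ∪ V = Set.univ) :
    ∃ (a : ∀ n, singularHomologyOver.{u, v} F n ↥(U ∩ V) →ₗ[F]
        singularHomologyOver.{u, v} F n U × singularHomologyOver.{u, v} F n V)
      (b : ∀ n, (singularHomologyOver.{u, v} F n U × singularHomologyOver.{u, v} F n V) →ₗ[F]
        singularHomologyOver.{u, v} F n X)
      (δ : ∀ n, singularHomologyOver.{u, v} F (n + 1) X →ₗ[F]
        singularHomologyOver.{u, v} F n ↥(U ∩ V)),
      (∀ n, Function.Exact (a n) (b n)) ∧ Function.Surjective (b 0) ∧
      (∀ n, Function.Exact (b (n + 1)) (δ n)) ∧ ∀ n, Function.Exact (δ n) (a n) := by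
  have hinf : (fun n => chainsIn F U n ⊓ chainsIn F V n) = chainsIn F (U ∩ V) :=
    funext (chainsIn_inf U V)
  have hST : ∀ n, ∀ x ∈ chainsIn F U (n + 1) ⊓ chainsIn F V (n + 1),
      (singCx F X).d n x ∈ chainsIn F U n ⊓ chainsIn F V n := fun n x hx =>
    ⟨singD_mem_chainsIn U n x hx.1, singD_mem_chainsIn V n x hx.2⟩
  obtain ⟨a, b, δ, h1, h2, h3, h4⟩ := (singCx F X).exists_mayerVietoris (chainsIn F U)
    (chainsIn F V) (singD_mem_chainsIn U) (singD_mem_chainsIn V) hST (singD_mem_sup U V)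
  have e1 : ∀ n, Nonempty (singularHomologyOver.{u, v} F n ↥(U ∩ V) ≃ₗ[F]
      ((singCx F X).sub (fun n => chainsIn F U n ⊓ chainsIn F V n) hST).H n) :=
    fun n => nonempty_H_sub_chainsIn (U ∩ V) _ hinf hST n
  have e1 := fun n => (e1 n).some
  have e2 := fun n => (nonempty_H_chainsIn (F := F) U n).some
  have e3 := fun n => (nonempty_H_chainsIn (F := F) V n).some
  -- Openness of the cover enters only here: small chains compute the homology of `X`.
  have e4 := fun n => (LinearEquiv.ofBijective _ (bijective_small_chains (F := F) hU hV hUV n)).trans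
    (nonempty_singularHomology_equiv.{u, v} F X n).some.symm
  let e23 := fun n => LinearEquiv.prodCongr (e2 n) (e3 n)
  refine ⟨fun n => (e23 n).symm.toLinearMap ∘ₗ a n ∘ₗ (e1 n).toLinearMap,
    fun n => (e4 n).toLinearMap ∘ₗ b n ∘ₗ (e23 n).toLinearMap,
    fun n => (e1 n).symm.toLinearMap ∘ₗ δ n ∘ₗ (e4 (n + 1)).symm.toLinearMap, ?_, ?_, ?_, ?_⟩
  · intro n x
    obtain ⟨x, rfl⟩ := (e23 n).symm.surjective x
    simp only [LinearMap.comp_apply, LinearEquiv.coe_coe, LinearEquiv.apply_symm_apply,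
      LinearEquiv.map_eq_zero_iff]
    rw [h1 n x]
    constructor
    · rintro ⟨y, rfl⟩
      exact ⟨(e1 n).symm y, by simp⟩
    · rintro ⟨y, hy⟩
      exact ⟨e1 n y, (e23 n).symm.injective hy⟩
  · exact (e4 0).surjective.comp (h2.comp (e23 0).surjective)
  · intro n x
    obtain ⟨x, rfl⟩ := (e4 (n + 1)).surjective x
    simp only [LinearMap.comp_apply, LinearEquiv.coe_coe, LinearEquiv.symm_apply_apply,
      LinearEquiv.map_eq_zero_iff]
    rw [h3 n x]
    constructor
    · rintro ⟨y, rfl⟩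
      exact ⟨(e23 (n + 1)).symm y, by simp⟩
    · rintro ⟨y, hy⟩
      exact ⟨e23 (n + 1) y, (e4 (n + 1)).injective hy⟩
  · intro n x
    obtain ⟨x, rfl⟩ := (e1 n).symm.surjective x
    simp only [LinearMap.comp_apply, LinearEquiv.coe_coe, LinearEquiv.apply_symm_apply,
      LinearEquiv.map_eq_zero_iff]
    rw [h4 n x]
    constructor
    · rintro ⟨y, rfl⟩
      exact ⟨e4 (n + 1) y, by simp⟩
    · rintro ⟨y, hy⟩
      exact ⟨(e4 (n + 1)).symm y, (e1 n).symm.injective hy⟩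

/-- The homology of `X` is finite-dimensional, vanishes in degrees `≥ N`, and has Euler
characteristic `c`. -/
def SpaceEuler (F : Type v) [Field F] (X : Type u) [TopologicalSpace X] (N : ℕ) (c : ℤ) : Prop :=
  HasEulerChar F (fun n => singularHomologyOver.{u, v} F n X) N c

/-- The connecting map lowers the degree by one, which is why the bound for the overlap is one less
than for the pieces. -/
lemma SpaceEuler.union {U V : Set X} (hU : IsOpen U) (hV : IsOpen V)
    (hUV : U ∪ V = Set.univ) {N : ℕ} {α μ ν : ℤ} (h1 : SpaceEuler F ↥(U ∩ V) N α)
    (h2 : SpaceEuler F U (N + 1) μ) (h3 : SpaceEuler F V (N + 1) ν) :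
    SpaceEuler F X (N + 1) (μ + ν - α) := by
  obtain ⟨a, b, δ, hab, hb, hbδ, hδa⟩ := exists_mayerVietoris_of_isOpen (F := F) hU hV hUV
  exact HasEulerChar.of_long_exact h1 (HasEulerChar.prod h2 h3) a b δ hab hb hbδ hδa

/-- If the overlap has no homology in degree `n`, then `H_n(U) ⊕ H_n(V)` injects into `H_n(X)`. The
finiteness assumptions guard against `finrank` being `0` on infinite-dimensional spaces. -/
lemma bettiNumber_add_le {U V : Set X} (hU : IsOpen U) (hV : IsOpen V)
    (hUV : U ∪ V = Set.univ) {n : ℕ} (h1 : Subsingleton (singularHomologyOver.{u, v} F n ↥(U ∩ V)))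
    (h2 : Module.Finite F (singularHomologyOver.{u, v} F n U))
    (h3 : Module.Finite F (singularHomologyOver.{u, v} F n V))
    (h4 : Module.Finite F (singularHomologyOver.{u, v} F n X)) :
    bettiNumber.{u, v} F n U + bettiNumber.{u, v} F n V ≤ bettiNumber.{u, v} F n X := by
  obtain ⟨a, b, δ, hab, hb, hbδ, hδa⟩ := exists_mayerVietoris_of_isOpen (F := F) hU hV hUV
  have := finrank_le_of_exact_of_subsingleton _ _ (hab n)
  rwa [Module.finrank_prod] at this

lemma map_singularHomology_eq {Z W : TopCat.{u}} (R : ModuleCat.{max u v} F) (p q : Z ⟶ W)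
    (h : ContinuousMap.Homotopic p.hom q.hom) (n : ℕ) :
    ((singularHomologyFunctor (ModuleCat.{max u v} F) n).obj R).map p =
      ((singularHomologyFunctor (ModuleCat.{max u v} F) n).obj R).map q :=
  TopCat.Homotopy.congr_homologyMap_singularChainComplexFunctor h.some R n

lemma nonempty_iso_of_homotopyEquiv {C : Type*} [Category C] (Φ : TopCat.{u} ⥤ C)
    (hΦ : ∀ {Z W : TopCat.{u}} (p q : Z ⟶ W), ContinuousMap.Homotopic p.hom q.hom →
      Φ.map p = Φ.map q) (e : ContinuousMap.HomotopyEquiv X Y) :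
    Nonempty (Φ.obj (TopCat.of X) ≅ Φ.obj (TopCat.of Y)) := by
  refine ⟨Iso.mk (Φ.map (TopCat.ofHom e.toFun)) (Φ.map (TopCat.ofHom e.invFun)) ?_ ?_⟩
  · rw [← Φ.map_comp, ← Φ.map_id]
    exact hΦ _ _ e.left_inv
  · rw [← Φ.map_comp, ← Φ.map_id]
    exact hΦ _ _ e.right_inv

lemma nonempty_homology_equiv_of_homotopyEquiv (e : ContinuousMap.HomotopyEquiv X Y) (n : ℕ) :
    Nonempty (singularHomologyOver.{u, v} F n X ≃ₗ[F] singularHomologyOver.{u, v} F n Y) :=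
  ⟨(nonempty_iso_of_homotopyEquiv _ (fun p q h => map_singularHomology_eq _ p q h n)
    e).some.toLinearEquiv⟩

lemma SpaceEuler.of_homotopyEquiv (e : ContinuousMap.HomotopyEquiv X Y) {N : ℕ} {c : ℤ}
    (h : SpaceEuler F X N c) : SpaceEuler F Y N c :=
  HasEulerChar.congr h fun n => nonempty_homology_equiv_of_homotopyEquiv e n

lemma bettiNumber_eq_of_homotopyEquiv (e : ContinuousMap.HomotopyEquiv X Y) (n : ℕ) :
    bettiNumber.{u, v} F n X = bettiNumber.{u, v} F n Y :=
  (nonempty_homology_equiv_of_homotopyEquiv e n).some.finrank_eq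

lemma nonempty_homology_zero_equiv [PathConnectedSpace X] :
    Nonempty (singularHomologyOver.{u, v} F 0 X ≃ₗ[F] F) := by
  let ε := (TopCat.of X).singularHomology₀ε (ModuleCat.of F (ULift.{u} F))
  have : PathConnectedSpace (TopCat.of X) := inferInstanceAs (PathConnectedSpace X)
  exact ⟨(asIso ε).toLinearEquiv.trans ULift.moduleEquiv⟩

lemma spaceEuler_of_isEmpty [IsEmpty X] (N : ℕ) : SpaceEuler F X N 0 := by
  have h : ∀ n, Subsingleton (singularHomologyOver.{u, v} F n X) := fun n => by
    have e := (nonempty_singularHomology_equiv.{u, v} F X n).some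
    have : Subsingleton ((singCx F X).H n) := by
      apply VectCx.subsingleton_H
      intro x _
      have : IsEmpty C(StdSimp n, X) := ⟨fun σ => isEmptyElim (σ (stdVertices n 0))⟩
      refine ⟨0, ?_⟩
      have hs : Subsingleton (SingChain F X n) := inferInstance
      exact hs.elim _ _
    exact e.toEquiv.subsingleton
  exact ⟨fun n => by have := h n; infer_instance, fun n _ => h n,
    Finset.sum_eq_zero fun n _ => by
      have := h n; rw [Module.finrank_zero_of_subsingleton]; simp⟩

lemma subsingleton_homology_of_totallyDisconnected (Z : TopCat.{u})
    [TotallyDisconnectedSpace Z] (n : ℕ) (hn : n ≠ 0) :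
    Subsingleton (singularHomologyOver.{u, v} F n Z) :=
  ModuleCat.subsingleton_of_isZero
    (isZero_singularHomologyFunctor_of_totallyDisconnectedSpace _ _ _ Z hn)

lemma spaceEuler_of_contractible [ContractibleSpace X] : SpaceEuler F X 1 1 := by
  have hs : ∀ n, 1 ≤ n → Subsingleton (singularHomologyOver.{u, v} F n X) := fun n hn => by
    have : Subsingleton (singularHomologyOver.{u, v} F n PUnit.{u + 1}) :=
      subsingleton_homology_of_totallyDisconnected (TopCat.of PUnit.{u + 1}) n (by omega)
    have e : ContinuousMap.HomotopyEquiv X PUnit.{u + 1} :=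
      (ContractibleSpace.hequiv X PUnit.{u + 1}).some
    exact (nonempty_homology_equiv_of_homotopyEquiv (F := F) e n).some.toEquiv.subsingleton
  have e0 := (nonempty_homology_zero_equiv (F := F) (X := X)).some
  refine ⟨fun n => ?_, hs, ?_⟩
  · rcases n with _ | n
    · exact Module.Finite.equiv e0.symm
    · have := hs (n + 1) (by omega)
      infer_instance
  · simp [e0.finrank_eq]

end SpaceHomology
end

/-! ### Betti numbers of coverings with a finite `p`-group -/

section

namespace VectCx

variable {F : Type v} [Field F]

/-- If `T` is a nilpotent endomorphism of `C` of order `m + 1` whose kernel is contained in the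
image of `T ^ m` and is isomorphic to `D`, then the Betti numbers of `C` are at most `m + 1` times
those of `D`. -/
lemma finrank_H_le_of_nilpotent (C D : VectCx.{v, w} F) (T : Hom C C) (j : Hom D C) (m : ℕ)
    (hj : ∀ n, Function.Injective (j.f n))
    (hjT : ∀ n, LinearMap.range (j.f n) = LinearMap.ker (T.f n))
    (hker : ∀ n, LinearMap.ker (T.f n) ≤ LinearMap.range ((T.f n) ^ m))
    (hpow : ∀ n, (T.f n) ^ (m + 1) = 0) (n : ℕ) (hD : Module.Finite F (D.H n)) :
    Module.Finite F (C.H n) ∧ Module.finrank F (C.H n) ≤ (m + 1) * Module.finrank F (D.H n) := by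
  have hcomm : ∀ k n x, C.d n ((T.f (n + 1) ^ k) x) = (T.f n ^ k) (C.d n x) := fun k => by
    induction k with
    | zero => simp
    | succ k ih => intro n x; rw [pow_succ, pow_succ, Module.End.mul_apply, Module.End.mul_apply,
        ih, T.comm]
  let S : ∀ k n, Submodule F (C.X n) := fun k n => LinearMap.range ((T.f n) ^ k)
  have hS : ∀ k n, ∀ x ∈ S k (n + 1), C.d n x ∈ S k n := by
    rintro k n _ ⟨y, rfl⟩
    exact ⟨C.d n y, (hcomm k n y).symm⟩
  -- The images of `T ^ k` filter `C`. The induction descends from `T ^ (m + 1) = 0` to `T ^ 0`, and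
  -- `l` counts the layers collected so far.
  have key : ∀ l k, l + k = m + 1 → Module.Finite F ((C.sub (S k) (hS k)).H n) ∧
      Module.finrank F ((C.sub (S k) (hS k)).H n) ≤ l * Module.finrank F (D.H n) := by
    intro l
    induction l with
    | zero =>
      rintro k hk
      obtain rfl : k = m + 1 := by omega
      have : Subsingleton ((C.sub (S (m + 1)) (hS (m + 1))).H n) := by
        apply subsingleton_H
        rintro ⟨x, y, rfl⟩ -
        refine ⟨0, Subtype.ext ?_⟩
        simp only [hpow, LinearMap.zero_apply, map_zero]
        rfl
      refine ⟨inferInstance, ?_⟩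
      rw [Module.finrank_zero_of_subsingleton]
      simp
    | succ l ih =>
      intro k hk
      obtain ⟨h1, h2⟩ := ih (k + 1) (by omega)
      have hkm : ∀ n, LinearMap.ker (T.f n) ≤ S k n := fun n x hx => by
        obtain ⟨y, rfl⟩ := hker n hx
        refine ⟨(T.f n ^ (m - k)) y, ?_⟩
        rw [← Module.End.mul_apply, ← pow_add]
        congr 2
        omega
      -- For `k ≤ m` the whole kernel of `T` lies in the image of `T ^ k`, which gives a short exact
      -- sequence `0 → D → im T^k → im T^(k+1) → 0`; each layer costs one copy of the homology of
      -- `D`.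
      let f : Hom D (C.sub (S k) (hS k)) :=
        ⟨fun n => (j.f n).codRestrict _ fun x => hkm n (hjT n ▸ ⟨x, rfl⟩), fun n x =>
          Subtype.ext (j.comm n x)⟩
      have hg : ∀ n, ∀ x ∈ S k n, T.f n x ∈ S (k + 1) n := by
        rintro n _ ⟨y, rfl⟩
        exact ⟨y, by rw [pow_succ']; rfl⟩
      let g : Hom (C.sub (S k) (hS k)) (C.sub (S (k + 1)) (hS (k + 1))) :=
        ⟨fun n => (T.f n).restrict (hg n), fun n x => Subtype.ext (T.comm n x.1)⟩
      obtain ⟨h3, -⟩ := exists_long_exact f g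
        (fun n x y h => hj n (congrArg Subtype.val h))
        (fun n => by
          rintro ⟨x, hx⟩
          constructor
          · intro h
            have : x ∈ LinearMap.ker (T.f n) := congrArg Subtype.val h
            rw [← hjT] at this
            obtain ⟨y, rfl⟩ := this
            exact ⟨y, rfl⟩
          · rintro ⟨y, hy⟩
            have h1 : j.f n y = x := congrArg Subtype.val hy
            have : x ∈ LinearMap.ker (T.f n) := by rw [← hjT]; exact ⟨y, h1⟩
            exact Subtype.ext this)
        (fun n => by
          rintro ⟨_, y, rfl⟩
          exact ⟨⟨(T.f n ^ k) y, y, rfl⟩, Subtype.ext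
            (LinearMap.congr_fun (pow_succ' (T.f n) k) y).symm⟩)
      refine ⟨finite_of_function_exact (h3 n), ?_⟩
      have := finrank_le_of_function_exact (h3 n)
      rw [add_mul, one_mul]
      omega
  obtain ⟨h1, h2⟩ := key (m + 1) 0 rfl
  have e := (nonempty_H_equiv (C.subIncl (S 0) (hS 0)) (fun n =>
    ⟨(S 0 n).injective_subtype, fun x => ⟨⟨x, x, by simp⟩, rfl⟩⟩) n).some
  exact ⟨Module.Finite.equiv e, e.finrank_eq ▸ h2⟩

end VectCx

section Covering

variable {F : Type v} [Field F] {E B : Type u} [TopologicalSpace E] [TopologicalSpace B]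
  {G : Type w} [Group G] [MulAction G E] {q : E → B}

instance (n : ℕ) : ContractibleSpace (StdSimp n) :=
  (convex_stdSimplex ℝ _).contractibleSpace ⟨_, (stdVertices n 0).2⟩

instance (n : ℕ) : LocallyPathConnectedSpace (StdSimp n) :=
  (convex_stdSimplex ℝ _).locallyPathConnectedSpace

/-- The homeomorphism given by a group element, as a continuous map. -/
def smulMap [ContinuousConstSMul G E] (g : G) : C(E, E) := ⟨(g • ·), continuous_const_smul g⟩

@[simp] lemma smulMap_apply [ContinuousConstSMul G E] (g : G) (x : E) :
    smulMap g x = g • x := rfl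

variable {A : Type*} [TopologicalSpace A]

/-- Maps from simply connected spaces lift to coverings. -/
lemma IsQuotientCoveringMap.exists_lift (hq : IsQuotientCoveringMap q G) [SimplyConnectedSpace A]
    [LocallyPathConnectedSpace A] (σ : C(A, B)) : ∃ τ : C(A, E), ∀ a, q (τ a) = σ a := by
  have a : A := Classical.arbitrary A
  obtain ⟨e, he⟩ := hq.surjective (σ a)
  obtain ⟨τ, ⟨-, h⟩, -⟩ := hq.isCoveringMap.existsUnique_continuousMap_lifts σ a e he
  exact ⟨τ, fun x => congrFun h x⟩

/-- Two lifts of a map from a connected space differ by an element of the group. -/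
lemma IsQuotientCoveringMap.exists_smul_eq (hq : IsQuotientCoveringMap q G) [ConnectedSpace A]
    (τ τ' : C(A, E)) (h : ∀ a, q (τ a) = q (τ' a)) : ∃ g : G, ∀ a, τ a = g • τ' a := by
  have := hq.toContinuousConstSMul
  have a : A := Classical.arbitrary A
  obtain ⟨g, hg⟩ := hq.apply_eq_iff_mem_orbit.1 (h a)
  refine ⟨g, congrFun (hq.isCoveringMap.eq_of_comp_eq (g₂ := smulMap g ∘ τ') τ.continuous
    ((smulMap g).continuous.comp τ'.continuous) ?_ a hg.symm)⟩
  ext x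
  simp [h, hq.map_smul]

lemma singMap_comp {Z : Type u} [TopologicalSpace Z] (g : C(B, Z)) (f : C(E, B)) (n : ℕ)
    (x : SingChain F E n) : singMap F (g.comp f) n x = singMap F g n (singMap F f n x) := by
  refine congrFun (congrArg DFunLike.coe (?_ : singMap F (g.comp f) n =
    singMap F g n ∘ₗ singMap F f n)) x
  refine Finsupp.lhom_ext fun σ c => ?_
  simp [ContinuousMap.comp_assoc]

variable [Fintype G]

/-- The transfer homomorphism of a finite regular covering. -/
noncomputable def transfer [ContinuousConstSMul G E] (s : ∀ n, C(StdSimp n, B) → C(StdSimp n, E))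
    (n : ℕ) : SingChain F B n →ₗ[F] SingChain F E n :=
  Finsupp.linearCombination F fun σ => ∑ g : G, Finsupp.single ((smulMap g).comp (s n σ)) 1

/-- Exactly one translate of the chosen lift of `q ∘ τ` equals `τ`, by transitivity and freeness of
the action on lifts. So the transfer is composition with `q` on coefficients, whatever the section
`s`. -/
lemma transfer_apply (hq : IsQuotientCoveringMap q G) [ContinuousConstSMul G E]
    (s : ∀ n, C(StdSimp n, B) → C(StdSimp n, E)) (hs : ∀ n σ t, q (s n σ t) = σ t) (n : ℕ)
    (y : SingChain F B n) (τ : C(StdSimp n, E)) :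
    transfer (G := G) s n y τ = y (ContinuousMap.comp ⟨q, hq.continuous⟩ τ) := by
  classical
  have := hq.isCancelSMul
  induction y using Finsupp.induction_linear with
  | zero => simp
  | add x y hx hy => rw [map_add, Finsupp.add_apply, hx, hy, Finsupp.add_apply]
  | single σ c =>
    simp only [transfer, Finsupp.linearCombination_single, Finsupp.smul_apply,
      Finsupp.finsetSum_apply, Finsupp.single_apply, smul_eq_mul]
    by_cases h : σ = ContinuousMap.comp ⟨q, hq.continuous⟩ τ
    · rw [if_pos h]
      obtain ⟨g, hg⟩ := hq.exists_smul_eq τ (s n σ) (fun a => by rw [hs, h]; rfl)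
      rw [Finset.sum_eq_single g]
      · rw [if_pos (ContinuousMap.ext fun t => (hg t).symm), mul_one]
      · intro g' _ hg'
        rw [if_neg]
        intro h'
        apply hg'
        have h1 := DFunLike.congr_fun h' (stdVertices n 0)
        rw [hg] at h1
        exact IsCancelSMul.right_cancel _ _ _ h1
      · simp
    · rw [if_neg h, Finset.sum_eq_zero, mul_zero]
      intro g _
      rw [if_neg]
      rintro rfl
      apply h
      ext t
      simp [hq.map_smul, hs]

lemma transfer_singMap (hq : IsQuotientCoveringMap q G) [ContinuousConstSMul G E]
    (s : ∀ n, C(StdSimp n, B) → C(StdSimp n, E)) (hs : ∀ n σ t, q (s n σ t) = σ t) (n : ℕ)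
    (x : SingChain F E n) :
    transfer (G := G) s n (singMap F ⟨q, hq.continuous⟩ n x) =
      ∑ g : G, singMap F (smulMap g) n x := by
  induction x using Finsupp.induction_linear with
  | zero => simp
  | add x y hx hy => simp only [map_add, hx, hy, Finset.sum_add_distrib]
  | single σ c =>
    simp only [singMap_single, transfer, Finsupp.linearCombination_single]
    obtain ⟨h, hh⟩ := hq.exists_smul_eq (s n (ContinuousMap.comp ⟨q, hq.continuous⟩ σ)) σ
      (fun a => hs _ _ _)
    rw [Finset.smul_sum, ← Equiv.sum_comp (Equiv.mulRight h⁻¹)]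
    refine Finset.sum_congr rfl fun g _ => ?_
    rw [Finsupp.smul_single, smul_eq_mul, mul_one]
    congr 1
    ext t
    simp [hh, mul_smul]

omit [Fintype G] in
lemma singMap_surjective (hq : IsQuotientCoveringMap q G) (n : ℕ) :
    Function.Surjective (singMap F (⟨q, hq.continuous⟩ : C(E, B)) n) := by
  intro x
  induction x using Finsupp.induction_linear with
  | zero => exact ⟨0, map_zero _⟩
  | add x y hx hy =>
    obtain ⟨a, rfl⟩ := hx
    obtain ⟨b, rfl⟩ := hy
    exact ⟨a + b, map_add _ _ _⟩
  | single σ c =>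
    obtain ⟨τ, hτ⟩ := hq.exists_lift σ
    exact ⟨Finsupp.single τ c, by rw [singMap_single]; congr 1; ext t; exact hτ t⟩

/-- The chosen lifts need not be compatible with faces. Instead `y` is lifted to a chain on `E`,
where the transfer becomes the sum of all group elements, and these commute with the boundary. -/
lemma singD_transfer (hq : IsQuotientCoveringMap q G) [ContinuousConstSMul G E]
    (s : ∀ n, C(StdSimp n, B) → C(StdSimp n, E)) (hs : ∀ n σ t, q (s n σ t) = σ t) (n : ℕ)
    (y : SingChain F B (n + 1)) :
    singD F E n (transfer (G := G) s (n + 1) y) = transfer (G := G) s n (singD F B n y) := by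
  obtain ⟨x, rfl⟩ := singMap_surjective hq (n + 1) y
  rw [transfer_singMap hq s hs, singD_singMap, transfer_singMap hq s hs, map_sum]
  exact Finset.sum_congr rfl fun g _ => singD_singMap _ _ _

/-- In `F[X]` both sides times `X - 1` are `X^p - 1 = (X - 1)^p`, and `X - 1` can be cancelled
there; in `R` it could not. -/
lemma geom_sum_eq_sub_one_pow {R : Type*} [Ring R] [Algebra F R] (p : ℕ) [Fact p.Prime]
    [CharP F p] (t : R) : ∑ i ∈ Finset.range p, t ^ i = (t - 1) ^ (p - 1) := by
  have h : ∑ i ∈ Finset.range p, (Polynomial.X : Polynomial F) ^ i =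
      (Polynomial.X - 1) ^ (p - 1) := by
    have h1 : (Polynomial.X - 1 : Polynomial F) ≠ 0 := Polynomial.X_sub_C_ne_zero (1 : F)
    apply mul_right_cancel₀ h1
    rw [geom_sum_mul, ← pow_succ, Nat.sub_add_cancel (Fact.out : p.Prime).one_le, sub_pow_char,
      one_pow]
  simpa using congrArg (Polynomial.aeval t) h

lemma sub_one_pow_eq_zero {R : Type*} [Ring R] [Algebra F R] (p : ℕ) [Fact p.Prime]
    [CharP F p] (t : R) (ht : t ^ p = 1) : (t - 1) ^ p = 0 := by
  have h : (Polynomial.X - 1 : Polynomial F) ^ p = Polynomial.X ^ p - 1 := by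
    rw [sub_pow_char, one_pow]
  simpa [ht] using congrArg (Polynomial.aeval t) h

omit [Fintype G] in
lemma singMap_smulMap_pow [ContinuousConstSMul G E] (g : G) (n k : ℕ) :
    singMap F (smulMap (E := E) (g ^ k)) n = singMap F (smulMap g) n ^ k := by
  induction k with
  | zero =>
    refine Finsupp.lhom_ext fun σ c => ?_
    rw [singMap_single, pow_zero, pow_zero, Module.End.one_apply]
    congr 1
    ext t
    simp
  | succ k ih =>
    have : smulMap (E := E) (g ^ (k + 1)) = (smulMap (g ^ k)).comp (smulMap g) := by
      ext t; simp [pow_succ, mul_smul]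
    rw [this, pow_succ, ← ih]
    exact LinearMap.ext (singMap_comp _ _ _)

omit [Fintype G] in
/-- For a regular covering with group of order `p` the Betti numbers over a field of
characteristic `p` grow at most by the factor `p`. -/
lemma bettiNumber_le_of_card_eq_prime (hq : IsQuotientCoveringMap q G) (p : ℕ) [Fact p.Prime]
    [CharP F p] (hG : Nat.card G = p) (n : ℕ)
    (hB : Module.Finite F (singularHomologyOver.{u, v} F n B)) :
    Module.Finite F (singularHomologyOver.{u, v} F n E) ∧
      bettiNumber.{u, v} F n E ≤ p * bettiNumber.{u, v} F n B := by
  have hp : p.Prime := Fact.out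
  have := hq.toContinuousConstSMul
  have : Finite G := Nat.finite_of_card_ne_zero (by rw [hG]; exact hp.ne_zero)
  have : Fintype G := Fintype.ofFinite G
  have : IsCyclic G := isCyclic_of_prime_card hG
  obtain ⟨t, ht⟩ := IsCyclic.exists_generator (α := G)
  classical
  have htp : orderOf t = p := by rw [← hG]; exact orderOf_eq_card_of_forall_mem_zpowers ht
  have hsum : ∀ n (x : SingChain F E n), ∑ g : G, singMap F (smulMap g) n x =
      ∑ i ∈ Finset.range p, (singMap F (smulMap t) n ^ i) x := by
    intro n x
    rw [← IsCyclic.image_range_orderOf ht, htp, Finset.sum_image]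
    · exact Finset.sum_congr rfl fun i _ => by rw [singMap_smulMap_pow]
    · intro i hi j hj hij
      rw [← htp] at hi hj
      exact pow_injOn_Iio_orderOf (by simpa using hi) (by simpa using hj) hij
  choose s hs using fun n (σ : C(StdSimp n, B)) => hq.exists_lift σ
  -- `finrank_H_le_of_nilpotent` is applied with `T = t - 1`, the transfer as `j`, and `m = p - 1`.
  let T : VectCx.Hom (singCx F E) (singCx F E) :=
    ⟨fun n => (singMap F (smulMap t) n - 1 : Module.End F (SingChain F E n)),
      fun n (x : SingChain F E (n + 1)) => by
      show singD F E n (singMap F (smulMap t) (n + 1) x - x) =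
        singMap F (smulMap t) n (singD F E n x) - singD F E n x
      rw [map_sub, singD_singMap]⟩
  let j : VectCx.Hom (singCx F B) (singCx F E) :=
    ⟨transfer (G := G) s, singD_transfer hq s hs⟩
  have happ := transfer_apply (F := F) hq s hs
  have hT : ∀ n (x : SingChain F E n), T.f n x = 0 ↔ singMap F (smulMap t) n x = x :=
    fun n x => sub_eq_zero
  have hjinj : ∀ n, Function.Injective (j.f n) := fun n x y h => by
    refine Finsupp.ext fun σ => ?_
    have := DFunLike.congr_fun (show transfer (G := G) s n x = transfer (G := G) s n y from h)
      (s n σ)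
    replace this := (happ n x (s n σ)).symm.trans (this.trans (happ n y (s n σ)))
    have h1 : ContinuousMap.comp ⟨q, hq.continuous⟩ (s n σ) = σ := ContinuousMap.ext (hs n σ)
    rwa [h1] at this
  -- A chain fixed by `t` has coefficients constant along `G`-orbits of simplices, so it is the
  -- transfer of the chain whose coefficients are read off at the chosen lifts.
  have hker : ∀ n (x : SingChain F E n), T.f n x = 0 → ∃ y, j.f n y = x := by
    intro n x hx
    rw [hT] at hx
    have hinv : ∀ (g : G) (σ : C(StdSimp n, E)), x ((smulMap g).comp σ) = x σ := by
      intro g σ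
      obtain ⟨k, rfl⟩ : ∃ k : ℕ, t ^ k = g := by
        have := Finset.mem_univ g
        rw [← IsCyclic.image_range_orderOf ht] at this
        obtain ⟨k, -, hk⟩ := Finset.mem_image.1 this
        exact ⟨k, hk⟩
      have h1 : singMap F (smulMap (t ^ k)) n x = x := by
        rw [singMap_smulMap_pow]
        clear σ
        induction k with
        | zero => rfl
        | succ k ih => rw [pow_succ, Module.End.mul_apply, hx, ih]
      have hinj : Function.Injective fun τ : C(StdSimp n, E) => (smulMap (t ^ k)).comp τ := by
        intro τ τ' h
        ext a
        have := DFunLike.congr_fun h a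
        simpa using this
      conv_lhs => rw [← h1]
      exact Finsupp.mapDomain_apply hinj x σ
    have hsinj : Function.Injective (s n) := fun σ σ' h => by
      ext a
      rw [← hs n σ, h, hs]
    refine ⟨Finsupp.comapDomain (s n) x hsinj.injOn, ?_⟩
    refine Finsupp.ext fun τ => ?_
    refine (happ n _ τ).trans ?_
    rw [Finsupp.comapDomain_apply]
    obtain ⟨g, hg⟩ := hq.exists_smul_eq (s n (ContinuousMap.comp ⟨q, hq.continuous⟩ τ)) τ
      (fun a => hs _ _ _)
    rw [← hinv g τ]
    exact congrArg x (ContinuousMap.ext hg)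
  -- Since `q` is surjective on chains, this makes the image of `T ^ (p - 1)` equal to the image of
  -- the transfer, hence to the kernel of `T`.
  have hpow : ∀ n (x : SingChain F E n), (T.f n ^ (p - 1)) x =
      transfer (G := G) s n (singMap F ⟨q, hq.continuous⟩ n x) := by
    intro n x
    rw [transfer_singMap hq s hs, hsum, ← LinearMap.sum_apply,
      geom_sum_eq_sub_one_pow (F := F) p (singMap F (smulMap t) n)]
    rfl
  have htpow : ∀ n, (T.f n) ^ p = 0 := fun n => by
    refine sub_one_pow_eq_zero (F := F) p (singMap F (smulMap t) n) ?_
    rw [← singMap_smulMap_pow, ← htp, pow_orderOf_eq_one, ← pow_zero t, singMap_smulMap_pow,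
      pow_zero]
  have hp1 : p - 1 + 1 = p := Nat.sub_add_cancel hp.one_le
  have eB := (nonempty_singularHomology_equiv.{u, v} F B n).some
  have eE := (nonempty_singularHomology_equiv.{u, v} F E n).some
  obtain ⟨h1, h2⟩ := VectCx.finrank_H_le_of_nilpotent _ _ T j (p - 1) hjinj
    (fun n => by
      ext x
      constructor
      · rintro ⟨y, rfl⟩
        obtain ⟨z, rfl⟩ := singMap_surjective (F := F) hq n y
        have h3 : j.f n (singMap F ⟨q, hq.continuous⟩ n z) = (T.f n ^ (p - 1)) z :=
          (hpow n z).symm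
        rw [LinearMap.mem_ker, h3]
        have := LinearMap.congr_fun (pow_succ' (T.f n) (p - 1)) z
        rw [hp1, htpow] at this
        exact this.symm
      · intro hx
        exact hker n x hx)
    (fun n x hx => by
      obtain ⟨y, rfl⟩ := hker n x hx
      obtain ⟨z, rfl⟩ := singMap_surjective (F := F) hq n y
      exact ⟨z, hpow n z⟩)
    (fun n => by rw [hp1]; exact htpow n) n (Module.Finite.equiv eB)
  refine ⟨Module.Finite.equiv eE.symm, ?_⟩
  rw [bettiNumber, bettiNumber, eE.finrank_eq, eB.finrank_eq]
  rwa [hp1] at h2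

end Covering

section QuotientByNormal

variable {E : Type u} {G : Type w} [Group G] [MulAction G E]

/-- The action of `G ⧸ N` on the space of `N`-orbits. -/
instance orbitQuotientMulAction (N : Subgroup G) [N.Normal] :
    MulAction (G ⧸ N) (Quotient (MulAction.orbitRel N E)) where
  smul a x := Quotient.liftOn₂ a x (fun g e => Quotient.mk _ (g • e)) (by
    intro g e g' e' hg he
    obtain ⟨n, rfl⟩ := he
    have h1 : g⁻¹ * g' ∈ N := QuotientGroup.leftRel_apply.1 hg
    refine Quotient.sound ⟨⟨g * n * g'⁻¹, ?_⟩, ?_⟩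
    · have h2 : g * (n * (g⁻¹ * g')⁻¹) * g⁻¹ ∈ N :=
        Subgroup.Normal.conj_mem inferInstance _ (N.mul_mem n.2 (N.inv_mem h1)) g
      convert h2 using 1
      group
    · show (g * n * g'⁻¹) • g' • e' = g • n • e'
      rw [Subgroup.smul_def, mul_smul, mul_smul, inv_smul_smul])
  one_smul x := by
    induction x using Quotient.inductionOn with | _ e
    exact congrArg (Quotient.mk _) (one_smul G e)
  mul_smul a b x := by
    induction x using Quotient.inductionOn with | _ e
    induction a using QuotientGroup.induction_on with | _ g
    induction b using QuotientGroup.induction_on with | _ h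
    exact congrArg (Quotient.mk _) (mul_smul g h e)

variable [TopologicalSpace E] {B : Type*} [TopologicalSpace B] {q : E → B}

lemma IsQuotientCoveringMap.quotient_mk (hq : IsQuotientCoveringMap q G) (N : Subgroup G) :
    IsQuotientCoveringMap (Quotient.mk (MulAction.orbitRel N E)) N where
  __ := isQuotientMap_quotient_mk'
  continuous_const_smul n := hq.continuous_const_smul (n : G)
  apply_eq_iff_mem_orbit := Quotient.eq''
  disjoint e := by
    obtain ⟨U, hU, h⟩ := hq.disjoint e
    exact ⟨U, hU, fun n hn => Subtype.ext (h n hn)⟩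

/-- The map induced on a quotient of a regular covering. -/
def IsQuotientCoveringMap.quotientLift (hq : IsQuotientCoveringMap q G) (N : Subgroup G) :
    Quotient (MulAction.orbitRel N E) → B :=
  Quotient.lift q fun _ _ h => by
    obtain ⟨n, rfl⟩ := h
    exact hq.map_smul (n : G)

/-- If the image in `E/N` of a good neighbourhood `U` meets its translate by the class of `g`, then
some `n * g` with `n ∈ N` moves a point of `U` into `U`; hence `n * g = 1` and `g ∈ N`. -/
lemma IsQuotientCoveringMap.isQuotientCoveringMap_quotientLift (hq : IsQuotientCoveringMap q G)
    (N : Subgroup G) [N.Normal] : IsQuotientCoveringMap (hq.quotientLift N) (G ⧸ N) where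
  __ := Topology.IsQuotientMap.of_comp (f := Quotient.mk (MulAction.orbitRel N E))
    continuous_quot_mk (hq.continuous.quotient_lift _) hq.toIsQuotientMap
  continuous_const_smul a := by
    induction a using QuotientGroup.induction_on with | _ g
    have := hq.toContinuousConstSMul
    exact continuous_quot_lift _ (continuous_quot_mk.comp (continuous_const_smul g))
  apply_eq_iff_mem_orbit {x y} := by
    induction x using Quotient.inductionOn with | _ e
    induction y using Quotient.inductionOn with | _ e'
    refine hq.apply_eq_iff_mem_orbit.trans ⟨?_, ?_⟩
    · rintro ⟨g, rfl⟩
      exact ⟨g, rfl⟩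
    · rintro ⟨a, h⟩
      induction a using QuotientGroup.induction_on with | _ g
      obtain ⟨n, hn⟩ := Quotient.exact (show Quotient.mk (MulAction.orbitRel N E) (g • e') = _ from h)
      refine ⟨(n : G)⁻¹ * g, ?_⟩
      simp only at hn ⊢
      rw [mul_smul, ← hn, Subgroup.smul_def, inv_smul_smul]
  disjoint x := by
    induction x using Quotient.inductionOn with | _ e
    obtain ⟨U, hU, h⟩ := hq.disjoint e
    refine ⟨_, (hq.quotient_mk N).isOpenQuotientMap.isOpenMap.image_mem_nhds hU, fun a => ?_⟩
    induction a using QuotientGroup.induction_on with | _ g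
    rintro ⟨_, ⟨_, ⟨x, hx, rfl⟩, rfl⟩, y, hy, hxy⟩
    obtain ⟨n, hn⟩ := Quotient.exact
      (show Quotient.mk (MulAction.orbitRel N E) y = Quotient.mk _ (g • x) from hxy)
    have h1 := h ((n : G) * g) ⟨y, ⟨x, hx, ?_⟩, hy⟩
    · have : g = ((n⁻¹ : N) : G) := by
        rw [Subgroup.coe_inv]; exact eq_inv_of_mul_eq_one_right h1
      rw [this]
      exact (QuotientGroup.eq_one_iff _).2 (n⁻¹).2
    · simp only at hn ⊢
      rw [mul_smul, ← hn]
      rfl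

end QuotientByNormal

/-- A covering with one sheet is a homeomorphism. -/
lemma IsQuotientCoveringMap.nonempty_homeomorph {E B : Type*} [TopologicalSpace E]
    [TopologicalSpace B] {G : Type*} [Group G] [MulAction G E] {q : E → B}
    (hq : IsQuotientCoveringMap q G) (hG : Nat.card G = 1) : Nonempty (E ≃ₜ B) := by
  have : Subsingleton G := (Nat.card_eq_one_iff_unique.1 hG).1
  have hinj : Function.Injective q := fun x y h => by
    obtain ⟨g, rfl⟩ := hq.apply_eq_iff_mem_orbit.1 h
    simp [Subsingleton.elim g 1]
  exact ⟨(Equiv.ofBijective q ⟨hinj, hq.surjective⟩).toHomeomorphOfContinuousOpen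
    hq.continuous hq.isOpenQuotientMap.isOpenMap⟩

section PGroupCovering

variable {F : Type v} [Field F] {B : Type u} [TopologicalSpace B]

/-- The Betti numbers in characteristic `p` grow at most by the factor `|G|` in a regular covering
whose group `G` is a finite `p`-group. -/
lemma bettiNumber_le_of_card_eq_prime_pow (p : ℕ) [Fact p.Prime] [CharP F p] (n : ℕ)
    (hB : Module.Finite F (singularHomologyOver.{u, v} F n B)) (m : ℕ) :
    ∀ (E : Type u) [TopologicalSpace E] (G : Type w) [Group G] [MulAction G E] (q : E → B),
      IsQuotientCoveringMap q G → Nat.card G = p ^ m →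
      Module.Finite F (singularHomologyOver.{u, v} F n E) ∧
        bettiNumber.{u, v} F n E ≤ p ^ m * bettiNumber.{u, v} F n B := by
  induction m with
  | zero =>
    intro E _ G _ _ q hq hG
    obtain ⟨e⟩ := hq.nonempty_homeomorph (by simpa using hG)
    have e' := (nonempty_homology_equiv_of_homotopyEquiv (F := F) e.toHomotopyEquiv n).some
    exact ⟨Module.Finite.equiv e'.symm, by simp [bettiNumber, e'.finrank_eq]⟩
  | succ m ih =>
    intro E _ G _ _ q hq hG
    have hp : p.Prime := Fact.out
    have : Finite G := Nat.finite_of_card_ne_zero (by rw [hG]; exact pow_ne_zero _ hp.ne_zero)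
    have hpG : IsPGroup p G := IsPGroup.of_card hG
    have : Nontrivial G := Finite.one_lt_card_iff_nontrivial.1 (by
      rw [hG]; exact Nat.one_lt_pow (by omega) hp.one_lt)
    -- A nontrivial `p`-group has a central, hence normal, subgroup `N` of order `p`; the covering
    -- factors as `E → E/N → B`, and the induction hypothesis handles the second map.
    have hc : p ∣ Nat.card (Subgroup.center G) := by
      have := hpG.center_nontrivial
      obtain ⟨k, hk0, hk⟩ := (hpG.to_subgroup (Subgroup.center G)).nontrivial_iff_card.1 this
      rw [hk]
      exact dvd_pow_self p hk0.ne'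
    obtain ⟨z, hz⟩ := exists_prime_orderOf_dvd_card' p hc
    let N := Subgroup.zpowers (z : G)
    have hN : N.Normal := by
      refine ⟨fun a ha g => ?_⟩
      have h1 : a ∈ Subgroup.center G := (Subgroup.zpowers_le.2 z.2) ha
      rw [Subgroup.mem_center_iff.1 h1 g]
      simpa using ha
    have hNc : Nat.card N = p := by
      rw [Nat.card_zpowers, Subgroup.orderOf_coe, hz]
    have hQ : Nat.card (G ⧸ N) = p ^ m := by
      have := Subgroup.card_eq_card_quotient_mul_card_subgroup N
      rw [hG, hNc, pow_succ] at this
      exact (Nat.eq_of_mul_eq_mul_right hp.pos this).symm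
    obtain ⟨h1, h2⟩ := ih _ _ _ (hq.isQuotientCoveringMap_quotientLift N) hQ
    obtain ⟨h3, h4⟩ := bettiNumber_le_of_card_eq_prime (hq.quotient_mk N) p hNc n h1
    refine ⟨h3, h4.trans ?_⟩
    rw [pow_succ', mul_assoc]
    exact Nat.mul_le_mul_left _ h2

end PGroupCovering
end

/-! ### Homology of punctured Euclidean spaces -/

section

section PuncturedSpaces

variable {F : Type v} [Field F]

/-- Punctured products with a line: `(V × ℝ) ∖ 0` is the suspension of `V ∖ 0`. -/
lemma spaceEuler_punctured_prod {V : Type*} [NormedAddCommGroup V] [NormedSpace ℝ V] {N : ℕ} {c : ℤ}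
    (h : ∀ (X : Type u) [TopologicalSpace X], ContinuousMap.HomotopyEquiv X {v : V // v ≠ 0} →
      SpaceEuler F X N c)
    (W : Type u) [TopologicalSpace W] (φ : W ≃ₜ {v : V × ℝ // v ≠ 0}) :
    SpaceEuler F W (N + 1) (2 - c) := by
  have hφ : Continuous φ := φ.continuous
  have hφ' : Continuous φ.symm := φ.symm.continuous
  -- For `s = ±1` this is the complement of a closed half-line on the vertical axis, which is
  -- star-shaped about `(0, s)`.
  let U : ℝ → Set W := fun s => {w | 0 < s * (φ w).1.2 ∨ (φ w).1.1 ≠ 0}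
  have hU : ∀ s, IsOpen (U s) := fun s =>
    (isOpen_lt (f := fun _ : W => (0 : ℝ)) (g := fun w : W => s * (φ w).1.2) continuous_const
      (by fun_prop)).union
      (isOpen_ne_fun (f := fun w : W => (φ w).1.1) (g := fun _ => 0) (by fun_prop) continuous_const)
  have hUe : ∀ s : ℝ, s ≠ 0 → SpaceEuler F (U s) (N + 1) 1 := fun s hs => by
    let S : Set (V × ℝ) := {w | 0 < s * w.2 ∨ w.1 ≠ 0}
    have hss : 0 < s * s := mul_self_pos.2 hs
    have hstar : StarConvex ℝ ((0 : V), s) S := by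
      intro w hw a b ha hb hab
      rcases hw with hw | hw
      · left
        show 0 < s * (a * s + b * w.2)
        have : s * (a * s + b * w.2) = a * (s * s) + b * (s * w.2) := by ring
        rw [this]
        rcases ha.eq_or_lt with rfl | ha
        · obtain rfl : b = 1 := by linarith
          simpa using hw
        · have := mul_pos ha hss
          have := mul_nonneg hb hw.le
          linarith
      · rcases hb.eq_or_lt with rfl | hb
        · left
          obtain rfl : a = 1 := by linarith
          simpa using hss
        · right
          show a • (0 : V) + b • w.1 ≠ 0
          rw [smul_zero, zero_add]
          exact smul_ne_zero hb.ne' hw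
    have h0 : ∀ w ∈ S, w ≠ 0 := by
      rintro _ hw rfl
      rcases hw with hw | hw
      · simp at hw
      · exact hw rfl
    have hS : ContractibleSpace S := hstar.contractibleSpace ⟨((0 : V), s), Or.inl hss⟩
    let e' : U s ≃ₜ S :=
      { toFun := fun w => ⟨(φ w.1).1, w.2⟩
        invFun := fun w => ⟨φ.symm ⟨w.1, h0 _ w.2⟩, by
          show _ ∨ _
          rw [φ.apply_symm_apply]
          exact w.2⟩
        left_inv := fun _ => by simp
        right_inv := fun _ => by simp
        continuous_toFun := by fun_prop
        continuous_invFun := by fun_prop }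
    have : ContractibleSpace (U s) := e'.contractibleSpace
    exact HasEulerChar.mono spaceEuler_of_contractible (by omega)
  have hcov : U 1 ∪ U (-1) = Set.univ := by
    refine Set.eq_univ_of_forall fun w => ?_
    by_cases h1 : (φ w).1.1 = 0
    · have h2 : (φ w).1.2 ≠ 0 := fun h2 => (φ w).2 (Prod.ext h1 h2)
      rcases h2.lt_or_gt with h3 | h3
      · exact Or.inr (Or.inl (by simpa using h3))
      · exact Or.inl (Or.inl (by simpa using h3))
    · exact Or.inl (Or.inr h1)
  have hint : ∀ w ∈ U 1 ∩ U (-1), (φ w).1.1 ≠ 0 := by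
    rintro w ⟨h1 | h1, h2 | h2⟩
    · linarith
    · exact h2
    · exact h1
    · exact h1
  have hint' : ∀ v : {v : V × ℝ // v ≠ 0}, v.1.1 ≠ 0 → φ.symm v ∈ U 1 ∩ U (-1) := by
    intro v hv
    constructor <;> right <;> simpa using hv
  let toF : C(↥(U 1 ∩ U (-1)), {v : V // v ≠ 0}) :=
    ⟨fun w => ⟨(φ w.1).1.1, hint _ w.2⟩, by fun_prop⟩
  let invF : C({v : V // v ≠ 0}, ↥(U 1 ∩ U (-1))) :=
    ⟨fun v => ⟨φ.symm ⟨(v.1, 0), fun h => v.2 (congrArg Prod.fst h)⟩, hint' _ v.2⟩, by fun_prop⟩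
  -- The overlap consists of the points off the axis; scaling the line coordinate to `0` deforms it
  -- onto `V ∖ 0`.
  have ei : ContinuousMap.HomotopyEquiv ↥(U 1 ∩ U (-1)) {v : V // v ≠ 0} :=
    { toFun := toF
      invFun := invF
      left_inv := ⟨
        { toFun := fun x => ⟨φ.symm ⟨((φ x.2.1).1.1, (x.1 : ℝ) * (φ x.2.1).1.2), fun h =>
              hint _ x.2.2 (congrArg Prod.fst h)⟩, hint' _ (hint _ x.2.2)⟩
          continuous_toFun := by fun_prop
          map_zero_left := fun x => by
            apply Subtype.ext
            simp [toF, invF]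
          map_one_left := fun x => by
            apply Subtype.ext
            simp }⟩
      right_inv := by
        have : toF.comp invF = ContinuousMap.id _ := by ext; simp [toF, invF]
        rw [this] }
  have := SpaceEuler.union (hU 1) (hU (-1)) hcov (h _ ei) (hUe 1 one_ne_zero)
    (hUe (-1) (by norm_num))
  convert this using 1
  ring

/-- The homology of `ℝ^k ∖ 0`. -/
lemma spaceEuler_punctured (k : ℕ) : ∀ (X : Type u) [TopologicalSpace X],
    ContinuousMap.HomotopyEquiv X {x : Fin k → ℝ // x ≠ 0} →
      SpaceEuler F X k (1 - (-1) ^ k) := by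
  induction k with
  | zero =>
    intro X _ e
    have : IsEmpty X := ⟨fun x => (e.toFun x).2 (Subsingleton.elim _ _)⟩
    simpa using spaceEuler_of_isEmpty (F := F) (X := X) 0
  | succ k ih =>
    intro X _ e
    let l : (Fin (k + 1) → ℝ) ≃L[ℝ] (Fin k → ℝ) × ℝ := ContinuousLinearEquiv.ofFinrankEq (by simp)
    let l' : {x : Fin (k + 1) → ℝ // x ≠ 0} ≃ₜ {v : (Fin k → ℝ) × ℝ // v ≠ 0} :=
      l.toHomeomorph.subtype (fun x => (l.map_eq_zero_iff (x := x)).not.symm)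
    -- Euclidean space lives in `Type`, so it is lifted to `Type u`. For the same reason the
    -- induction ranges over all spaces homotopy equivalent to the model.
    have := spaceEuler_punctured_prod ih _ (Homeomorph.ulift.trans l')
    have e' : ContinuousMap.HomotopyEquiv (ULift.{u} {x : Fin (k + 1) → ℝ // x ≠ 0}) X :=
      Homeomorph.ulift.toHomotopyEquiv.trans e.symm
    convert SpaceEuler.of_homotopyEquiv e' this using 1
    ring

end PuncturedSpaces

section Disks

/-- The closed unit ball. -/
abbrev Disk (k : ℕ) := Metric.closedBall (0 : Fin k → ℝ) 1

instance (k : ℕ) : ContractibleSpace (Disk k) :=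
  (convex_closedBall _ _).contractibleSpace ⟨0, by simp⟩

instance (k : ℕ) : LocallyPathConnectedSpace (Disk k) :=
  (convex_closedBall _ _).locallyPathConnectedSpace

instance (k : ℕ) : CompactSpace (Disk k) := isCompact_iff_compactSpace.1 (isCompact_closedBall _ _)

/-- The punctured open ball is homeomorphic to punctured space. -/
noncomputable def puncturedBallHomeomorph (k : ℕ) :
    {x : Disk k // ‖x.1‖ < 1 ∧ x.1 ≠ 0} ≃ₜ {x : Fin k → ℝ // x ≠ 0} :=
  let b := Homeomorph.unitBall (E := Fin k → ℝ)
  have hb : ∀ x, (b x).1 = 0 ↔ x = 0 := fun x => by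
    rw [← b.injective.eq_iff (a := x) (b := 0), ← Subtype.coe_inj]
    exact Eq.congr_right Homeomorph.coe_unitBall_apply_zero.symm
  { toFun := fun x => ⟨b.symm ⟨x.1.1, by simpa using x.2.1⟩, fun h => x.2.2 (by
      have := (hb _).2 h
      rwa [b.apply_symm_apply] at this)⟩
    invFun := fun x => ⟨⟨(b x.1).1, Metric.ball_subset_closedBall (b x.1).2⟩,
      mem_ball_zero_iff.1 (b x.1).2, fun h => x.2 ((hb _).1 h)⟩
    left_inv := fun x => by simp
    right_inv := fun x => by simp
    continuous_toFun := by
      refine Continuous.subtype_mk (b.symm.continuous.comp ?_) _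
      fun_prop
    continuous_invFun := by
      refine Continuous.subtype_mk (Continuous.subtype_mk ?_ _) _
      exact continuous_subtype_val.comp (b.continuous.comp continuous_subtype_val) }

end Disks
end

/-! ### Attaching a single cell -/

section

open scoped unitInterval

/-- A map out of a space covered by the images of two closed maps is continuous if both
composites are. -/
lemma continuous_of_isClosedMap_cover {P Q Z W : Type*} [TopologicalSpace P] [TopologicalSpace Q]
    [TopologicalSpace Z] [TopologicalSpace W] {a : P → Z} {b : Q → Z} (ha : IsClosedMap a)
    (hb : IsClosedMap b) (hab : ∀ z, z ∈ Set.range a ∨ z ∈ Set.range b) {h : Z → W}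
    (h1 : Continuous (h ∘ a)) (h2 : Continuous (h ∘ b)) : Continuous h := by
  rw [continuous_iff_isClosed]
  intro C hC
  have : h ⁻¹' C = a '' ((h ∘ a) ⁻¹' C) ∪ b '' ((h ∘ b) ⁻¹' C) := by
    ext z
    constructor
    · intro hz
      rcases hab z with ⟨p, rfl⟩ | ⟨p, rfl⟩
      · exact Or.inl ⟨p, hz, rfl⟩
      · exact Or.inr ⟨p, hz, rfl⟩
    · rintro (⟨p, hp, rfl⟩ | ⟨p, hp, rfl⟩) <;> exact hp
  rw [this]
  exact (ha _ (hC.preimage h1)).union (hb _ (hC.preimage h2))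

lemma Disk.norm_le {k : ℕ} (x : Disk k) : ‖x.1‖ ≤ 1 := mem_closedBall_zero_iff.1 x.2

lemma Disk.lt_or_eq {k : ℕ} (x : Disk k) : ‖x.1‖ < 1 ∨ ‖x.1‖ = 1 := (Disk.norm_le x).lt_or_eq

/-- `Φ` exhibits `X` as obtained from the closed subspace `A` by attaching a `k`-cell. -/
structure IsCellAttachment {X : Type u} [TopologicalSpace X] (A : Set X) {k : ℕ}
    (Φ : C(Disk k, X)) : Prop where
  isClosed : IsClosed A
  mem_iff : ∀ x, Φ x ∈ A ↔ ‖x.1‖ = 1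
  injOn : ∀ x y, ‖x.1‖ < 1 → ‖y.1‖ < 1 → Φ x = Φ y → x = y
  cover : ∀ z, z ∉ A → ∃ x, Φ x = z

namespace IsCellAttachment

variable {F : Type v} [Field F] {X : Type u} [TopologicalSpace X] [T2Space X] {A : Set X} {k : ℕ}
  {Φ : C(Disk k, X)}

omit [T2Space X] in
lemma notMem (h : IsCellAttachment A Φ) {x : Disk k} (hx : ‖x.1‖ < 1) : Φ x ∉ A :=
  fun h' => hx.ne ((h.mem_iff x).1 h')

omit [T2Space X] in
lemma norm_lt (h : IsCellAttachment A Φ) {x : Disk k} (hx : Φ x ∉ A) : ‖x.1‖ < 1 :=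
  (Disk.lt_or_eq x).resolve_right fun h' => hx ((h.mem_iff x).2 h')

/-- The open cell is homeomorphic to the open ball. -/
lemma nonempty_homeomorph_compl (h : IsCellAttachment A Φ) (S : Set X) (hS : S ⊆ Aᶜ) :
    Nonempty ({x : Disk k // Φ x ∈ S} ≃ₜ S) := by
  have hp : IsProperMap Φ := Φ.continuous.isProperMap
  have hr : IsClosedMap (S.restrictPreimage Φ) := hp.isClosedMap.restrictPreimage S
  have hb : Function.Bijective (S.restrictPreimage Φ) := by
    refine ⟨fun x y hxy => ?_, fun z => ?_⟩
    · exact Subtype.ext (h.injOn _ _ (h.norm_lt (hS x.2)) (h.norm_lt (hS y.2))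
        (congrArg Subtype.val hxy))
    · obtain ⟨x, hx⟩ := h.cover z.1 (hS z.2)
      exact ⟨⟨x, show Φ x ∈ S by rw [hx]; exact z.2⟩, Subtype.ext hx⟩
  exact ⟨(Equiv.ofBijective _ hb).toHomeomorphOfContinuousClosed
    (Φ.continuous.restrictPreimage) hr⟩

lemma contractibleSpace_compl (h : IsCellAttachment A Φ) : ContractibleSpace ↥Aᶜ := by
  let e := (h.nonempty_homeomorph_compl Aᶜ subset_rfl).some
  let e' : {x : Disk k // Φ x ∈ Aᶜ} ≃ₜ Metric.ball (0 : Fin k → ℝ) 1 :=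
    { toFun := fun x => ⟨x.1.1, mem_ball_zero_iff.2 (h.norm_lt x.2)⟩
      invFun := fun x => ⟨⟨x.1, Metric.ball_subset_closedBall x.2⟩,
        h.notMem (mem_ball_zero_iff.1 x.2)⟩
      left_inv := fun _ => rfl
      right_inv := fun _ => rfl
      continuous_toFun := by fun_prop
      continuous_invFun := by fun_prop }
  have : ContractibleSpace (Metric.ball (0 : Fin k → ℝ) 1) :=
    (convex_ball _ _).contractibleSpace ⟨0, by simp⟩
  exact (e.symm.trans e').contractibleSpace

variable (Φ) in
/-- The complement of the centre of the cell. -/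
def punctured : Set X := {Φ ⟨0, by simp⟩}ᶜ

omit [T2Space X] in
lemma subset_punctured (h : IsCellAttachment A Φ) : A ⊆ punctured Φ := by
  rintro _ hx rfl
  exact h.notMem (by simp) hx

omit [T2Space X] in
lemma mem_punctured (h : IsCellAttachment A Φ) {x : Disk k} : Φ x ∈ punctured Φ ↔ x.1 ≠ 0 := by
  refine not_congr ⟨fun hx => ?_, fun hx => congrArg Φ (Subtype.ext hx)⟩
  have h1 : ‖x.1‖ < 1 := h.norm_lt (by rw [hx]; exact h.notMem (by simp))
  exact congrArg Subtype.val (h.injOn x _ h1 (by simp) hx)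

lemma spaceEuler_inter (h : IsCellAttachment A Φ) :
    SpaceEuler F ↥(punctured Φ ∩ Aᶜ) k (1 - (-1) ^ k) := by
  let e := (h.nonempty_homeomorph_compl (punctured Φ ∩ Aᶜ) Set.inter_subset_right).some
  let e' : {x : Disk k // Φ x ∈ punctured Φ ∩ Aᶜ} ≃ₜ {x : Disk k // ‖x.1‖ < 1 ∧ x.1 ≠ 0} :=
    (Homeomorph.refl _).subtype fun x => by
      show _ ∧ _ ↔ _
      rw [h.mem_punctured, and_comm]
      exact and_congr_left fun _ => ⟨h.norm_lt, h.notMem⟩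
  exact spaceEuler_punctured k _
    (e.symm.trans (e'.trans (puncturedBallHomeomorph k))).toHomotopyEquiv

/-- The radial deformation of the punctured disk to its boundary. -/
noncomputable def radial (k : ℕ) : C(I × {x : Disk k // x.1 ≠ 0}, {x : Disk k // x.1 ≠ 0}) :=
  have hpos : ∀ p : I × {x : Disk k // x.1 ≠ 0}, 0 < ‖p.2.1.1‖ := fun p => norm_pos_iff.2 p.2.2
  have hs : ∀ p : I × {x : Disk k // x.1 ≠ 0},
      0 < (1 - (p.1 : ℝ)) + (p.1 : ℝ) * ‖p.2.1.1‖⁻¹ := fun p => by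
    have h1 : 1 ≤ ‖p.2.1.1‖⁻¹ := (one_le_inv₀ (hpos p)).2 (Disk.norm_le p.2.1)
    nlinarith [p.1.2.1, p.1.2.2]
  { toFun := fun p => ⟨⟨((1 - (p.1 : ℝ)) + (p.1 : ℝ) * ‖p.2.1.1‖⁻¹) • p.2.1.1, by
        rw [mem_closedBall_zero_iff, norm_smul, Real.norm_of_nonneg (hs p).le, add_mul, mul_assoc,
          inv_mul_cancel₀ (hpos p).ne']
        have h1 := (Disk.norm_le p.2.1)
        have h2 := mul_le_mul_of_nonneg_left h1 (sub_nonneg.2 p.1.2.2)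
        linarith⟩, smul_ne_zero (hs p).ne' p.2.2⟩
    continuous_toFun := by
      refine Continuous.subtype_mk (Continuous.subtype_mk ?_ _) _
      have h1 : Continuous fun p : I × {x : Disk k // x.1 ≠ 0} => ‖p.2.1.1‖⁻¹ :=
        Continuous.inv₀ (by fun_prop) fun p => (hpos p).ne'
      fun_prop }

lemma radial_zero (x : {x : Disk k // x.1 ≠ 0}) : radial k (0, x) = x := by
  apply Subtype.ext; apply Subtype.ext
  simp [radial]

lemma radial_of_norm_eq (s : I) (x : {x : Disk k // x.1 ≠ 0}) (hx : ‖x.1.1‖ = 1) :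
    radial k (s, x) = x := by
  apply Subtype.ext; apply Subtype.ext
  simp [radial, hx]

lemma norm_radial_one (x : {x : Disk k // x.1 ≠ 0}) : ‖(radial k (1, x)).1.1‖ = 1 := by
  have : ‖x.1.1‖ ≠ 0 := norm_ne_zero_iff.2 x.2
  simp [radial, norm_smul, this]

/-- The deformation of the punctured complex onto the base of the attachment. -/
lemma exists_deformation (h : IsCellAttachment A Φ) :
    ∃ H : C(I × punctured Φ, punctured Φ), (∀ z, H (0, z) = z) ∧ (∀ z, (H (1, z)).1 ∈ A) ∧
      ∀ s z, z.1 ∈ A → H (s, z) = z := by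
  classical
  let b : {x : Disk k // x.1 ≠ 0} → punctured Φ := fun x => ⟨Φ x.1, h.mem_punctured.2 x.2⟩
  have hbc : Continuous b := by fun_prop
  have hb : IsProperMap b := by
    have hp : IsProperMap Φ := Φ.continuous.isProperMap
    have h1 : IsProperMap ((punctured Φ).restrictPreimage Φ) := hp.restrictPreimage _
    exact h1.comp ((Homeomorph.refl _).subtype fun x => h.mem_punctured.symm).isProperMap
  let a : A → punctured Φ := fun x => ⟨x.1, h.subset_punctured x.2⟩
  have ha : IsProperMap a :=
    isProperMap_of_comp_of_inj (by fun_prop) continuous_subtype_val h.isClosed.isProperMap_subtypeVal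
      Subtype.val_injective
  have hcov : ∀ z : punctured Φ, z.1 ∉ A → ∃ x, b x = z := fun z hz => by
    obtain ⟨x, hx⟩ := h.cover z.1 hz
    exact ⟨⟨x, h.mem_punctured.1 (by rw [hx]; exact z.2)⟩, Subtype.ext hx⟩
  -- The deformation is constant on `A` and radial on the cell; the two prescriptions agree on the
  -- boundary sphere, which `radial` fixes.
  let H : I × punctured Φ → punctured Φ := fun p =>
    if hp : p.2.1 ∈ A then p.2 else b (radial k (p.1, (hcov p.2 hp).choose))
  have Ha : ∀ s z, z.1 ∈ A → H (s, z) = z := fun s z hz => dif_pos hz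
  have Hb : ∀ s x, H (s, b x) = b (radial k (s, x)) := fun s x => by
    by_cases hx : (b x).1 ∈ A
    · rw [Ha _ _ hx, radial_of_norm_eq]
      exact (h.mem_iff _).1 hx
    · have h1 : H (s, b x) = b (radial k (s, (hcov (b x) hx).choose)) := dif_neg hx
      have h2 := (hcov (b x) hx).choose_spec
      have h3 : (hcov (b x) hx).choose = x := by
        apply Subtype.ext
        refine h.injOn _ _ (h.norm_lt ?_) (h.norm_lt hx) (congrArg Subtype.val h2)
        have := congrArg Subtype.val h2
        rw [show Φ _ = _ from this]
        exact hx
      rw [h1, h3]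
  -- Properness of `a` and `b`, unlike mere closedness, survives the product with the interval, so
  -- the two products form a closed cover.
  have Hc : Continuous H := by
    refine continuous_of_isClosedMap_cover (a := Prod.map id a) (b := Prod.map id b)
      (isProperMap_id.prodMap ha).isClosedMap (isProperMap_id.prodMap hb).isClosedMap ?_ ?_ ?_
    · rintro ⟨s, z⟩
      by_cases hz : z.1 ∈ A
      · exact Or.inl ⟨(s, ⟨z.1, hz⟩), rfl⟩
      · obtain ⟨x, rfl⟩ := hcov z hz
        exact Or.inr ⟨(s, x), rfl⟩
    · have : H ∘ Prod.map id a = fun p => a p.2 := by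
        ext1 p
        exact Ha _ _ p.2.2
      rw [this]
      exact ha.continuous.comp continuous_snd
    · have : H ∘ Prod.map id b = fun p => b (radial k p) := by
        ext1 p
        exact Hb _ _
      rw [this]
      exact hbc.comp (radial k).continuous
  refine ⟨⟨H, Hc⟩, fun z => ?_, fun z => ?_, Ha⟩
  · by_cases hz : z.1 ∈ A
    · exact Ha _ _ hz
    · obtain ⟨x, rfl⟩ := hcov z hz
      rw [ContinuousMap.coe_mk, Hb, radial_zero]
  · rw [ContinuousMap.coe_mk]
    by_cases hz : z.1 ∈ A
    · rw [Ha _ _ hz]; exact hz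
    · obtain ⟨x, rfl⟩ := hcov z hz
      rw [Hb]
      exact (h.mem_iff _).2 (norm_radial_one x)

lemma nonempty_homotopyEquiv_punctured (h : IsCellAttachment A Φ) :
    Nonempty (ContinuousMap.HomotopyEquiv A (punctured Φ)) := by
  obtain ⟨H, h0, h1, hA⟩ := h.exists_deformation
  let a : C(A, punctured Φ) := ⟨fun x => ⟨x.1, h.subset_punctured x.2⟩, by fun_prop⟩
  let r : C(punctured Φ, A) := ⟨fun z => ⟨(H (1, z)).1, h1 z⟩, by fun_prop⟩
  exact ⟨{
    toFun := a
    invFun := r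
    left_inv := by
      have : r.comp a = ContinuousMap.id _ := by
        ext x
        exact congrArg (fun y : punctured Φ => y.1) (hA 1 (a x) x.2)
      rw [this]
    right_inv := ContinuousMap.Homotopic.symm ⟨
      { toFun := H
        map_zero_left := h0
        map_one_left := fun z => rfl }⟩ }⟩

lemma isOpen_punctured : IsOpen (punctured Φ) := isClosed_singleton.isOpen_compl

omit [T2Space X] in
lemma union_eq (h : IsCellAttachment A Φ) : punctured Φ ∪ Aᶜ = Set.univ := by
  refine Set.eq_univ_of_forall fun z => ?_
  by_cases hz : z ∈ A
  · exact Or.inl (h.subset_punctured hz)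
  · exact Or.inr hz

/-- `X` is the union of the punctured space, which retracts to `A`, and the contractible open cell,
overlapping in a punctured ball: `c + 1 - (1 - (-1)^k)`. -/
lemma spaceEuler (h : IsCellAttachment A Φ) {N : ℕ} {c : ℤ} (hA : SpaceEuler F A N c)
    (hN : k + 1 ≤ N) : SpaceEuler F X N (c + (-1) ^ k) := by
  obtain ⟨M, rfl⟩ : ∃ M, N = M + 1 := ⟨N - 1, by omega⟩
  have := h.contractibleSpace_compl
  have h1 := SpaceEuler.union isOpen_punctured h.isClosed.isOpen_compl h.union_eq
    (HasEulerChar.mono (h.spaceEuler_inter (F := F)) (by omega : k ≤ M))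
    (SpaceEuler.of_homotopyEquiv h.nonempty_homotopyEquiv_punctured.some hA)
    (HasEulerChar.mono spaceEuler_of_contractible (by omega))
  convert h1 using 1
  ring

/-- A punctured `k`-ball has no homology in degrees `n ≥ k`, so attaching the cell cannot kill any
class of degree `n`. -/
lemma bettiNumber_le (h : IsCellAttachment A Φ) {N : ℕ} {c : ℤ} (hA : SpaceEuler F A N c)
    (hN : k + 1 ≤ N) {n : ℕ} (hn : k ≤ n) :
    bettiNumber.{u, v} F n A ≤ bettiNumber.{u, v} F n X := by
  have := h.contractibleSpace_compl
  have e := h.nonempty_homotopyEquiv_punctured.some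
  have h1 := bettiNumber_add_le (F := F) isOpen_punctured h.isClosed.isOpen_compl h.union_eq
    ((h.spaceEuler_inter (F := F)).subsingleton n hn) ((hA.of_homotopyEquiv e).finite n)
    ((spaceEuler_of_contractible (F := F)).finite n) ((h.spaceEuler hA hN).finite n)
  rw [bettiNumber_eq_of_homotopyEquiv e]
  omega

end IsCellAttachment
end

/-! ### Finite cell complexes and their coverings -/

section

/-- A decomposition of a space into open cells, with characteristic maps sending the boundary of
each disk into the union of the open cells of smaller dimension. -/
structure CellDecomposition (E : Type u) [TopologicalSpace E] (J : Type w) where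
  dim : J → ℕ
  map : ∀ j, C(Disk (dim j), E)
  injOn : ∀ j x y, ‖x.1‖ < 1 → ‖y.1‖ < 1 → map j x = map j y → x = y
  eq_of_map_eq : ∀ i j x y, ‖x.1‖ < 1 → ‖y.1‖ < 1 → map i x = map j y → i = j
  cover : ∀ z, ∃ j x, ‖x.1‖ < 1 ∧ map j x = z
  frontier : ∀ j x, ‖x.1‖ = 1 → ∃ i y, dim i < dim j ∧ ‖y.1‖ < 1 ∧ map i y = map j x

/-- A subset contained in another one, as a subspace of the latter. -/
def homeomorphSubsetOfSubset {E : Type*} [TopologicalSpace E] {S T : Set E} (h : S ⊆ T) :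
    {z : T | z.1 ∈ S} ≃ₜ S where
  toFun z := ⟨z.1.1, z.2⟩
  invFun z := ⟨⟨z.1, h z.2⟩, z.2⟩
  left_inv _ := rfl
  right_inv _ := rfl
  continuous_toFun := by fun_prop
  continuous_invFun := by fun_prop

namespace CellDecomposition

variable {F : Type v} [Field F] {E : Type u} [TopologicalSpace E] {J : Type w}
  (D : CellDecomposition E J)

/-- The open cells. -/
def openCell (j : J) : Set E := {z | ∃ x, ‖x.1‖ < 1 ∧ D.map j x = z}

/-- The union of a set of open cells. -/
def carrier (s : Finset J) : Set E := {z | ∃ j ∈ s, z ∈ D.openCell j}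

/-- A finite set of cells is a subcomplex if it contains the boundaries of its cells. -/
def IsSub (s : Finset J) : Prop := ∀ j ∈ s, ∀ x, D.map j x ∈ D.carrier s

lemma map_mem_openCell_iff {i j : J} {x} (hx : ‖x.1‖ < 1) :
    D.map j x ∈ D.openCell i ↔ j = i := by
  constructor
  · rintro ⟨y, hy, h⟩
    exact (D.eq_of_map_eq _ _ _ _ hy hx h).symm
  · rintro rfl
    exact ⟨x, hx, rfl⟩

lemma map_mem_carrier_iff {s : Finset J} {j : J} {x} (hx : ‖x.1‖ < 1) :
    D.map j x ∈ D.carrier s ↔ j ∈ s := by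
  constructor
  · rintro ⟨i, hi, h⟩
    rwa [(D.map_mem_openCell_iff hx).1 h]
  · exact fun h => ⟨j, h, x, hx, rfl⟩

/-- A finite subcomplex is the union of the compact images of its closed disks. -/
lemma isClosed_carrier [T2Space E] {s : Finset J} (hs : D.IsSub s) : IsClosed (D.carrier s) := by
  have : D.carrier s = ⋃ j ∈ s, Set.range (D.map j) := by
    ext z
    simp only [Set.mem_iUnion, Set.mem_range]
    constructor
    · rintro ⟨j, hj, x, -, rfl⟩
      exact ⟨j, hj, x, rfl⟩
    · rintro ⟨j, hj, x, rfl⟩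
      exact hs j hj x
  rw [this]
  exact s.finite_toSet.isClosed_biUnion fun j _ => (isCompact_range (D.map j).continuous).isClosed

include D in
lemma compactSpace [Finite J] : CompactSpace E := by
  refine ⟨?_⟩
  have : (Set.univ : Set E) = ⋃ j, Set.range (D.map j) := by
    refine (Set.eq_univ_of_forall fun z => ?_).symm
    obtain ⟨j, x, -, rfl⟩ := D.cover z
    exact Set.mem_iUnion.2 ⟨j, x, rfl⟩
  rw [this]
  exact isCompact_iUnion fun j => isCompact_range (D.map j).continuous

lemma carrier_mono {s t : Finset J} (h : s ⊆ t) : D.carrier s ⊆ D.carrier t :=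
  fun _ ⟨j, hj, hz⟩ => ⟨j, h hj, hz⟩

variable [DecidableEq J]

/-- Removing a cell of maximal dimension outside of a smaller subcomplex leaves a subcomplex. -/
lemma IsSub.erase {D : CellDecomposition E J} {s t : Finset J} (hs : D.IsSub s) (ht : D.IsSub t)
    {j : J} (hj : j ∈ t \ s) (hmax : ∀ i ∈ t \ s, D.dim i ≤ D.dim j) (hst : s ⊆ t) :
    D.IsSub (t.erase j) := by
  intro i hi x
  obtain ⟨hij, hit⟩ := Finset.mem_erase.1 hi
  by_cases his : i ∈ s
  · refine D.carrier_mono (fun k hk => ?_) (hs i his x)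
    refine Finset.mem_erase.2 ⟨?_, hst hk⟩
    rintro rfl
    exact (Finset.mem_sdiff.1 hj).2 hk
  · rcases Disk.lt_or_eq x with hx | hx
    · exact (D.map_mem_carrier_iff hx).2 hi
    · obtain ⟨k, y, hk, hy, hky⟩ := D.frontier i x hx
      have h1 := ht i hit x
      rw [← hky, D.map_mem_carrier_iff hy] at h1 ⊢
      refine Finset.mem_erase.2 ⟨?_, h1⟩
      rintro rfl
      exact (hmax i (Finset.mem_sdiff.2 ⟨hit, his⟩)).not_gt hk

lemma isCellAttachment [T2Space E] {t : Finset J} (ht : D.IsSub t) {j : J} (hj : j ∈ t)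
    (ht' : D.IsSub (t.erase j)) :
    IsCellAttachment (X := D.carrier t) {z : D.carrier t | z.1 ∈ D.carrier (t.erase j)}
      ⟨fun x => ⟨D.map j x, ht j hj x⟩, by fun_prop⟩ where
  isClosed := (D.isClosed_carrier ht').preimage continuous_subtype_val
  mem_iff x := by
    constructor
    · intro h
      refine (Disk.lt_or_eq x).resolve_left fun hx => ?_
      have := (D.map_mem_carrier_iff hx).1 h
      simp at this
    · intro hx
      obtain ⟨k, y, hk, hy, hky⟩ := D.frontier j x hx
      have h1 := ht j hj x
      show D.map j x ∈ D.carrier (t.erase j)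
      rw [← hky, D.map_mem_carrier_iff hy] at h1 ⊢
      refine Finset.mem_erase.2 ⟨?_, h1⟩
      rintro rfl
      exact lt_irrefl _ hk
  injOn x y hx hy h := D.injOn j x y hx hy (congrArg Subtype.val h)
  cover := by
    rintro ⟨z, i, hi, x, hx, rfl⟩ hz
    have : i = j := by
      by_contra hij
      exact hz ((D.map_mem_carrier_iff hx).2 (Finset.mem_erase.2 ⟨hij, hi⟩))
    subst this
    exact ⟨x, rfl⟩

/-- A cell of maximal dimension in `t \ s` is peeled off at each step. Both conclusions go through
the induction together, since comparing Betti numbers needs the finiteness contained in the first.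
-/
lemma spaceEuler_carrier [T2Space E] {N : ℕ} (hN : ∀ j, D.dim j + 1 ≤ N) {s : Finset J}
    (hs : D.IsSub s) {c : ℤ} (hc : SpaceEuler F (D.carrier s) N c) (t : Finset J) (hst : s ⊆ t)
    (ht : D.IsSub t) : SpaceEuler F (D.carrier t) N (c + ∑ j ∈ t \ s, (-1) ^ D.dim j) ∧
      ∀ n, (∀ j, D.dim j ≤ n) →
        bettiNumber.{u, v} F n (D.carrier s) ≤ bettiNumber.{u, v} F n (D.carrier t) := by
  obtain ⟨m, hm⟩ : ∃ m, (t \ s).card = m := ⟨_, rfl⟩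
  induction m generalizing t with
  | zero =>
    have h1 : t \ s = ∅ := Finset.card_eq_zero.1 hm
    obtain rfl : s = t := hst.antisymm (Finset.sdiff_eq_empty_iff_subset.1 h1)
    simpa using hc
  | succ m ih =>
    obtain ⟨j, hj, hmax⟩ := (t \ s).exists_max_image D.dim (Finset.card_pos.1 (by omega))
    have ht' := hs.erase ht hj hmax hst
    obtain ⟨hjt, hjs⟩ := Finset.mem_sdiff.1 hj
    have hst' : s ⊆ t.erase j := fun k hk => Finset.mem_erase.2 ⟨by rintro rfl; exact hjs hk, hst hk⟩
    have hsd : t.erase j \ s = (t \ s).erase j := Finset.erase_sdiff_comm _ _ _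
    obtain ⟨h1, h2⟩ := ih (t.erase j) hst' ht' (by
      rw [hsd, Finset.card_erase_of_mem hj, hm, Nat.add_sub_cancel])
    have ha := D.isCellAttachment ht hjt ht'
    have e := homeomorphSubsetOfSubset (D.carrier_mono (t.erase_subset j))
    have h3 := SpaceEuler.of_homotopyEquiv e.symm.toHomotopyEquiv h1
    refine ⟨?_, fun n hn => (h2 n hn).trans ?_⟩
    · convert ha.spaceEuler h3 (hN j) using 1
      rw [hsd, add_assoc, Finset.sum_erase_add _ _ hj]
    · rw [← bettiNumber_eq_of_homotopyEquiv e.toHomotopyEquiv]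
      exact ha.bettiNumber_le h3 (hN j) (hn j)

omit [DecidableEq J] in
lemma carrier_univ [Fintype J] : D.carrier Finset.univ = Set.univ :=
  Set.eq_univ_of_forall fun z =>
    let ⟨j, x, hx, h⟩ := D.cover z
    ⟨j, Finset.mem_univ j, x, hx, h⟩

omit [DecidableEq J] in
lemma isSub_univ [Fintype J] : D.IsSub Finset.univ := fun _ _ _ => by
  rw [carrier_univ]; exact Set.mem_univ _

omit [DecidableEq J] in
lemma spaceEuler_sub [T2Space E] {N : ℕ} (hN : ∀ j, D.dim j + 1 ≤ N) {s : Finset J}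
    (hs : D.IsSub s) : SpaceEuler F (D.carrier s) N (∑ j ∈ s, (-1) ^ D.dim j) := by
  classical
  have : IsEmpty (D.carrier ∅) := ⟨fun ⟨_, _, h, _⟩ => by simp at h⟩
  simpa using (D.spaceEuler_carrier hN (s := ∅) (fun j hj => by simp at hj)
    (spaceEuler_of_isEmpty (F := F) N) s (Finset.empty_subset _) hs).1

omit [DecidableEq J] in
/-- The homology and the Euler characteristic of a finite cell complex. -/
lemma spaceEuler [T2Space E] [Fintype J] {N : ℕ} (hN : ∀ j, D.dim j + 1 ≤ N) :
    SpaceEuler F E N (∑ j, (-1) ^ D.dim j) := by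
  have e : D.carrier Finset.univ ≃ₜ E :=
    (Homeomorph.setCongr D.carrier_univ).trans (Homeomorph.Set.univ E)
  exact SpaceEuler.of_homotopyEquiv e.toHomotopyEquiv (D.spaceEuler_sub hN D.isSub_univ)

omit [DecidableEq J] in
lemma bettiNumber_carrier_le [T2Space E] [Fintype J] {n : ℕ} (hn : ∀ j, D.dim j ≤ n)
    {s : Finset J} (hs : D.IsSub s) :
    bettiNumber.{u, v} F n (D.carrier s) ≤ bettiNumber.{u, v} F n E := by
  classical
  have e : D.carrier Finset.univ ≃ₜ E :=
    (Homeomorph.setCongr D.carrier_univ).trans (Homeomorph.Set.univ E)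
  rw [← bettiNumber_eq_of_homotopyEquiv e.toHomotopyEquiv]
  have hN : ∀ j, D.dim j + 1 ≤ n + 1 := fun j => Nat.succ_le_succ (hn j)
  exact (D.spaceEuler_carrier hN hs (D.spaceEuler_sub hN hs) _ (Finset.subset_univ _)
    D.isSub_univ).2 n hn

omit [DecidableEq J] in
/-- In the top dimension, the Betti number of a closed union of open cells is at most that of the
whole complex. -/
lemma bettiNumber_le_of_isClosed [T2Space E] [Finite J] {n : ℕ} (hn : ∀ j, D.dim j ≤ n)
    {A : Set E} (hA : IsClosed A)
    (h : ∀ j x y, ‖x.1‖ < 1 → ‖y.1‖ < 1 → D.map j x ∈ A → D.map j y ∈ A) :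
    bettiNumber.{u, v} F n A ≤ bettiNumber.{u, v} F n E := by
  classical
  have := Fintype.ofFinite J
  let s : Finset J := {j | D.map j ⟨0, by simp⟩ ∈ A}
  have hs : ∀ {j}, j ∈ s ↔ D.map j ⟨0, by simp⟩ ∈ A := by simp [s]
  have hsA : D.carrier s = A := by
    ext z
    obtain ⟨j, x, hx, rfl⟩ := D.cover z
    rw [D.map_mem_carrier_iff hx, hs]
    exact ⟨h j _ _ (by simp) hx, h j _ _ hx (by simp)⟩
  -- A closed set containing an open cell contains the image of the whole closed disk, the closure
  -- of the open ball.
  have hsub : D.IsSub s := by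
    intro j hj x
    rw [hsA]
    rw [hs] at hj
    have h1 : IsClosed (Subtype.val '' (D.map j ⁻¹' A)) :=
      Metric.isClosed_closedBall.isClosedEmbedding_subtypeVal.isClosedMap _
        (hA.preimage (D.map j).continuous)
    have h2 : Metric.ball (0 : Fin (D.dim j) → ℝ) 1 ⊆ Subtype.val '' (D.map j ⁻¹' A) :=
      fun y hy => ⟨⟨y, Metric.ball_subset_closedBall hy⟩,
        h j _ _ (by simp) (mem_ball_zero_iff.1 hy) hj, rfl⟩
    have h3 := closure_minimal h2 h1
    rw [closure_ball _ one_ne_zero] at h3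
    obtain ⟨y, hy, hyx⟩ := h3 x.2
    rwa [← Subtype.ext hyx]
  rw [← hsA]
  exact D.bettiNumber_carrier_le hn hsub

omit [DecidableEq J] in
include D in
/-- The path components of a finite cell complex are closed and open. -/
lemma isClopen_pathComponent [T2Space E] [Finite J] (z : E) : IsClopen (pathComponent z) := by
  -- A property invariant under paths holds on a whole closed cell or nowhere on it, so it cuts out
  -- a finite union of compact sets. This applies to a path component and to its complement.
  have key : ∀ P : E → Prop, (∀ x y, Joined x y → P x → P y) → IsClosed {x | P x} := by
    intro P hP
    have : {x | P x} = ⋃ j ∈ {j : J | ∃ y, P (D.map j y)}, Set.range (D.map j) := by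
      ext x
      simp only [Set.mem_ofPred_eq, Set.mem_iUnion, Set.mem_range, exists_prop]
      constructor
      · intro hx
        obtain ⟨j, y, -, rfl⟩ := D.cover x
        exact ⟨j, ⟨y, hx⟩, y, rfl⟩
      · rintro ⟨j, ⟨y, hy⟩, y', rfl⟩
        exact hP _ _ ((PathConnectedSpace.joined y y').map (D.map j).continuous) hy
    rw [this]
    exact (Set.toFinite _).isClosed_biUnion fun j _ =>
      (isCompact_range (D.map j).continuous).isClosed
  refine ⟨key (Joined z) fun x y hxy hx => hx.trans hxy, ?_⟩
  rw [← isClosed_compl_iff]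
  exact key (fun x => ¬ Joined z x) fun x y hxy hx hy => hx (hy.trans hxy.symm)

omit [DecidableEq J] in
include D in
lemma pathConnectedSpace [T2Space E] [Finite J] [ConnectedSpace E] : PathConnectedSpace E := by
  have z : E := Classical.arbitrary E
  have := (D.isClopen_pathComponent z).eq_univ ⟨z, mem_pathComponent_self z⟩
  exact pathConnectedSpace_iff_eq.2 ⟨z, this⟩

section Lift

variable {G : Type*} [Group G] {Z : Type u} [TopologicalSpace Z] [MulAction G Z] {q : Z → E}

omit [DecidableEq J] in
lemma exists_lift (hq : IsQuotientCoveringMap q G) (j : J) :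
    ∃ τ : C(Disk (D.dim j), Z), ∀ x, q (τ x) = D.map j x :=
  hq.exists_lift (D.map j)

/-- The cell decomposition of the total space of a regular covering. -/
noncomputable def lift (hq : IsQuotientCoveringMap q G) : CellDecomposition Z (J × G) :=
  have := hq.toContinuousConstSMul
  -- The cell `(j, g)` is the `g`-translate of a chosen lift of cell `j`; freeness of the action
  -- makes these cells disjoint, and transitivity on fibres makes them cover.
  have hl := fun j => (D.exists_lift hq j).choose_spec
  have hm : ∀ (p : J × G) x, q (p.2 • (D.exists_lift hq p.1).choose x) = D.map p.1 x :=
    fun p x => (hq.map_smul _).trans (hl _ _)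
  { dim := fun p => D.dim p.1
    map := fun p => ⟨fun x => p.2 • (D.exists_lift hq p.1).choose x, by fun_prop⟩
    injOn := fun p x y hx hy h => D.injOn p.1 x y hx hy (by
      rw [← hm p x, ← hm p y]
      exact congrArg q h)
    eq_of_map_eq := by
      rintro ⟨i, g⟩ ⟨j, g'⟩ x y hx hy h
      have h1 := congrArg q h
      have h2 : D.map i x = D.map j y := by
        rw [← hm (i, g) x, ← hm (j, g') y]
        exact h1
      obtain rfl := D.eq_of_map_eq i j x y hx hy h2
      obtain rfl := D.injOn i x y hx hy h2
      have := hq.isCancelSMul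
      exact Prod.ext rfl (IsCancelSMul.right_cancel _ _ _ h)
    cover := fun z => by
      obtain ⟨j, x, hx, h⟩ := D.cover (q z)
      rw [← hl j x] at h
      obtain ⟨g, hg⟩ := hq.apply_eq_iff_mem_orbit.1 h.symm
      exact ⟨(j, g), x, hx, hg⟩
    frontier := by
      rintro ⟨j, g⟩ x hx
      obtain ⟨i, y, hi, hy, h⟩ := D.frontier j x hx
      rw [← hl i y, ← hm (j, g) x] at h
      obtain ⟨g', hg'⟩ := hq.apply_eq_iff_mem_orbit.1 h.symm
      exact ⟨(i, g'), y, hi, hy, hg'⟩ }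

omit [DecidableEq J] in
lemma map_lift (hq : IsQuotientCoveringMap q G) (p : J × G) (x : Disk (D.dim p.1)) :
    q ((D.lift hq).map p x) = D.map p.1 x :=
  (hq.map_smul _).trans ((D.exists_lift hq p.1).choose_spec x)

end Lift

end CellDecomposition

/-- The total space of a covering of a Hausdorff space is Hausdorff. -/
lemma IsCoveringMap.t2Space {Z E : Type*} [TopologicalSpace Z] [TopologicalSpace E] [T2Space E]
    {q : Z → E} (hq : IsCoveringMap q) : T2Space Z := by
  refine ⟨fun x y hxy => ?_⟩
  by_cases h : q x = q y
  · exact hq.isSeparatedMap x y h hxy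
  · obtain ⟨U, V, hU, hV, hx, hy, hUV⟩ := t2_separation h
    exact ⟨q ⁻¹' U, q ⁻¹' V, hU.preimage hq.continuous, hV.preimage hq.continuous, hx, hy,
      hUV.preimage q⟩

namespace CWSpace

open Topology

/-- The cell decomposition underlying a CW-structure. -/
noncomputable def cellDecomposition (X : CWSpace.{u}) :
    CellDecomposition X (Σ n, X.Cell n) where
  dim e := e.1
  map e := ⟨fun x => RelCWComplex.map (C := (Set.univ : Set X)) e.1 e.2 x.1,
    (RelCWComplex.continuousOn (C := (Set.univ : Set X)) e.1 e.2).domRestrict⟩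
  injOn e x y hx hy h := by
    have hinj := (RelCWComplex.map (C := (Set.univ : Set X)) e.1 e.2).injOn
    rw [RelCWComplex.source_eq (C := (Set.univ : Set X)) e.1 e.2] at hinj
    exact Subtype.ext (hinj (mem_ball_zero_iff.2 hx) (mem_ball_zero_iff.2 hy) h)
  eq_of_map_eq e e' x y hx hy h := by
    by_contra hne
    have := RelCWComplex.disjoint_openCell_of_ne (C := (Set.univ : Set X)) hne
    exact Set.disjoint_left.1 this ⟨x.1, mem_ball_zero_iff.2 hx, rfl⟩
      ⟨y.1, mem_ball_zero_iff.2 hy, h.symm⟩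
  cover z := by
    have := CWComplex.iUnion_openCell_eq_complex (C := (Set.univ : Set X))
    have hz : z ∈ ⋃ (n : ℕ) (j : RelCWComplex.cell (Set.univ : Set X) n),
      RelCWComplex.openCell n j := by rw [this]; trivial
    simp only [Set.mem_iUnion] at hz
    obtain ⟨n, j, x, hx, rfl⟩ := hz
    exact ⟨⟨n, j⟩, ⟨x, Metric.ball_subset_closedBall hx⟩, mem_ball_zero_iff.1 hx, rfl⟩
  frontier e x hx := by
    obtain ⟨I, hI⟩ := CWComplex.cellFrontier_subset_finite_openCell (C := (Set.univ : Set X)) e.1 e.2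
    have := hI ⟨x.1, mem_sphere_zero_iff_norm.2 hx, rfl⟩
    simp only [Set.mem_iUnion] at this
    obtain ⟨m, hm, j, -, y, hy, h⟩ := this
    exact ⟨⟨m, j⟩, ⟨y, Metric.ball_subset_closedBall hy⟩, hm, mem_ball_zero_iff.1 hy, h⟩

lemma cellDecomposition_openCell (X : CWSpace.{u}) (e : Σ n, X.Cell n) :
    X.cellDecomposition.openCell e = X.openCell e.2 := by
  ext z
  constructor
  · rintro ⟨x, hx, rfl⟩
    exact ⟨x.1, mem_ball_zero_iff.2 hx, rfl⟩
  · rintro ⟨x, hx, rfl⟩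
    exact ⟨⟨x, Metric.ball_subset_closedBall hx⟩, mem_ball_zero_iff.1 hx, rfl⟩

lemma IsFinite.finite {X : CWSpace.{u}} (h : X.IsFinite) : Finite (Σ n, X.Cell n) :=
  have : RelCWComplex.Finite (Set.univ : Set X) := h
  RelCWComplex.finite_cells_of_finite (C := (Set.univ : Set X))

end CWSpace
end

/-! ### Pullbacks, residual finiteness and components of coverings -/

section

section Pullback

variable {G : Type*} [Group G] {E B X : Type*} [TopologicalSpace E] [TopologicalSpace B]
  [TopologicalSpace X] [MulAction G E] {q : E → B}

/-- The pullback of a regular covering is a regular covering. -/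
lemma IsQuotientCoveringMap.exists_pullback (hq : IsQuotientCoveringMap q G) {f : X → B}
    (hf : Continuous f) : ∃ _ : MulAction G {p : X × E // f p.1 = q p.2},
      IsQuotientCoveringMap (fun p : {p : X × E // f p.1 = q p.2} => p.1.1) G := by
  have := hq.toContinuousConstSMul
  let a : MulAction G {p : X × E // f p.1 = q p.2} :=
    { smul := fun g p => ⟨(p.1.1, g • p.1.2), p.2.trans (hq.map_smul g).symm⟩
      one_smul := fun p => Subtype.ext (Prod.ext rfl (one_smul G p.1.2))
      mul_smul := fun g h p => Subtype.ext (Prod.ext rfl (mul_smul g h p.1.2)) }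
  have hopen : IsOpenMap (fun p : {p : X × E // f p.1 = q p.2} => p.1.1) := by
    rw [isOpenMap_iff_nhds_le]
    rintro ⟨⟨x, e⟩, hxe⟩ S hS
    rw [Filter.mem_map, nhds_subtype_eq_comap] at hS
    obtain ⟨T, hT, hTS⟩ := hS
    rw [nhds_prod_eq] at hT
    obtain ⟨U, hU, V, hV, hUV⟩ := Filter.mem_prod_iff.1 hT
    have h1 : q '' V ∈ nhds (f x) := by
      rw [show f x = q e from hxe]
      exact hq.isOpenQuotientMap.isOpenMap.image_mem_nhds hV
    filter_upwards [hU, hf.continuousAt.preimage_mem_nhds h1] with y hy ⟨e', he', h'⟩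
    exact hTS (show (⟨(y, e'), h'.symm⟩ : {p : X × E // f p.1 = q p.2}) ∈ Subtype.val ⁻¹' T from
      hUV ⟨hy, he'⟩)
  have hsurj : Function.Surjective (fun p : {p : X × E // f p.1 = q p.2} => p.1.1) := fun x => by
    obtain ⟨e, he⟩ := hq.surjective (f x)
    exact ⟨⟨(x, e), he.symm⟩, rfl⟩
  refine ⟨a, ⟨hopen.isQuotientMap (by fun_prop) hsurj,
    ⟨fun g => Continuous.subtype_mk (by fun_prop) _⟩, fun {x y} => ⟨fun h => ?_, ?_⟩, fun p => ?_⟩⟩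
  · have h1 : q x.1.2 = q y.1.2 := by rw [← x.2, ← y.2]; exact congrArg f h
    obtain ⟨g, hg⟩ := hq.apply_eq_iff_mem_orbit.1 h1
    exact ⟨g, Subtype.ext (Prod.ext h.symm hg)⟩
  · rintro ⟨g, rfl⟩
    rfl
  · obtain ⟨U, hU, h⟩ := hq.disjoint p.1.2
    refine ⟨(fun p : {p : X × E // f p.1 = q p.2} => p.1.2) ⁻¹' U,
      ContinuousAt.preimage_mem_nhds (by fun_prop) hU, fun g => ?_⟩
    rintro ⟨_, ⟨y, hy, rfl⟩, hy'⟩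
    exact h g ⟨g • y.1.2, ⟨y.1.2, hy, rfl⟩, hy'⟩

end Pullback

section ResiduallyP

/-- Finitely many elements of a residually (finite `p`-) group can be detected by a single
finite `p`-quotient. -/
lemma ResiduallyFiniteP.exists_normal {p : ℕ} {G : Type u} [Group G] (hG : ResiduallyFiniteP p G)
    (S : Finset G) : ∃ (N : Subgroup G) (_ : N.Normal), Finite (G ⧸ N) ∧ IsPGroup p (G ⧸ N) ∧
      ∀ g ∈ S, g ∈ N → g = 1 := by
  classical
  -- In this form the condition visibly passes to the intersection of two normal subgroups, by
  -- adding exponents.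
  have hp : ∀ (N : Subgroup G) [N.Normal], IsPGroup p (G ⧸ N) ↔ ∀ g : G, ∃ k : ℕ, g ^ p ^ k ∈ N := by
    intro N _
    constructor
    · intro h g
      obtain ⟨k, hk⟩ := h (g : G ⧸ N)
      exact ⟨k, (QuotientGroup.eq_one_iff _).1 hk⟩
    · intro h a
      induction a using QuotientGroup.induction_on with | _ g
      obtain ⟨k, hk⟩ := h g
      exact ⟨k, (QuotientGroup.eq_one_iff _).2 hk⟩
  induction S using Finset.induction_on with
  | empty =>
    refine ⟨⊤, inferInstance, ?_, ?_, by simp⟩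
    · have : Subsingleton (G ⧸ (⊤ : Subgroup G)) := QuotientGroup.subsingleton_quotient_top
      infer_instance
    · exact (hp ⊤).2 fun g => ⟨0, trivial⟩
  | insert a S _ ih =>
    obtain ⟨N, hN, hf, hpN, h⟩ := ih
    by_cases ha : a = 1
    · refine ⟨N, hN, hf, hpN, fun g hg hgN => ?_⟩
      rcases Finset.mem_insert.1 hg with rfl | hg
      · exact ha
      · exact h g hg hgN
    · obtain ⟨M, hM, hfM, hpM, haM⟩ := hG a ha
      have h1 : N.FiniteIndex := Subgroup.finiteIndex_of_finite_quotient
      have h2 : M.FiniteIndex := Subgroup.finiteIndex_of_finite_quotient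
      refine ⟨N ⊓ M, inferInstance, inferInstance, (hp _).2 fun g => ?_, fun g hg hgN => ?_⟩
      · obtain ⟨k, hk⟩ := (hp N).1 hpN g
        obtain ⟨l, hl⟩ := (hp M).1 hpM g
        refine ⟨k + l, ?_, ?_⟩
        · rw [pow_add, pow_mul]
          exact N.pow_mem hk _
        · rw [pow_add, mul_comm, pow_mul]
          exact M.pow_mem hl _
      · rcases Finset.mem_insert.1 hg with rfl | hg
        · exact absurd hgN.2 haM
        · exact h g hg hgN.1

/-- A compact space in a regular covering with residually (finite `p`-) group embeds in a finite
regular covering. -/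
lemma ResiduallyFiniteP.exists_injective {p : ℕ} {G : Type u} [Group G]
    (hG : ResiduallyFiniteP p G) {X Z Y : Type*} [TopologicalSpace X] [CompactSpace X]
    [TopologicalSpace Z] [TopologicalSpace Y] [T2Space Y] [MulAction G Z] {q : Z → Y}
    (hq : IsQuotientCoveringMap q G) {i : X → Z} (hi : Continuous i) (hinj : Function.Injective i) :
    ∃ (N : Subgroup G) (_ : N.Normal), Finite (G ⧸ N) ∧ IsPGroup p (G ⧸ N) ∧
      Function.Injective fun x => Quotient.mk (MulAction.orbitRel N Z) (i x) := by
  have := hq.toContinuousConstSMul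
  let K := {z : X × X // q (i z.1) = q (i z.2)}
  have hK : CompactSpace K := by
    have : IsClosed {z : X × X | q (i z.1) = q (i z.2)} := isClosed_eq
      ((hq.continuous.comp hi).comp continuous_fst) ((hq.continuous.comp hi).comp continuous_snd)
    exact isCompact_iff_compactSpace.1 this.isCompact
  -- `γ` records the group element relating two points of `X` in the same fibre. It is locally
  -- constant on the compact space `K`, so it takes finitely many values, and `N` is chosen to avoid
  -- the nontrivial ones.
  choose γ hγ using fun z : K => hq.apply_eq_iff_mem_orbit.1 z.2
  have hγ : ∀ z : K, γ z • i z.1.2 = i z.1.1 := hγ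
  have hloc : IsLocallyConstant γ := by
    rw [IsLocallyConstant.iff_eventually_eq]
    intro z
    obtain ⟨U, hU, h⟩ := hq.disjoint (i z.1.1)
    have h1 : ∀ᶠ y : K in nhds z, i y.1.1 ∈ U :=
      (show Continuous fun y : K => i y.1.1 by fun_prop).continuousAt.preimage_mem_nhds hU
    have h2 : ∀ᶠ y : K in nhds z, γ z • i y.1.2 ∈ U := by
      refine (show Continuous fun y : K => γ z • i y.1.2 by
        fun_prop).continuousAt.preimage_mem_nhds ?_
      rwa [hγ]
    filter_upwards [h1, h2] with y hy1 hy2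
    have h3 := h (γ y * (γ z)⁻¹) ⟨i y.1.1, ⟨_, hy2, ?_⟩, hy1⟩
    · rwa [mul_inv_eq_one] at h3
    · simp only [mul_smul, inv_smul_smul, hγ]
  obtain ⟨N, hN, hf, hpN, h⟩ := hG.exists_normal hloc.range_finite.toFinset
  refine ⟨N, hN, hf, hpN, fun x y hxy => ?_⟩
  obtain ⟨n, hn⟩ := Quotient.exact hxy
  have hn : (n : G) • i y = i x := hn
  have h1 : q (i x) = q (i y) := by rw [← hn, hq.map_smul]
  have h2 : γ ⟨(x, y), h1⟩ = n := by
    have := hq.isCancelSMul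
    exact IsCancelSMul.right_cancel _ _ (i y) ((hγ ⟨(x, y), h1⟩).trans hn.symm)
  have h3 : (n : G) = 1 := h n (by
    rw [Set.Finite.mem_toFinset]
    exact ⟨_, h2⟩) n.2
  rw [h3, one_smul] at hn
  exact (hinj hn).symm

end ResiduallyP

section Components

variable {F : Type v} [Field F] {X : Type u} [TopologicalSpace X]

lemma finite_homology_and_add_le_of_disjoint {U V : Set X} (hU : IsOpen U) (hV : IsOpen V)
    (hUV : U ∪ V = Set.univ) (hd : Disjoint U V) {n : ℕ}
    (h : Module.Finite F (singularHomologyOver.{u, v} F n X)) :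
    (Module.Finite F (singularHomologyOver.{u, v} F n U) ∧
      Module.Finite F (singularHomologyOver.{u, v} F n V)) ∧
      bettiNumber.{u, v} F n U + bettiNumber.{u, v} F n V ≤ bettiNumber.{u, v} F n X := by
  have : IsEmpty ↥(U ∩ V) := Set.isEmpty_coe_sort.2 (Set.disjoint_iff_inter_eq_empty.1 hd)
  have hs := (spaceEuler_of_isEmpty (F := F) (X := ↥(U ∩ V)) 0).subsingleton n n.zero_le
  obtain ⟨a, b, δ, hab, -⟩ := exists_mayerVietoris_of_isOpen (F := F) hU hV hUV
  have hb : Function.Injective (b n) := by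
    rw [injective_iff_map_eq_zero]
    intro x hx
    obtain ⟨y, rfl⟩ := (hab n x).1 hx
    rw [Subsingleton.elim y 0, map_zero]
  have hf := Module.Finite.of_injective _ hb
  have h1 := Module.Finite.of_injective (LinearMap.inl F
    (singularHomologyOver.{u, v} F n U) (singularHomologyOver.{u, v} F n V)) LinearMap.inl_injective
  have h2 := Module.Finite.of_injective (LinearMap.inr F
    (singularHomologyOver.{u, v} F n U) (singularHomologyOver.{u, v} F n V)) LinearMap.inr_injective
  exact ⟨⟨h1, h2⟩, bettiNumber_add_le hU hV hUV hs h1 h2 h⟩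

/-- For a disjoint clopen splitting the overlap is empty, so homology of the pieces injects;
finiteness of each piece is inherited from `X`. -/
lemma sum_bettiNumber_le_of_disjoint {ι : Type*} {U : ι → Set X} (hU : ∀ i, IsClopen (U i))
    (hd : ∀ i j, i ≠ j → Disjoint (U i) (U j)) {n : ℕ}
    (h : Module.Finite F (singularHomologyOver.{u, v} F n X)) (s : Finset ι) :
    ∑ i ∈ s, bettiNumber.{u, v} F n (U i) ≤ bettiNumber.{u, v} F n X := by
  classical
  have hcl : ∀ s : Finset ι, IsClopen (⋃ i ∈ s, U i) := fun s => s.finite_toSet.isClopen_biUnion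
    fun i _ => hU i
  have hle : ∀ W : Set X, IsClopen W → Module.Finite F (singularHomologyOver.{u, v} F n W) ∧
      bettiNumber.{u, v} F n W ≤ bettiNumber.{u, v} F n X := fun W hW => by
    obtain ⟨⟨h1, -⟩, h2⟩ := finite_homology_and_add_le_of_disjoint hW.isOpen hW.compl.isOpen
      (Set.union_compl_self W) disjoint_compl_right h
    exact ⟨h1, (Nat.le_add_right _ _).trans h2⟩
  suffices key : ∑ i ∈ s, bettiNumber.{u, v} F n (U i) ≤ bettiNumber.{u, v} F n ↥(⋃ i ∈ s, U i) from
    key.trans (hle _ (hcl s)).2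
  induction s using Finset.induction_on with
  | empty => simp
  | insert a s ha ih =>
    rw [Finset.sum_insert ha]
    have hf := (hle _ (hcl (insert a s))).1
    have h1 : U a ⊆ ⋃ i ∈ insert a s, U i := fun z hz =>
      Set.mem_biUnion (Finset.mem_insert_self a s) hz
    have h2 : (⋃ i ∈ s, U i) ⊆ ⋃ i ∈ insert a s, U i :=
      Set.biUnion_subset_biUnion_left fun i hi => Finset.mem_insert_of_mem hi
    have h3 := (finite_homology_and_add_le_of_disjoint (X := ↥(⋃ i ∈ insert a s, U i))
      (U := {z | z.1 ∈ U a}) (V := {z | z.1 ∈ ⋃ i ∈ s, U i})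
      ((hU a).isOpen.preimage continuous_subtype_val)
      ((hcl s).isOpen.preimage continuous_subtype_val)
      (Set.eq_univ_of_forall fun z => by
        obtain ⟨i, hi, hz⟩ := Set.mem_iUnion₂.1 z.2
        rcases Finset.mem_insert.1 hi with rfl | hi
        · exact Or.inl hz
        · exact Or.inr (Set.mem_biUnion hi hz))
      (Set.disjoint_left.2 fun z hz hz' => by
        obtain ⟨i, hi, hz'⟩ := Set.mem_iUnion₂.1 hz'
        exact Set.disjoint_left.1 (hd a i (by rintro rfl; exact ha hi)) hz hz') hf).2
    rw [bettiNumber_eq_of_homotopyEquiv (homeomorphSubsetOfSubset h1).toHomotopyEquiv,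
      bettiNumber_eq_of_homotopyEquiv (homeomorphSubsetOfSubset h2).toHomotopyEquiv] at h3
    omega

/-- A path component `C` of a finite regular covering of a connected space is a regular covering
whose group is the stabilizer `H` of the component, if the path components are closed and open. -/
lemma IsQuotientCoveringMap.exists_component {G : Type w} [Group G] [Finite G]
    {E : Type u} [TopologicalSpace E] [MulAction G E] [CompactSpace E] {q : E → X} [T2Space X]
    [ConnectedSpace X]
    (hq : IsQuotientCoveringMap q G) (hE : ∀ z : E, IsClopen (pathComponent z)) (z : E) {n : ℕ}
    (hf : Module.Finite F (singularHomologyOver.{u, v} F n E)) :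
    ∃ (H : Subgroup G) (_ : MulAction H (pathComponent z)),
      IsQuotientCoveringMap (fun x : pathComponent z => q x.1) H ∧
      H.index * bettiNumber.{u, v} F n (pathComponent z) ≤ bettiNumber.{u, v} F n E := by
  have := hq.toContinuousConstSMul
  have hsm : ∀ (g : G) {x y : E}, Joined x y → Joined (g • x) (g • y) := fun g x y h =>
    h.map (continuous_const_smul g)
  let H : Subgroup G :=
    { carrier := {g | Joined z (g • z)}
      mul_mem' := fun {a b} ha hb => by
        have := hsm a hb
        rw [← mul_smul] at this
        exact ha.trans this
      one_mem' := by simpa using Joined.refl z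
      inv_mem' := fun {a} ha => by
        have := hsm a⁻¹ ha
        rw [inv_smul_smul] at this
        exact this.symm }
  have hH : ∀ g, g ∈ H ↔ Joined z (g • z) := fun g => Iff.rfl
  let act : MulAction H (pathComponent z) :=
    { smul := fun h x => ⟨(h : G) • x.1, ((hH _).1 h.2).trans (hsm h x.2)⟩
      one_smul := fun x => Subtype.ext (one_smul G x.1)
      mul_smul := fun g h x => Subtype.ext (mul_smul (g : G) (h : G) x.1) }
  have hopen : IsOpenMap (fun x : pathComponent z => q x.1) :=
    hq.isOpenQuotientMap.isOpenMap.comp (hE z).isOpen.isOpenMap_subtype_val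
  have hcont : Continuous (fun x : pathComponent z => q x.1) :=
    hq.continuous.comp continuous_subtype_val
  -- The image of the component is open because `q` is, and compact, hence closed; connectedness of
  -- `X` makes it everything.
  have hsurj : Function.Surjective (fun x : pathComponent z => q x.1) := by
    have : CompactSpace (pathComponent z) := isCompact_iff_compactSpace.1 (hE z).isClosed.isCompact
    rw [← Set.range_eq_univ]
    exact IsClopen.eq_univ ⟨(isCompact_range hcont).isClosed, hopen.isOpen_range⟩
      ⟨_, ⟨z, mem_pathComponent_self z⟩, rfl⟩
  refine ⟨H, act, ⟨hopen.isQuotientMap hcont hsurj, ⟨fun h => ?_⟩, fun {x y} => ⟨?_, ?_⟩,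
    fun x => ?_⟩, ?_⟩
  · exact Continuous.subtype_mk (by fun_prop) _
  · intro hxy
    obtain ⟨g, hg⟩ := hq.apply_eq_iff_mem_orbit.1 hxy
    have hg : g • y.1 = x.1 := hg
    have hgH : g ∈ H := by
      have h1 := hsm g y.2
      rw [hg] at h1
      exact (show Joined z x.1 from x.2).trans h1.symm
    exact ⟨⟨g, hgH⟩, Subtype.ext hg⟩
  · rintro ⟨h, rfl⟩
    exact hq.map_smul (h : G)
  · obtain ⟨U, hU, h⟩ := hq.disjoint x.1
    refine ⟨Subtype.val ⁻¹' U, continuous_subtype_val.continuousAt.preimage_mem_nhds hU,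
      fun g => ?_⟩
    rintro ⟨_, ⟨y, hy, rfl⟩, hy'⟩
    exact Subtype.ext (h g ⟨(g : G) • y.1, ⟨y.1, hy, rfl⟩, hy'⟩)
  · have := Fintype.ofFinite (G ⧸ H)
    -- One translate of the component per coset of its stabilizer; they are pairwise disjoint and
    -- mutually homeomorphic, which produces the factor `H.index`.
    let U : G ⧸ H → Set E := fun a => pathComponent (a.out • z)
    have h1 := sum_bettiNumber_le_of_disjoint (U := U) (fun a => hE _) (fun a b hab => by
      refine Set.disjoint_left.2 fun y hy hy' => hab ?_
      have h2 : Joined (a.out • z) (b.out • z) :=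
        (show Joined (a.out • z) y from hy).trans (show Joined (b.out • z) y from hy').symm
      have h3 := hsm a.out⁻¹ h2
      rw [inv_smul_smul, ← mul_smul] at h3
      have h4 : (a.out : G ⧸ H) = (b.out : G ⧸ H) := QuotientGroup.eq.2 h3
      rwa [QuotientGroup.out_eq', QuotientGroup.out_eq'] at h4) hf Finset.univ
    have h2 : ∀ a, bettiNumber.{u, v} F n (U a) = bettiNumber.{u, v} F n (pathComponent z) := by
      intro a
      have e : pathComponent z ≃ₜ U a :=
        (Homeomorph.smul a.out).subtype fun x => by
          refine ⟨fun h => hsm _ h, fun h => ?_⟩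
          have := hsm a.out⁻¹ (show Joined (a.out • z) (a.out • x) from h)
          rwa [inv_smul_smul, inv_smul_smul] at this
      exact (bettiNumber_eq_of_homotopyEquiv e.toHomotopyEquiv n).symm
    simp only [h2, Finset.sum_const, smul_eq_mul] at h1
    rwa [Subgroup.index, Nat.card_eq_fintype_card]

end Components
end

/-! ### Small coverings along one stage of a tower -/

section

namespace CellDecomposition

variable {E : Type u} [TopologicalSpace E] {J : Type w} (D : CellDecomposition E J)

/-- The open cells of a decomposition are homeomorphic to open balls. -/
lemma exists_homeomorph_openCell [T2Space E] (j : J) :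
    ∃ κ : D.openCell j ≃ₜ {x : Disk (D.dim j) // ‖x.1‖ < 1}, ∀ z, D.map j (κ z).1 = z.1 := by
  -- Boundary points land in cells of smaller dimension, so the open ball is the full preimage of
  -- the open cell and closedness of the characteristic map restricts to it.
  have hpre : ∀ x, D.map j x ∈ D.openCell j ↔ ‖x.1‖ < 1 := fun x => by
    refine ⟨fun ⟨y, hy, h⟩ => (Disk.lt_or_eq x).resolve_right fun hx => ?_, fun hx => ⟨x, hx, rfl⟩⟩
    obtain ⟨i, w, hi, hw, hwx⟩ := D.frontier j x hx
    obtain rfl := D.eq_of_map_eq i j w y hw hy (hwx.trans h.symm)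
    exact lt_irrefl _ hi
  let f := (D.openCell j).restrictPreimage (D.map j)
  have hf : IsClosedMap f := (D.map j).continuous.isProperMap.isClosedMap.restrictPreimage _
  have hb : Function.Bijective f := by
    refine ⟨fun x y h => Subtype.ext (D.injOn j _ _ ((hpre _).1 x.2) ((hpre _).1 y.2)
      (congrArg Subtype.val h)), ?_⟩
    rintro ⟨_, x, hx, rfl⟩
    exact ⟨⟨x, x, hx, rfl⟩, rfl⟩
  let e := (Equiv.ofBijective f hb).toHomeomorphOfContinuousClosed
    (D.map j).continuous.restrictPreimage hf
  refine ⟨e.symm.trans ((Homeomorph.refl _).subtype hpre), fun z => ?_⟩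
  exact congrArg Subtype.val (e.apply_symm_apply z)

end CellDecomposition

/-- `Y` has regular coverings whose groups are finite `p`-groups (with total space not necessarily
connected) and whose normalized `d`-th Betti numbers are arbitrarily small. -/
def HasSmallCoverings (p : ℕ) (F : Type v) [Field F] (d : ℕ) (Y : Type u) [TopologicalSpace Y] :
    Prop :=
  ∀ ε : ℝ, 0 < ε → ∃ (E : Type u) (_ : TopologicalSpace E) (G : Type u) (_ : Group G)
    (_ : MulAction G E) (q : E → Y) (m : ℕ), IsQuotientCoveringMap q G ∧ Nat.card G = p ^ m ∧
      (bettiNumber.{u, v} F d E : ℝ) ≤ ε * (Nat.card G : ℝ)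

section Towers

variable {F : Type v} [Field F]

/-- Let `f : X → Y` map open cells onto open cells and let `j : X → Z` be a lift of `f` to a
covering `q : Z → Y`. If the lift `Ψ` to `Z` of an open cell of `Y` meets the image of `j`, then it
is contained in it. -/
lemma CellDecomposition.mem_range_of_mem_range {X Y Z I J G : Type*} [TopologicalSpace X]
    [TopologicalSpace Y] [TopologicalSpace Z] [T2Space Y] [Group G] [MulAction G Z]
    (DX : CellDecomposition X I) (DY : CellDecomposition Y J) {f : X → Y} {q : Z → Y}
    (hq : IsQuotientCoveringMap q G) {j : X → Z} (hj : Continuous j) (hqj : ∀ x, q (j x) = f x)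
    (hcells : ∀ c, ∃ c', f '' DX.openCell c = DY.openCell c') (k : J) (Ψ : C(Disk (DY.dim k), Z))
    (hΨq : ∀ x, q (Ψ x) = DY.map k x) (x y) (hx : ‖x.1‖ < 1) (hy : ‖y.1‖ < 1)
    (h : ∃ a, Ψ x = j a) : ∃ a, Ψ y = j a := by
  have hf : Continuous f := by
    rw [← funext hqj]
    exact hq.continuous.comp hj
  obtain ⟨a, ha⟩ := h
  obtain ⟨c', y₀, hy₀, rfl⟩ := DX.cover a
  obtain ⟨k', hk⟩ := hcells c'
  have hfx : f (DX.map c' y₀) = DY.map k x := by rw [← hqj, ← ha, hΨq]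
  have hkc : k' = k := by
    have h1 : f (DX.map c' y₀) ∈ DY.openCell k' := hk ▸ ⟨_, ⟨y₀, hy₀, rfl⟩, rfl⟩
    rw [hfx] at h1
    exact ((DY.map_mem_openCell_iff hx).1 h1).symm
  rw [hkc] at hk
  obtain ⟨κ, hκ⟩ := DY.exists_homeomorph_openCell k
  have hB : PreconnectedSpace {y : Disk (DX.dim c') // ‖y.1‖ < 1} := by
    have e : Metric.ball (0 : Fin (DX.dim c') → ℝ) 1 ≃ₜ {y : Disk (DX.dim c') // ‖y.1‖ < 1} :=
      { toFun := fun y => ⟨⟨y.1, Metric.ball_subset_closedBall y.2⟩, mem_ball_zero_iff.1 y.2⟩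
        invFun := fun y => ⟨y.1.1, mem_ball_zero_iff.2 y.2⟩
        left_inv := fun _ => rfl
        right_inv := fun _ => rfl
        continuous_toFun := by fun_prop
        continuous_invFun := by fun_prop }
    have : PreconnectedSpace (Metric.ball (0 : Fin (DX.dim c') → ℝ) 1) :=
      Subtype.preconnectedSpace (convex_ball _ _).isPreconnected
    exact e.surjective.denseRange.preconnectedSpace e.continuous
  have hmem : ∀ y : {y : Disk (DX.dim c') // ‖y.1‖ < 1}, f (DX.map c' y.1) ∈ DY.openCell k := fun y =>
    hk ▸ ⟨_, ⟨y.1, y.2, rfl⟩, rfl⟩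
  -- `φ` expresses `f` on the cell `c'` in the coordinates of the cell `k`, so that the lift through
  -- `j` and the lift through `Ψ` can be compared on one domain.
  let φ : {y : Disk (DX.dim c') // ‖y.1‖ < 1} → Disk (DY.dim k) := fun y => (κ ⟨f (DX.map c' y.1), hmem y⟩).1
  have hφc : Continuous φ := by
    refine continuous_subtype_val.comp (κ.continuous.comp (Continuous.subtype_mk ?_ _))
    fun_prop
  have hφ : ∀ y, DY.map k (φ y) = f (DX.map c' y.1) := fun y => hκ _
  have hφ1 : ∀ y, ‖(φ y).1‖ < 1 := fun y => (κ _).2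
  -- Two lifts of the same map on a connected open ball that agree at `y₀`.
  have hg : (fun y : {y : Disk (DX.dim c') // ‖y.1‖ < 1} => j (DX.map c' y.1)) = fun y => Ψ (φ y) := by
    refine hq.isCoveringMap.eq_of_comp_eq (by fun_prop) ?_ ?_ ⟨y₀, hy₀⟩ ?_
    · exact Ψ.continuous.comp hφc
    · ext1 y
      simp only [Function.comp_apply]
      rw [hqj, hΨq, hφ]
    · have : φ ⟨y₀, hy₀⟩ = x := DY.injOn _ _ _ (hφ1 _) hx ((hφ _).trans hfx)
      rw [this]
      exact ha.symm
  have hy' : DY.map k y ∈ f '' DX.openCell c' := by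
    rw [hk]
    exact ⟨y, hy, rfl⟩
  obtain ⟨_, ⟨w, hw, rfl⟩, hwy⟩ := hy'
  have : φ ⟨w, hw⟩ = y := DY.injOn _ _ _ (hφ1 _) hy ((hφ _).trans hwy)
  refine ⟨DX.map c' w, ?_⟩
  rw [← this]
  exact (congrFun hg ⟨w, hw⟩).symm

/-- Small coverings of `Y` induce small coverings of a finite subcomplex `X` of a residually
(finite `p`-) covering of `Y`. -/
lemma HasSmallCoverings.of_elementary {p : ℕ} [Fact p.Prime] [CharP F p] {d : ℕ}
    {X Y Z I J G : Type u} [TopologicalSpace X] [TopologicalSpace Y] [TopologicalSpace Z]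
    [T2Space Y] [Group G] [MulAction G Z] [Finite I] [Finite J] (DX : CellDecomposition X I)
    (DY : CellDecomposition Y J) (hd : ∀ j, DY.dim j ≤ d) {q : Z → Y}
    (hq : IsQuotientCoveringMap q G) (hG : ResiduallyFiniteP p G) {i : X → Z} (hi : Continuous i)
    (hinj : Function.Injective i)
    (hcells : ∀ c, ∃ c', (q ∘ i) '' DX.openCell c = DY.openCell c')
    (hY : HasSmallCoverings.{u, v} p F d Y) : HasSmallCoverings.{u, v} p F d X := by
  have : CompactSpace X := DX.compactSpace
  obtain ⟨N, hN, hQf, hQp, hNinj⟩ := hG.exists_injective hq hi hinj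
  have hp : p.Prime := Fact.out
  obtain ⟨k, hk⟩ := (IsPGroup.iff_card (p := p)).1 hQp
  have hqN := hq.isQuotientCoveringMap_quotientLift N
  have hpk : (0 : ℝ) < (p : ℝ) ^ k := pow_pos (by exact_mod_cast hp.pos) k
  intro ε hε
  -- The factor `p ^ k = |G/N|` will be lost in passing from `E` to `E ×_Y Z/N`; it depends only on
  -- `X`, not on `ε`.
  obtain ⟨E, _, H, _, _, r, m, hr, hH, hE⟩ := hY (ε / p ^ k) (div_pos hε hpk)
  have hHf : Finite H := Nat.finite_of_card_ne_zero (by rw [hH]; exact pow_ne_zero _ hp.ne_zero)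
  have hiN : Continuous fun x => Quotient.mk (MulAction.orbitRel N Z) (i x) :=
    continuous_quot_mk.comp hi
  obtain ⟨_, hX⟩ := hr.exists_pullback (hq.continuous.comp hi)
  obtain ⟨_, hE2⟩ := hqN.exists_pullback hr.continuous
  have : T2Space E := hr.isCoveringMap.t2Space
  have : T2Space (Quotient (MulAction.orbitRel N Z)) := hqN.isCoveringMap.t2Space
  have : CompactSpace {p : X × E // (q ∘ i) p.1 = r p.2} := (DX.lift hX).compactSpace
  have := Fintype.ofFinite J
  have := Fintype.ofFinite H
  have hEfin : Module.Finite F (singularHomologyOver.{u, v} F d E) :=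
    ((DY.lift hr).spaceEuler (F := F) (N := d + 1) fun j => Nat.succ_le_succ (hd j.1)).finite d
  obtain ⟨-, hb⟩ := bettiNumber_le_of_card_eq_prime_pow p d hEfin k _ _ _ hE2 hk
  -- The embedding `X ×_Y E → E ×_Y Z/N`, injective because `X → Z/N` is.
  let φ : {p : X × E // (q ∘ i) p.1 = r p.2} →
      {p : E × Quotient (MulAction.orbitRel N Z) // r p.1 = hq.quotientLift N p.2} :=
    fun z => ⟨(z.1.2, Quotient.mk _ (i z.1.1)), z.2.symm⟩
  have hφ : Continuous φ := Continuous.subtype_mk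
    ((continuous_snd.comp continuous_subtype_val).prodMk
      (hiN.comp (continuous_fst.comp continuous_subtype_val))) _
  have hφi : Function.Injective φ := fun z w h => by
    have h1 := congrArg (fun y => y.1.1) h
    have h2 := congrArg (fun y => y.1.2) h
    exact Subtype.ext (Prod.ext (hNinj h2) h1)
  have hφe := hφ.isClosedEmbedding hφi
  have hrange : ∀ z, z ∈ Set.range φ ↔ ∃ a, z.1.2 = Quotient.mk _ (i a) := by
    intro z
    constructor
    · rintro ⟨w, rfl⟩
      exact ⟨w.1.1, rfl⟩
    · rintro ⟨a, ha⟩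
      refine ⟨⟨(a, z.1.1), ?_⟩, Subtype.ext (Prod.ext rfl ha.symm)⟩
      rw [z.2, ha]
      rfl
  -- The image of `φ` is the preimage of the image of `X` in `Z/N`. Cells of `E ×_Y Z/N` project to
  -- lifts of cells of `Y`, each inside or outside that image, so the image of `φ` is a closed union
  -- of open cells and the top-degree comparison applies.
  have hle := ((DY.lift hr).lift hE2).bettiNumber_le_of_isClosed (F := F) (n := d)
    (fun c => hd c.1.1) hφe.isClosed_range (fun c x y hx hy h => by
      rw [hrange] at h ⊢
      exact DX.mem_range_of_mem_range DY hqN hiN (fun _ => rfl) hcells c.1.1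
        ⟨fun x => (((DY.lift hr).lift hE2).map c x).1.2, by
          exact (continuous_snd.comp continuous_subtype_val).comp
            (((DY.lift hr).lift hE2).map c).continuous⟩
        (fun x => (((DY.lift hr).lift hE2).map c x).2.symm.trans
          ((congrArg r ((DY.lift hr).map_lift hE2 c x)).trans (DY.map_lift hr c.1 x)))
        x y hx hy h)
  rw [← bettiNumber_eq_of_homotopyEquiv hφe.isEmbedding.toHomeomorph.toHomotopyEquiv] at hle
  refine ⟨_, inferInstance, H, inferInstance, inferInstance, _, m, hX, hH, ?_⟩
  have h1 : (bettiNumber.{u, v} F d {p : X × E // (q ∘ i) p.1 = r p.2} : ℝ) ≤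
      (p : ℝ) ^ k * bettiNumber.{u, v} F d E := by exact_mod_cast hle.trans hb
  refine h1.trans ((mul_le_mul_of_nonneg_left hE hpk.le).trans_eq ?_)
  field_simp

end Towers
end

/-! ### The infimum, towers and the Euler characteristic -/

section

section BetaInf

variable {p : ℕ} {F : Type v} [Field F] {d : ℕ}

/-- The identity is a regular covering with trivial group. -/
lemma exists_isQuotientCoveringMap_id (Y : Type u) [TopologicalSpace Y] :
    ∃ _ : MulAction PUnit.{u + 1} Y, IsQuotientCoveringMap (id : Y → Y) PUnit.{u + 1} := by
  let a : MulAction PUnit.{u + 1} Y :=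
    { smul := fun _ y => y
      one_smul := fun _ => rfl
      mul_smul := fun _ _ _ => rfl }
  refine ⟨a, ⟨Topology.IsQuotientMap.id, ⟨fun _ => continuous_id⟩, fun {x y} => ⟨?_, ?_⟩,
    fun y => ⟨Set.univ, Filter.univ_mem, fun _ _ => rfl⟩⟩⟩
  · rintro rfl
    exact ⟨PUnit.unit, rfl⟩
  · rintro ⟨_, rfl⟩
    rfl

/-- The trivial covering keeps the set nonempty; without it `sInf` would be `0` by convention and
the bound would yield no covering. -/
lemma exists_connected_covering_of_betaInfP_lt {Y : Type u} [TopologicalSpace Y]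
    [ConnectedSpace Y] {ε : ℝ} (h : betaInfP.{u, v} p F d Y < ε) :
    ∃ (Y' : Type u) (_ : TopologicalSpace Y') (_ : ConnectedSpace Y')
      (G : Type u) (_ : Group G) (_ : MulAction G Y') (q : Y' → Y) (m : ℕ),
      IsQuotientCoveringMap q G ∧ Nat.card G = p ^ m ∧
        (bettiNumber.{u, v} F d Y' : ℝ) / (Nat.card G : ℝ) < ε := by
  obtain ⟨_, hid⟩ := exists_isQuotientCoveringMap_id Y
  have hr := exists_lt_of_csInf_lt (by
    exact ⟨_, Y, inferInstance, inferInstance, PUnit.{u + 1}, inferInstance, inferInstance, id, 0,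
      hid, by simp, rfl⟩) h
  obtain ⟨_, ⟨Y', _, hc, G, _, _, q, m, hq, hG, rfl⟩, hr⟩ := hr
  exact ⟨Y', _, hc, G, _, _, q, m, hq, hG, hr⟩

lemma HasSmallCoverings.of_betaInfP_eq_zero (hp : p.Prime) {Y : Type u} [TopologicalSpace Y]
    [ConnectedSpace Y] (h : betaInfP.{u, v} p F d Y = 0) : HasSmallCoverings.{u, v} p F d Y := by
  intro ε hε
  obtain ⟨Y', _, _, G, _, _, q, m, hq, hG, hr⟩ :=
    exists_connected_covering_of_betaInfP_lt (h.trans_lt hε)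
  refine ⟨Y', inferInstance, G, inferInstance, inferInstance, q, m, hq, hG, ?_⟩
  have hpos : (0 : ℝ) < Nat.card G := by
    rw [hG]
    exact_mod_cast pow_pos hp.pos m
  exact ((div_lt_iff₀ hpos).1 hr).le

/-- Passing to connected components, arbitrarily small coverings make the infimum vanish. -/
lemma HasSmallCoverings.betaInfP_eq_zero [Fact p.Prime] {X : Type u} [TopologicalSpace X]
    [T2Space X] [ConnectedSpace X] {I : Type w} [Finite I] (D : CellDecomposition X I)
    (hd : ∀ j, D.dim j ≤ d) (h : HasSmallCoverings.{u, v} p F d X) :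
    betaInfP.{u, v} p F d X = 0 := by
  have hp : p.Prime := Fact.out
  have hnonneg : ∀ r ∈ {r : ℝ | ∃ (Y' : Type u) (_ : TopologicalSpace Y') (_ : ConnectedSpace Y')
      (G : Type u) (_ : Group G) (_ : MulAction G Y') (q : Y' → X) (m : ℕ),
      IsQuotientCoveringMap q G ∧ Nat.card G = p ^ m ∧
        r = (bettiNumber.{u, v} F d Y' : ℝ) / (Nat.card G : ℝ)}, 0 ≤ r := by
    rintro _ ⟨Y', _, _, G, _, _, q, m, -, -, rfl⟩
    positivity
  refine le_antisymm (le_of_forall_pos_le_add fun ε hε => ?_) (Real.sInf_nonneg hnonneg)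
  rw [zero_add]
  obtain ⟨E, _, G, _, _, q, m, hq, hG, hE⟩ := h ε hε
  have hGf : Finite G := Nat.finite_of_card_ne_zero (by rw [hG]; exact pow_ne_zero _ hp.ne_zero)
  have := Fintype.ofFinite I
  have := Fintype.ofFinite G
  have : T2Space E := hq.isCoveringMap.t2Space
  have : CompactSpace E := (D.lift hq).compactSpace
  have hfin : Module.Finite F (singularHomologyOver.{u, v} F d E) :=
    ((D.lift hq).spaceEuler (F := F) (N := d + 1) fun j => Nat.succ_le_succ (hd j.1)).finite d
  obtain ⟨z, -⟩ := hq.surjective (Classical.arbitrary X)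
  -- A component has normalized Betti number at most that of `E`: the index of its stabilizer
  -- cancels against `|G| = [G : H] |H|`.
  obtain ⟨H, _, hH, hle⟩ := hq.exists_component (D.lift hq).isClopen_pathComponent z hfin
  have : PathConnectedSpace (pathComponent z) :=
    isPathConnected_iff_pathConnectedSpace.1 isPathConnected_pathComponent
  obtain ⟨k, hk⟩ := (IsPGroup.iff_card (p := p)).1 ((IsPGroup.of_card hG).to_subgroup H)
  refine (csInf_le ⟨0, hnonneg⟩ ⟨pathComponent z, inferInstance, inferInstance, H, inferInstance,
    inferInstance, _, k, hH, hk, rfl⟩).trans ?_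
  have hHpos : (0 : ℝ) < Nat.card H := by exact_mod_cast Nat.card_pos
  have hipos : (0 : ℝ) < H.index := by
    exact_mod_cast Nat.pos_of_ne_zero H.index_ne_zero_of_finite
  rw [div_le_iff₀ hHpos]
  have h1 : (H.index : ℝ) * bettiNumber.{u, v} F d (pathComponent z) ≤
      bettiNumber.{u, v} F d E := by exact_mod_cast hle
  rw [← H.index_mul_card, Nat.cast_mul] at hE
  refine le_of_mul_le_mul_left (h1.trans (hE.trans_eq ?_)) hipos
  ring

end BetaInf

namespace CWSpace

variable {p : ℕ} {F : Type v} [Field F] {d : ℕ}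

lemma IsElementaryTower.isEmpty_cell {𝓕 : (G : Type u) → [Group G] → Prop} {X Y : CWSpace.{u}}
    {f : X → Y} (h : IsElementaryTower 𝓕 X Y f) (n : ℕ) (hY : IsEmpty (Y.Cell n)) :
    IsEmpty (X.Cell n) := by
  obtain ⟨-, Z, G, _, _, i, q, -, hi, hq, -⟩ := h
  refine ⟨fun e => ?_⟩
  obtain ⟨e', -⟩ := hi.mapsCells n e
  obtain ⟨e'', -⟩ := hq.mapsCells n e'
  exact hY.false e''

lemma IsElementaryTower.hasSmallCoverings [Fact p.Prime] [CharP F p] {X Y : CWSpace.{u}}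
    {f : X → Y} (h : IsElementaryTower (fun G _ => ResiduallyFiniteP p G) X Y f)
    (hYfin : Y.IsFinite) (hYdim : ∀ n, d < n → IsEmpty (Y.Cell n))
    (hY : HasSmallCoverings.{u, v} p F d Y) : HasSmallCoverings.{u, v} p F d X := by
  obtain ⟨hX, Z, G, _, _, i, q, hG, hi, hq, -⟩ := h
  have := hX.finite
  have := hYfin.finite
  refine hY.of_elementary X.cellDecomposition Y.cellDecomposition (fun e => ?_)
    hq.isQuotientCoveringMap hG hi.isClosedEmbedding.continuous hi.isClosedEmbedding.injective
    fun e => ?_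
  · by_contra hlt
    exact (hYdim e.1 (not_le.1 hlt)).false e.2
  · obtain ⟨e', he'⟩ := hi.mapsCells e.1 e.2
    obtain ⟨e'', he''⟩ := hq.mapsCells e.1 e'
    refine ⟨⟨e.1, e''⟩, ?_⟩
    rw [cellDecomposition_openCell, cellDecomposition_openCell, Set.image_comp, he'.image_eq,
      he''.image_eq]

/-- Intermediate complexes of the tower may be disconnected, so the induction carries
`HasSmallCoverings` rather than the infimum, along with finiteness and the dimension bound. -/
lemma IsTower.hasSmallCoverings [Fact p.Prime] [CharP F p] {Y : CWSpace.{u}}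
    (hYfin : Y.IsFinite) (hYdim : ∀ n, d < n → IsEmpty (Y.Cell n))
    (hY : HasSmallCoverings.{u, v} p F d Y) {X : CWSpace.{u}} {f : X → Y}
    (h : IsTower (fun G _ => ResiduallyFiniteP p G) Y X f) :
    X.IsFinite ∧ (∀ n, d < n → IsEmpty (X.Cell n)) ∧ HasSmallCoverings.{u, v} p F d X := by
  induction h with
  | elementary X f hf =>
    exact ⟨hf.1, fun n hn => hf.isEmpty_cell n (hYdim n hn), hf.hasSmallCoverings hYfin hYdim hY⟩
  | step X Y' f g _ hf ih =>
    obtain ⟨h1, h2, h3⟩ := ih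
    exact ⟨hf.1, fun n hn => hf.isEmpty_cell n (h2 n hn), hf.hasSmallCoverings h1 h2 h3⟩

lemma sum_dim_cellDecomposition (X : CWSpace.{u}) [Fintype (Σ n, X.Cell n)]
    (hX : ∀ n, d < n → IsEmpty (X.Cell n)) :
    ∑ e, (-1 : ℤ) ^ X.cellDecomposition.dim e = X.eulerCharacteristic := by
  classical
  have hfin : ∀ n, Finite (X.Cell n) := fun n =>
    Finite.of_injective (fun e => (⟨n, e⟩ : Σ n, X.Cell n)) sigma_mk_injective
  rw [eulerCharacteristic, finsum_eq_sum_of_support_subset (s := Finset.range (d + 1))]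
  · rw [← Finset.sum_fiberwise_of_maps_to (g := fun e : Σ n, X.Cell n => e.1)
      (t := Finset.range (d + 1)) (fun e _ => ?_)]
    · refine Finset.sum_congr rfl fun n _ => ?_
      rw [Finset.sum_congr rfl (g := fun _ => (-1 : ℤ) ^ n) (fun e he => by
        rw [show X.cellDecomposition.dim e = n from (Finset.mem_filter.1 he).2]),
        Finset.sum_const, nsmul_eq_mul, mul_comm]
      congr 2
      rw [← Nat.card_congr (Equiv.sigmaSubtype (β := X.Cell) n), Nat.card_eq_fintype_card,
        Fintype.card_subtype]
    · rw [Finset.mem_range]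
      by_contra hlt
      exact (hX e.1 (by omega)).false e.2
  · intro n hn
    rw [Finset.coe_range, Set.mem_Iio]
    by_contra hlt
    have := hX n (by omega)
    simp at hn

/-- If the normalized second Betti numbers of a finite connected 2-complex are arbitrarily small
and its Euler characteristic is positive, then it is acyclic over `F`. -/
lemma betti_eq_zero_of_betaInfP_eq_zero (hp : p.Prime) (X : CWSpace.{u}) [ConnectedSpace X]
    (hXfin : X.IsFinite) (hX : ∀ n, 2 < n → IsEmpty (X.Cell n))
    (h : betaInfP.{u, v} p F 2 X = 0) (hχ : 0 < X.eulerCharacteristic) :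
    bettiNumber.{u, v} F 1 X = 0 ∧ bettiNumber.{u, v} F 2 X = 0 ∧ X.eulerCharacteristic = 1 := by
  have := hXfin.finite
  have := Fintype.ofFinite (Σ n, X.Cell n)
  obtain ⟨X', _, _, G, _, _, q, m, hq, hG, hr⟩ :=
    -- With the bound `1 / 2`, positivity of `χ` gives `|G| ≤ 1 + b_2(X') < 1 + |G| / 2`, which
    -- leaves only `|G| = 1`.
    exists_connected_covering_of_betaInfP_lt (h.trans_lt (by norm_num : (0 : ℝ) < 1 / 2))
  have hGpos : 0 < Nat.card G := by
    rw [hG]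
    exact pow_pos hp.pos m
  have hGf : Finite G := Nat.finite_of_card_ne_zero hGpos.ne'
  have := Fintype.ofFinite G
  have : T2Space X' := hq.isCoveringMap.t2Space
  let D := X.cellDecomposition.lift hq
  have hdim : ∀ c, D.dim c + 1 ≤ 3 := fun c => by
    by_contra hlt
    exact (hX c.1.1 (by
      have : D.dim c = c.1.1 := rfl
      omega)).false c.1.2
  have hE := (D.spaceEuler (F := F) hdim).sum_eq
  have hsum : ∑ c, (-1 : ℤ) ^ D.dim c = Nat.card G * X.eulerCharacteristic := by
    rw [← X.sum_dim_cellDecomposition hX, Fintype.sum_prod_type, Finset.mul_sum]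
    refine Finset.sum_congr rfl fun e _ => ?_
    show ∑ _g : G, (-1 : ℤ) ^ X.cellDecomposition.dim e = _
    rw [Finset.sum_const, nsmul_eq_mul, Finset.card_univ, Nat.card_eq_fintype_card]
  have : PathConnectedSpace X' := D.pathConnectedSpace
  have h0 : Module.finrank F (singularHomologyOver.{u, v} F 0 X') = 1 := by
    rw [(nonempty_homology_zero_equiv (F := F) (X := X')).some.finrank_eq, Module.finrank_self]
  rw [hsum, Finset.sum_range_succ, Finset.sum_range_succ, Finset.sum_range_succ,
    Finset.sum_range_zero, h0] at hE
  change 0 + (-1 : ℤ) ^ 0 * ((1 : ℕ) : ℤ) + (-1) ^ 1 * (bettiNumber.{u, v} F 1 X' : ℤ) +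
    (-1) ^ 2 * (bettiNumber.{u, v} F 2 X' : ℤ) = _ at hE
  rw [div_lt_iff₀ (by exact_mod_cast hGpos)] at hr
  have hr' : 2 * bettiNumber.{u, v} F 2 X' < Nat.card G := by
    have : (2 : ℝ) * bettiNumber.{u, v} F 2 X' < Nat.card G := by linarith
    exact_mod_cast this
  have hle : (Nat.card G : ℤ) ≤ Nat.card G * X.eulerCharacteristic :=
    le_mul_of_one_le_right (by positivity) hχ
  have hG1 : Nat.card G = 1 := by omega
  obtain ⟨e⟩ := hq.nonempty_homeomorph hG1
  rw [← bettiNumber_eq_of_homotopyEquiv e.toHomotopyEquiv,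
    ← bettiNumber_eq_of_homotopyEquiv e.toHomotopyEquiv]
  rw [hG1] at hE hr'
  omega

end CWSpace

theorem mainTheorem2 (p : ℕ) (hp : p.Prime) (d : ℕ) (hd : 2 ≤ d)
    (F : Type v) [Field F] [CharP F p]
    (X Y : CWSpace.{u}) [ConnectedSpace X] [ConnectedSpace Y]
    (hXfin : X.IsFinite) (hYfin : Y.IsFinite)
    (hXdim : X.HasDimension d) (hYdim : Y.HasDimension d)
    (f : X → Y) (hf : CWSpace.IsTower (fun G _ => ResiduallyFiniteP p G) Y X f)
    (hY : betaInfP.{u, v} p F d Y = 0) :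
    betaInfP.{u, v} p F d X = 0 ∧
      (d = 2 →
        X.eulerCharacteristic ≤ 0 ∨
          (bettiNumber.{u, v} F 1 X = 0 ∧ bettiNumber.{u, v} F 2 X = 0 ∧
            X.eulerCharacteristic = 1)) := by
  have : Fact p.Prime := ⟨hp⟩
  obtain ⟨-, -, h⟩ := CWSpace.IsTower.hasSmallCoverings (F := F) hYfin hYdim.2
    (HasSmallCoverings.of_betaInfP_eq_zero hp hY) hf
  have := hXfin.finite
  have hβ : betaInfP.{u, v} p F d X = 0 := h.betaInfP_eq_zero X.cellDecomposition fun e => by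
    by_contra hlt
    exact (hXdim.2 e.1 (not_le.1 hlt)).false e.2
  refine ⟨hβ, ?_⟩
  rintro rfl
  by_cases hχ : X.eulerCharacteristic ≤ 0
  · exact Or.inl hχ
  · exact Or.inr (X.betti_eq_zero_of_betaInfP_eq_zero hp hXfin hXdim.2 hβ (not_le.1 hχ))
end
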